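/- All Hilbert spaces are finite-dimensional. Write $\mathbb P_m$ for the $4^m$ tensor products of the Pauli matrices $I,X,Y,Z$ on $m$ qubits, and let the Clifford group $\mathcal C_m$ be the group of $m$-qubit unitaries $V$, identified up to a global phase, such that for every $P\in\mathbb P_m$ there is $\alpha\in\{\pm1,\pm i\}$ with $\alpha VPV^\dagger\in\mathbb P_m$. Let $D(\rho,\sigma)=\frac12\operatorname{tr}\sqrt{(\rho-\sigma)^\dagger(\rho-\sigma)}$. **The Clifford code.** Let $n,d\ge 0$ and let $\Omega_M$ be an $n$-qubit state. The message register $M$ has $n$ qubits, the code register $C$ has $n+d$ qubits, and the flag register $F$ is a qubit with orthogonal basis states $|\mathrm{acc}\rangle,|\mathrm{rej}\rangle$. The keys $k\in\mathcal K$ index the elements $C_k$ of $\mathcal C_{n+d}$. With $\mathcal P_{acc}=\mathbb 1^{\otimes n}\otimes|0\rangle\langle0|^{\otimes d}$ and $\mathcal P_{rej}=\mathbb 1-\mathcal P_{acc}$, $$\mathcal E_k(\rho_M)=C_k(\rho_M\otimes|0\rangle\langle 0|^{\otimes d})C_k^\dagger,$$ $$\mathcal D_k(\rho_C)=\operatorname{tr}_0(\mathcal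 P_{acc}C_k^\dagger\rho_C C_k\mathcal P_{acc}^\dagger)\otimes|\mathrm{acc}\rangle\langle \mathrm{acc}|+\operatorname{tr}_{M,0}(\mathcal P_{rej}C_k^\dagger\rho_C C_k\mathcal P_{rej}^\dagger)\,\Omega_M\otimes|\mathrm{rej}\rangle\langle \mathrm{rej}|,$$ where $\operatorname{tr}_0$ is the trace over the $d$ trap qubits. **Real world.** An attack is a unitary $U_{CR}$ on $C$ and a reference register $R$. For the key $k$ it gives the channel $\mathscr E_k(\rho_{MR})=(\mathcal D_k\otimes \mathbb 1_R)\big(U_{CR}\,(\mathcal E_k\otimes\mathbb 1_R)(\rho_{MR})\,U_{CR}^\dagger\big)$. **Ideal world.** The simulator prepares $n+d$ EPR pairs $|\Phi^+\rangle\langle\Phi^+|^{\otimes(n+d)}_{C_1C_2}$, applies the attack to $C_1R$ in place of $CR$, measures the pairs in the Bell basis, and accepts if every pair is found in $|\Phi^+\rangle$ and rejects otherwise. With $\mathcal P^{\mathscr U}_{acc}=\mathbb 1\otimes|\Phi^+\rangle\langle\Phi^+|^{\otimes(n+d)}_{C_1C_2}$, $\mathcal P^{\mathscr U}_{rej}=\mathbb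 1-\mathcal P^{\mathscr U}_{acc}$ and $x\in\{acc,rej\}$, its two branches are $$\mathscr U^{x}(\rho_R)=\operatorname{tr}_{C_1C_2}\!\big(\mathcal P^{\mathscr U}_{x}U_{C_1R}(\rho_R\otimes|\Phi^+\rangle\langle\Phi^+|^{\otimes(n+d)}_{C_1C_2})U_{C_1R}^\dagger\mathcal P^{\mathscr U\dagger}_{x}\big),$$ and the ideal channel is $$\mathscr F(\rho_{MR})=(\mathbb 1_M\otimes\mathscr U^{acc})(\rho_{MR})\otimes|\mathrm{acc}\rangle\langle \mathrm{acc}|+\Omega_M\otimes\operatorname{tr}_M\!\big((\mathbb 1_M\otimes\mathscr U^{rej})(\rho_{MR})\big)\otimes|\mathrm{rej}\rangle\langle \mathrm{rej}|.$$ **Theorem.** Let $d=d(n)$ be the number of trap qubits and $\Omega_M=\Omega_n$ the fixed state used for $n$-qubit messages. 1. The Clifford code is a quantum message authentication scheme: all $\mathcal E_k,\mathcal D_k$ are completely positive and trace preserving, and $\mathcal D_k(\mathcal E_k(\rho_M))=\rho_M\otimes|\mathrm{acc}\rangle\langle \mathrm{acc}|$ for every state $\rho_M$ and every $k$. 2.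 It is $\frac{3}{2^d}$-secure: for every $n$, every $R$ and every attack $U_{CR}$, the maps $\mathscr U^{acc},\mathscr U^{rej}$ are completely positive, their sum is trace preserving, and for all states $\rho_{MR}$ $$D\Big(\frac1{|\mathcal K|}\sum_{k\in\mathcal K}\mathscr E_k(\rho_{MR}),\ \mathscr F(\rho_{MR})\Big)\le\frac{3}{2^{d}}.$$ 3. The simulation is efficient whenever the attack is: suppose that $1^n\mapsto 1^{d(n)}$ is computable in polynomial time and that the states $\Omega_n$ are polynomial-time generated (as they are when the scheme is polynomial-time). If the attacks $\rho\mapsto U_{CR}\,\rho\, U_{CR}^\dagger$, for $n=0,1,2,\dots$, on $R$ of $r(n)$ qubits, form a polynomial-time family, then so do the ideal channels $\mathscr F$. Here a family of quantum maps indexed by $n$ is polynomial-time if it is performed by quantum circuits (over the gates $H$, $T$, $X$, CNOT, Toffoli, with ancillas in $|0\rangle$ and discarded qubits) whose descriptions are computable from $1^n$ in time polynomial in $n$; states are polynomial-time generated if such a family without input prepares them. -/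

import Mathlib

open scoped Matrix Kronecker ComplexOrder

noncomputable section

namespace QAuth

/-! ### Registers, operators, channels -/

/-- Operators on the finite-dimensional Hilbert space with orthonormal basis `A`. -/
abbrev Op (A : Type) : Type := Matrix A A ℂ

/-- Computational basis labels of a register of `m` qubits. -/
abbrev Qubits (m : ℕ) : Type := Fin m → Fin 2

/-- Two adjacent qubit registers seen as one. -/
abbrev join (a b : ℕ) : Qubits a × Qubits b ≃ Qubits (a + b) := Fin.appendEquiv a b

/-- The projector `|a⟩⟨a|` onto a basis vector. -/
def proj {A : Type} [DecidableEq A] (a : A) : Op A := Matrix.single a a 1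

/-- Density operators. -/
def IsDensity {A : Type} [Fintype A] (ρ : Op A) : Prop := ρ.PosSemidef ∧ ρ.trace = 1

/-- The trace norm `tr √(X† X)`: the sum of the square roots of the eigenvalues of `X† X`. -/
def traceNorm {A : Type} [Fintype A] [DecidableEq A] (X : Op A) : ℝ :=
  ∑ i, Real.sqrt ((Matrix.isHermitian_conjTranspose_mul_self X).eigenvalues i)

def traceDist {A : Type} [Fintype A] [DecidableEq A] (ρ σ : Op A) : ℝ :=
  (1 / 2) * traceNorm (ρ - σ)

/-- `Φ ⊗ Id` -/
def onLeft {A B : Type} (R : Type) (Φ : Op A → Op B) (X : Op (A × R)) : Op (B × R) :=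
  Matrix.of fun u v => Φ (Matrix.of fun a a' => X (a, u.2) (a', v.2)) u.1 v.1

/-- `Id ⊗ Φ` -/
def onRight {A B : Type} (R : Type) (Φ : Op A → Op B) (X : Op (R × A)) : Op (R × B) :=
  Matrix.of fun u v => Φ (Matrix.of fun a a' => X (u.1, a) (v.1, a')) u.2 v.2

/-- Partial trace over the first factor. -/
def traceFst {A B : Type} [Fintype A] (X : Op (A × B)) : Op B :=
  Matrix.of fun b b' => ∑ a, X (a, b) (a, b')

/-- Partial trace over the second factor. -/
def traceSnd {A B : Type} [Fintype B] (X : Op (A × B)) : Op A :=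
  Matrix.of fun a a' => ∑ b, X (a, b) (a', b)

def IsCPMap {A B : Type} [Fintype A] [Fintype B] (Φ : Op A → Op B) : Prop :=
  IsLinearMap ℂ Φ ∧
    ∀ (m : ℕ) (X : Op (A × Fin m)), X.PosSemidef → (onLeft (Fin m) Φ X).PosSemidef

def IsTracePreserving {A B : Type} [Fintype A] [Fintype B] (Φ : Op A → Op B) : Prop :=
  ∀ X, (Φ X).trace = X.trace

/-- Quantum channels: completely positive trace preserving maps. -/
def IsChannel {A B : Type} [Fintype A] [Fintype B] (Φ : Op A → Op B) : Prop :=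
  IsCPMap Φ ∧ IsTracePreserving Φ

/-- The same map after renaming the bases of its input and output spaces. -/
def transport {A A' B B' : Type} (e : A ≃ A') (f : B ≃ B') (Φ : Op A → Op B) :
    Op A' → Op B' :=
  fun X => Matrix.reindex f f (Φ (Matrix.reindex e.symm e.symm X))

/-! ### Authentication schemes and their security -/

/-- The flag register is one qubit. -/
abbrev Flag : Type := Qubits 1

def accept : Op Flag := proj (fun _ => 1)

def reject : Op Flag := proj (fun _ => 0)

/-- Keyed encoding maps `M → C` and decoding maps `C → M F`. -/
structure Scheme (M C K : Type) where
  enc : K → Op M → Op C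
  dec : K → Op C → Op (M × Flag)

/-- Encodings and decodings are channels, and decoding an untouched codeword returns the message
and accepts. -/
structure Scheme.IsAuthenticationScheme {M C K : Type} [Fintype M] [Fintype C]
    (S : Scheme M C K) : Prop where
  enc_channel : ∀ k, IsChannel (S.enc k)
  dec_channel : ∀ k, IsChannel (S.dec k)
  correct : ∀ k ρ, IsDensity ρ → S.dec k (S.enc k ρ) = ρ ⊗ₖ accept

/-- The reordering `M F R → M R F` of registers. -/
def reorder (M R : Type) : (M × Flag) × R ≃ (M × R) × Flag where
  toFun x := ((x.1.1, x.2), x.1.2)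
  invFun x := ((x.1.1, x.2), x.1.2)
  left_inv _ := rfl
  right_inv _ := rfl

/-- The real-world channel for the key `k` and the unitary attack `U` on `C R`. -/
def Scheme.real {M C K R : Type} [Fintype C] [Fintype R] [DecidableEq C] [DecidableEq R]
    (S : Scheme M C K) (U : Matrix.unitaryGroup (C × R) ℂ) (k : K) (ρ : Op (M × R)) :
    Op ((M × R) × Flag) :=
  Matrix.reindex (reorder M R) (reorder M R)
    (onLeft R (S.dec k) ((U : Op (C × R)) * onLeft R (S.enc k) ρ * (U : Op (C × R))ᴴ))

/-- The real-world output for a uniformly random key. -/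
def Scheme.realAverage {M C K R : Type} [Fintype K] [Fintype C] [Fintype R] [DecidableEq C]
    [DecidableEq R] (S : Scheme M C K) (U : Matrix.unitaryGroup (C × R) ℂ) (ρ : Op (M × R)) :
    Op ((M × R) × Flag) :=
  (Fintype.card K : ℂ)⁻¹ • ∑ k, S.real U k ρ

/-- A simulator acts on the reference register alone; one branch selects accept, the other one
reject, and together they form a channel. -/
def IsSimulator {R : Type} [Fintype R] (acc rej : Op R → Op R) : Prop :=
  IsCPMap acc ∧ IsCPMap rej ∧ IsTracePreserving fun X => acc X + rej X

/-- The ideal channel: on accept `M` is left intact, on reject it is discarded and replaced by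
the fixed state `Ω`. -/
def ideal {M R : Type} [Fintype M] (Ω : Op M) (acc rej : Op R → Op R) (ρ : Op (M × R)) :
    Op ((M × R) × Flag) :=
  onRight M acc ρ ⊗ₖ accept + (Ω ⊗ₖ traceFst (onRight M rej ρ)) ⊗ₖ reject

/-! ### Pauli matrices, the Clifford group, the Clifford code -/

/-- The single-qubit Pauli matrices `I, X, Y, Z`. -/
def pauliOne : Fin 4 → Matrix (Fin 2) (Fin 2) ℂ :=
  ![1, !![0, 1; 1, 0], !![0, -Complex.I; Complex.I, 0], !![1, 0; 0, -1]]

/-- The `m`-qubit Pauli matrix `P₁ ⊗ ⋯ ⊗ Pₘ`. -/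
def pauli {m : ℕ} (p : Fin m → Fin 4) : Op (Qubits m) :=
  Matrix.of fun x y => ∏ i, pauliOne (p i) (x i) (y i)

/-- Unitaries mapping Paulis to Paulis, up to a phase `±1, ±i`, by conjugation. -/
def IsClifford {m : ℕ} (V : Matrix.unitaryGroup (Qubits m) ℂ) : Prop :=
  ∀ p : Fin m → Fin 4, ∃ q : Fin m → Fin 4,
    ∃ α ∈ ({1, -1, Complex.I, -Complex.I} : Set ℂ),
      α • ((V : Op (Qubits m)) * pauli p * (V : Op (Qubits m))ᴴ) = pauli q

/-- Equality up to a global phase. -/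
def phaseSetoid (m : ℕ) : Setoid {V : Matrix.unitaryGroup (Qubits m) ℂ // IsClifford V} where
  r V W := ∃ z : ℂ, ‖z‖ = 1 ∧ (W.1 : Op (Qubits m)) = z • (V.1 : Op (Qubits m))
  iseqv :=
    { refl := fun V => ⟨1, by simp, by simp⟩
      symm := by
        rintro V W ⟨z, hz, h⟩
        have h0 : z ≠ 0 := by
          intro h0
          simp [h0] at hz
        exact ⟨z⁻¹, by simp [hz], by rw [h, smul_smul, inv_mul_cancel₀ h0, one_smul]⟩
      trans := by
        rintro V W X ⟨z, hz, h⟩ ⟨w, hw, h'⟩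
        exact ⟨w * z, by simp [hz, hw], by rw [h', h, smul_smul]⟩ }

/-- The keys: the elements of the `m`-qubit Clifford group. A global phase has no effect on
conjugation, so Cliffords that differ by one are the same key; this makes the group finite. -/
def CliffordKey (m : ℕ) : Type := Quotient (phaseSetoid m)

/-- The `k`-th Clifford. -/
def CliffordKey.op {m : ℕ} (k : CliffordKey m) : Op (Qubits m) :=
  ((Quotient.out k : {V : Matrix.unitaryGroup (Qubits m) ℂ // IsClifford V}).1 : Op (Qubits m))

theorem scalar_of_commute_pauli {m : ℕ} (W : Op (Qubits m))
    (hW : ∀ p : Fin m → Fin 4, W * pauli p = pauli p * W) :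
    ∃ z : ℂ, W = z • (1 : Op (Qubits m)) := by
  have hoff : ∀ x y : Qubits m, x ≠ y → W x y = 0 := by
    intro x y hxy
    obtain ⟨i, hi⟩ := Function.ne_iff.mp hxy
    set p : Fin m → Fin 4 := Function.update 0 i 3 with hp
    have hdiag : ∀ u v : Qubits m,
        pauli p u v = if u = v then (if u i = 0 then (1 : ℂ) else -1) else 0 := by
      intro u v
      by_cases huv : u = v
      · subst huv
        rw [if_pos rfl]
        simp only [pauli, Matrix.of_apply]
        rw [Finset.prod_eq_single i]
        · have : u i = 0 ∨ u i = 1 := by omega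
          rcases this with h | h <;> simp [hp, h, pauliOne]
        · intro j _ hj
          simp [hp, Function.update_of_ne hj, pauliOne]
        · simp
      · rw [if_neg huv]
        obtain ⟨j, hj⟩ := Function.ne_iff.mp huv
        simp only [pauli, Matrix.of_apply]
        apply Finset.prod_eq_zero (Finset.mem_univ j)
        by_cases hji : j = i
        · subst hji
          have h1 : (u j = 0 ∧ v j = 1) ∨ (u j = 1 ∧ v j = 0) := by omega
          rcases h1 with ⟨h, h'⟩ | ⟨h, h'⟩ <;> simp [hp, h, h', pauliOne]
        · simp [hp, Function.update_of_ne hji, pauliOne, Matrix.one_apply_ne hj]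
    have h := congrFun (congrFun (hW p) x) y
    simp only [Matrix.mul_apply, hdiag] at h
    simp only [mul_ite, mul_zero, ite_mul, zero_mul, Finset.sum_ite_eq,
      Finset.sum_ite_eq', Finset.mem_univ, if_true] at h
    have h1 : (x i = 0 ∧ y i = 1) ∨ (x i = 1 ∧ y i = 0) := by omega
    rcases h1 with ⟨h2, h3⟩ | ⟨h2, h3⟩ <;> simp [h2, h3] at h
    · exact self_eq_neg.mp h.symm
    · exact self_eq_neg.mp h
  have hcon : ∀ x y : Qubits m, W x x = W y y := by
    intro x y
    set p : Fin m → Fin 4 := fun i => if x i = y i then 0 else 1 with hp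
    have hone : pauli p x y = 1 := by
      simp only [pauli, Matrix.of_apply]
      apply Finset.prod_eq_one
      intro i _
      by_cases hi : x i = y i
      · simp [hp, hi, pauliOne]
      · have h1 : (x i = 0 ∧ y i = 1) ∨ (x i = 1 ∧ y i = 0) := by omega
        rcases h1 with ⟨h, h'⟩ | ⟨h, h'⟩ <;> simp [hp, h, h', pauliOne]
    have h := congrFun (congrFun (hW p) x) y
    simp only [Matrix.mul_apply] at h
    rw [Finset.sum_eq_single x (fun z _ hz => by rw [hoff x z hz.symm, zero_mul]) (by simp),
      Finset.sum_eq_single y (fun z _ hz => by rw [hoff z y hz, mul_zero]) (by simp),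
      hone, mul_one, one_mul] at h
    exact h
  refine ⟨W 0 0, ?_⟩
  ext x y
  by_cases hxy : x = y
  · subst hxy
    simp [hcon x 0]
  · simp [Matrix.one_apply_ne hxy, hoff x y hxy]

instance (m : ℕ) : Finite (CliffordKey m) := by
  classical
  have hfin : (({1, -1, Complex.I, -Complex.I} : Set ℂ)).Finite := by simp
  have := hfin.to_subtype
  have hex : ∀ (k : CliffordKey m) (p : Fin m → Fin 4),
      ∃ c : (Fin m → Fin 4) × ({1, -1, Complex.I, -Complex.I} : Set ℂ),
        (c.2 : ℂ) • (k.op * pauli p * k.opᴴ) = pauli c.1 := by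
    intro k p
    obtain ⟨q, α, hα, h⟩ := (Quotient.out k).2 p
    exact ⟨(q, ⟨α, hα⟩), h⟩
  choose F hF using hex
  refine Finite.of_injective F ?_
  intro k l hkl
  have hne : ∀ a : ({1, -1, Complex.I, -Complex.I} : Set ℂ), (a : ℂ) ≠ 0 := by
    rintro ⟨a, ha⟩
    simp only [Set.mem_insert_iff, Set.mem_singleton_iff] at ha
    rcases ha with h | h | h | h <;> simp [h]
  have hact : ∀ p, k.op * pauli p * k.opᴴ = l.op * pauli p * l.opᴴ := by
    intro p
    have h1 := hF k p
    have h2 := hF l p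
    rw [← hkl, ← h1] at h2
    exact (smul_right_injective _ (hne (F k p).2) h2).symm
  have hk1 : k.opᴴ * k.op = 1 := Matrix.mem_unitaryGroup_iff'.mp (Quotient.out k).1.2
  have hl1 : l.opᴴ * l.op = 1 := Matrix.mem_unitaryGroup_iff'.mp (Quotient.out l).1.2
  have hk2 : k.op * k.opᴴ = 1 := Matrix.mem_unitaryGroup_iff.mp (Quotient.out k).1.2
  have hl2 : l.op * l.opᴴ = 1 := Matrix.mem_unitaryGroup_iff.mp (Quotient.out l).1.2
  obtain ⟨z, hz⟩ := scalar_of_commute_pauli (k.opᴴ * l.op) (by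
    intro p
    calc k.opᴴ * l.op * pauli p
        = k.opᴴ * (l.op * pauli p * l.opᴴ) * l.op := by
          simp only [Matrix.mul_assoc, hl1, Matrix.mul_one]
      _ = k.opᴴ * (k.op * pauli p * k.opᴴ) * l.op := by rw [hact p]
      _ = (k.opᴴ * k.op) * (pauli p * (k.opᴴ * l.op)) := by
          simp only [Matrix.mul_assoc]
      _ = pauli p * (k.opᴴ * l.op) := by rw [hk1, Matrix.one_mul])
  have hlk : l.op = z • k.op := by
    have h := congrArg (fun Y => k.op * Y) hz
    simpa [← Matrix.mul_assoc, hk2] using h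
  have hzz : ‖z‖ = 1 := by
    have h1 : (star z * z) • (1 : Op (Qubits m)) = 1 := by
      have h := hl1
      rw [hlk, Matrix.conjTranspose_smul, Matrix.smul_mul, Matrix.mul_smul, hk1, smul_smul] at h
      exact h
    have h2 := congrFun (congrFun h1 0) 0
    simp only [Matrix.smul_apply, Matrix.one_apply_eq, smul_eq_mul, mul_one] at h2
    have h3 := congrArg norm h2
    rw [norm_mul, norm_star, norm_one] at h3
    nlinarith [norm_nonneg z]
  rw [← Quotient.out_eq k, ← Quotient.out_eq l]
  exact Quotient.sound ⟨z, hzz, hlk⟩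

instance (m : ℕ) : Fintype (CliffordKey m) := Fintype.ofFinite _

/-- The projector `𝟙 ⊗ |0⟩⟨0|^{⊗ d}` on the code register. -/
def trapAcc (n d : ℕ) : Op (Qubits (n + d)) :=
  Matrix.reindex (join n d) (join n d) ((1 : Op (Qubits n)) ⊗ₖ proj (0 : Qubits d))

def trapRej (n d : ℕ) : Op (Qubits (n + d)) := 1 - trapAcc n d

/-- The Clifford code for `n`-qubit messages with `d` trap qubits, where `Ω` is the state that is
output on reject. -/
def cliffordCode (n d : ℕ) (Ω : Op (Qubits n)) :
    Scheme (Qubits n) (Qubits (n + d)) (CliffordKey (n + d)) where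
  enc k ρ := k.op * Matrix.reindex (join n d) (join n d) (ρ ⊗ₖ proj (0 : Qubits d)) * k.opᴴ
  dec k ρ :=
    traceSnd (Matrix.reindex (join n d).symm (join n d).symm
        (trapAcc n d * (k.opᴴ * ρ * k.op) * (trapAcc n d)ᴴ)) ⊗ₖ accept +
      ((trapRej n d * (k.opᴴ * ρ * k.op) * (trapRej n d)ᴴ).trace • Ω) ⊗ₖ reject

/-! ### The simulator -/

/-- Amplitudes of `|Φ⁺⟩^{⊗ m}`: the `i`-th qubit of `C₁` and the `i`-th qubit of `C₂` are in the
state `|Φ⁺⟩ = (|00⟩ + |11⟩) / √2`. -/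
def eprAmp {m : ℕ} (x y : Qubits m) : ℂ :=
  ∏ i, if x i = y i then ((Real.sqrt 2 : ℝ) : ℂ)⁻¹ else 0

/-- `ρ_R ⊗ |Φ⁺⟩⟨Φ⁺|^{⊗ m}` on the registers `(C₁ R) C₂`. -/
def eprState {m : ℕ} {R : Type} (ρ : Op R) : Op ((Qubits m × R) × Qubits m) :=
  Matrix.of fun u v =>
    ρ u.1.2 v.1.2 * (eprAmp u.1.1 u.2 * star (eprAmp v.1.1 v.2))

/-- `𝟙_R ⊗ |Φ⁺⟩⟨Φ⁺|^{⊗ m}`: the outcome of the Bell basis measurement of all pairs in which every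
pair is found intact. -/
def bellAcc (m : ℕ) (R : Type) [DecidableEq R] : Op ((Qubits m × R) × Qubits m) :=
  eprState (1 : Op R)

def bellRej (m : ℕ) (R : Type) [DecidableEq R] : Op ((Qubits m × R) × Qubits m) :=
  1 - bellAcc m R

/-- The attack `U` on `C₁ R` applied to half EPR pairs. -/
def attackedEpr {m : ℕ} {R : Type} [Fintype R] [DecidableEq R]
    (U : Matrix.unitaryGroup (Qubits m × R) ℂ) (ρ : Op R) : Op ((Qubits m × R) × Qubits m) :=
  ((U : Op (Qubits m × R)) ⊗ₖ (1 : Op (Qubits m))) * eprState ρ *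
    ((U : Op (Qubits m × R)) ⊗ₖ (1 : Op (Qubits m)))ᴴ

/-- The accepting branch of the simulator; `C₁` and `C₂` are traced out at the end. -/
def simAcc {m : ℕ} {R : Type} [Fintype R] [DecidableEq R]
    (U : Matrix.unitaryGroup (Qubits m × R) ℂ) (ρ : Op R) : Op R :=
  traceFst (traceSnd (bellAcc m R * attackedEpr U ρ * (bellAcc m R)ᴴ))

/-- The rejecting branch of the simulator. -/
def simRej {m : ℕ} {R : Type} [Fintype R] [DecidableEq R]
    (U : Matrix.unitaryGroup (Qubits m × R) ℂ) (ρ : Op R) : Op R :=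
  traceFst (traceSnd (bellRej m R * attackedEpr U ρ * (bellRej m R)ᴴ))

/-! ### Quantum circuits -/

/-- A fixed universal gate set. -/
inductive GateKind
  | hadamard
  | tGate
  | not
  | cnot
  | toffoli

def GateKind.arity : GateKind → ℕ
  | hadamard => 1
  | tGate => 1
  | not => 1
  | cnot => 2
  | toffoli => 3

def GateKind.matrix : (g : GateKind) → Op (Qubits g.arity)
  | hadamard => fun (x y : Qubits 1) =>
      ((Real.sqrt 2 : ℝ) : ℂ)⁻¹ * (if x 0 = 1 ∧ y 0 = 1 then -1 else 1)
  | tGate => fun (x y : Qubits 1) =>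
      if x = y then (if x 0 = 1 then Complex.exp (Complex.I * (Real.pi / 4)) else 1) else 0
  | not => fun (x y : Qubits 1) => if x 0 = y 0 + 1 then 1 else 0
  | cnot => fun (x y : Qubits 2) => if x 0 = y 0 ∧ x 1 = y 1 + y 0 then 1 else 0
  | toffoli => fun (x y : Qubits 3) =>
      if x 0 = y 0 ∧ x 1 = y 1 ∧ x 2 = y 2 + y 0 * y 1 then 1 else 0

/-- A gate applied to distinct wires of an `N`-wire circuit. -/
structure Gate (N : ℕ) where
  kind : GateKind
  wires : Fin kind.arity ↪ Fin N

open Classical in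
/-- The gate acts on its wires and as the identity on the others. -/
def Gate.matrix {N : ℕ} (g : Gate N) : Op (Qubits N) :=
  Matrix.of fun x y =>
    if ∀ j ∉ Set.range g.wires, x j = y j then
      g.kind.matrix (fun i => x (g.wires i)) (fun i => y (g.wires i))
    else 0

/-- A general quantum circuit with `a` input qubits and `b` output qubits on `N` wires. The wires
outside `input` start in `|0⟩` (ancillas), then the gates are applied from the first to the last,
and the wires outside `output` are traced out at the end. -/
structure Circuit (a b : ℕ) where
  N : ℕ
  input : Fin a ↪ Fin N
  gates : List (Gate N)
  output : Fin b ↪ Fin N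

/-- The product of the gates, the first gate rightmost. -/
def Circuit.unitary {a b : ℕ} (Q : Circuit a b) : Op (Qubits Q.N) :=
  Q.gates.foldl (fun V g => g.matrix * V) 1

open Classical in
/-- The isometry that places the input on the input wires and `|0⟩` on all others. -/
def Circuit.prepare {a b : ℕ} (Q : Circuit a b) : Matrix (Qubits Q.N) (Qubits a) ℂ :=
  Matrix.of fun z x =>
    if (∀ i, z (Q.input i) = x i) ∧ ∀ j ∉ Set.range Q.input, z j = 0 then 1 else 0

open Classical in
/-- Partial trace over all wires outside the output wires. -/
def Circuit.discard {a b : ℕ} (Q : Circuit a b) (Y : Op (Qubits Q.N)) : Op (Qubits b) :=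
  Matrix.of fun x y =>
    ∑ z, ∑ w,
      if (∀ i, z (Q.output i) = x i) ∧ (∀ i, w (Q.output i) = y i) ∧
          ∀ j ∉ Set.range Q.output, z j = w j then Y z w else 0

/-- The quantum map that a circuit performs. -/
def Circuit.channel {a b : ℕ} (Q : Circuit a b) (X : Op (Qubits a)) : Op (Qubits b) :=
  Q.discard (Q.unitary * (Q.prepare * X * Q.prepareᴴ) * Q.unitaryᴴ)

/-! ### Polynomial time -/

/-- Programs of a machine with finitely many stacks over the alphabet `Γ` (two stacks form a
Turing machine tape). The stacks are numbered; a program mentions only finitely many of them. -/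
inductive Program (Γ : Type)
  | skip
  | push (i : ℕ) (a : Γ)
  | pop (i : ℕ)
  | seq (p q : Program Γ)
  /-- run `p` or `q`, depending on the top symbol of stack `i` (`none` if it is empty) -/
  | cond (i : ℕ) (c : Option Γ → Bool) (p q : Program Γ)
  /-- repeat `p` as long as the top symbol of stack `i` satisfies `c` -/
  | loop (i : ℕ) (c : Option Γ → Bool) (p : Program Γ)

/-- `Runs p s t s'`: started with stack contents `s`, the program `p` halts with contents `s'`
after `t` elementary steps. A push, a pop, a test of a top symbol, and `skip` are one step each.
The first entry of a list is the top of the stack. -/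
inductive Runs {Γ : Type} : Program Γ → (ℕ → List Γ) → ℕ → (ℕ → List Γ) → Prop
  | skip (s) : Runs .skip s 1 s
  | push (i a s) : Runs (.push i a) s 1 (Function.update s i (a :: s i))
  | pop (i s) : Runs (.pop i) s 1 (Function.update s i (s i).tail)
  | seq {p q s t s' t' s''} : Runs p s t s' → Runs q s' t' s'' → Runs (.seq p q) s (t + t') s''
  | condTrue {i c p q s t s'} : c (s i).head? = true → Runs p s t s' →
      Runs (.cond i c p q) s (t + 1) s'
  | condFalse {i c p q s t s'} : c (s i).head? = false → Runs q s t s' →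
      Runs (.cond i c p q) s (t + 1) s'
  | loopDone {i c p s} : c (s i).head? = false → Runs (.loop i c p) s 1 s
  | loopStep {i c p s t s' t' s''} : c (s i).head? = true → Runs p s t s' →
      Runs (.loop i c p) s' t' s'' → Runs (.loop i c p) s (t + t' + 1) s''

/-- The finite alphabet for unary numbers and circuit descriptions. -/
inductive Sym
  | one
  | sep
  | mark
  | gate (g : GateKind)

/-- `n` in unary: `1ⁿ`. -/
def unary (n : ℕ) : List Sym := List.replicate n Sym.one

/-- The function that maps `1ⁿ` to the word `f n` is computable in time polynomial in `n`: the input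
is on stack `0`, the output on stack `1`, and all other stacks start empty. -/
def PolyTimeComputable (f : ℕ → List Sym) : Prop :=
  ∃ (p : Program Sym) (T : Polynomial ℕ), ∀ n, ∃ t s,
    Runs p (Function.update (fun _ => []) 0 (unary n)) t s ∧ s 1 = f n ∧ t ≤ T.eval n

/-- A wire (or a number), in unary with an end marker. -/
def encodeNat (i : ℕ) : List Sym := unary i ++ [Sym.sep]

/-- A list of wires. -/
def encodeWires {a N : ℕ} (w : Fin a ↪ Fin N) : List Sym :=
  (List.ofFn fun i => encodeNat (w i)).flatten

/-- The description of a circuit: the number of wires, the input wires, the gates with their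
wires, the output wires. -/
def Circuit.encode {a b : ℕ} (Q : Circuit a b) : List Sym :=
  encodeNat Q.N ++ encodeWires Q.input ++ [Sym.mark] ++
    (Q.gates.map fun g => Sym.gate g.kind :: encodeWires g.wires).flatten ++ [Sym.mark] ++
    encodeWires Q.output ++ [Sym.mark]

/-- A family of quantum maps on qubit registers is polynomial-time if it is performed by a
polynomial-time uniform family of quantum circuits. -/
def PolyTime {a b : ℕ → ℕ} (Φ : ∀ n, Op (Qubits (a n)) → Op (Qubits (b n))) : Prop :=
  ∃ Q : ∀ n, Circuit (a n) (b n),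
    PolyTimeComputable (fun n => (Q n).encode) ∧ ∀ n X, (Q n).channel X = Φ n X

/-- A family of states is polynomial-time generated if a polynomial-time map without input
(only ancillas in `|0⟩`) prepares it. -/
def PolyTimeGenerated {b : ℕ → ℕ} (Ω : ∀ n, Op (Qubits (b n))) : Prop :=
  PolyTime (a := fun _ => 0) (b := b) fun n X => X.trace • Ω n

/-- The attack `ρ ↦ U ρ U†` on the qubit registers `C R`, as a map on one register. -/
def attackMap {c r : ℕ} (U : Matrix.unitaryGroup (Qubits c × Qubits r) ℂ) :
    Op (Qubits (c + r)) → Op (Qubits (c + r)) :=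
  transport (join c r) (join c r) fun X =>
    (U : Op (Qubits c × Qubits r)) * X * (U : Op (Qubits c × Qubits r))ᴴ

/-- The ideal channel `M R → M R F` on qubit registers, as a map between single registers. -/
def idealMap {n r : ℕ} (Ω : Op (Qubits n)) (acc rej : Op (Qubits r) → Op (Qubits r)) :
    Op (Qubits (n + r)) → Op (Qubits (n + r + 1)) :=
  transport (join n r) (((join n r).prodCongr (Equiv.refl Flag)).trans (join (n + r) 1))
    (ideal Ω acc rej)

end QAuth

end

/-!
# The Clifford code is an efficiently simulatable quantum authentication scheme

**Correctness.** The traps come back in the state `|0⟩` when nobody interferes, and all maps involved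
are built from conjugations, partial traces and tensor products with fixed states
(`cliffordCode_isAuthenticationScheme`, `isSimulator`).

**Security.** Expand the attack as `U = ∑_P P ⊗ U_P` over the Pauli matrices on `C`
(`sum_pauli_kronecker_pauliCoeff`). Averaged over the keys, conjugation by the Clifford unitaries turns
the attack into a mixture. Cross terms between `P ≠ Q` vanish, because some Pauli matrix commutes with
exactly one of `P` and `Q` and so flips their sign (`sum_twirlTerm_of_ne`). A non-identity `P` turns into
a uniformly random non-identity Pauli matrix: if `P` and `Q` anticommute, the Clifford unitary
`(P + Q) / √2` exchanges them, and any two non-identity Pauli matrices have a common anticommuting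
one (`sum_twirlTerm_eq`, `average_twirlTerm`, `average_twirl`). The sum of all `4 ^ (n + d)` Pauli
conjugations is completely depolarizing, so all terms can be computed (`realAverage_eq`). On the
other side, the Bell measurement of the simulator projects on the term `U_𝟙` if it accepts and on
the sum of the others if it rejects (`simAcc_eq`, `simRej_eq`, `ideal_eq`). Thus the two worlds agree
up to the event that a random non-identity Pauli matrix leaves the traps intact. Their difference is
`X - Y` with positive `X` and `Y` of trace at most `2 ^ (n + d) * 2 ^ n / (4 ^ (n + d) - 1)`, which is
at most `3 / 2 ^ d` (`traceNorm_sub_le`, `weight_le`, `cliffordCode_secure`).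

**Efficiency.** The circuit of the ideal world prepares the EPR pairs with Hadamard and CNOT gates,
runs the circuit of the attack on `C₁ R` and that of the fixed state on fresh wires, and undoes the
preparation of the EPR pairs, which maps the Bell basis to the computational one. A chain of Toffoli
gates computes whether all measured bits are zero. The resulting flag controls a swap of the message
with the fixed state. No measurement is needed in the middle of the circuit, since discarding the
wires of the pairs at the end performs it. The given circuits are known only through the maps that
they perform; `traceWires_subcircuit` says that this is enough for their use inside a larger circuit.
The semantics of the whole circuit is `idealCircuit_channel`.

That the descriptions of these circuits are computable in polynomial time is shown on stack programs.
Programs are combined by giving them disjoint sets of stacks (`PolyTimeComputable.of_program`).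
A few programs on words then suffice: concatenation, cutting at a marker, substitution of a word for
a symbol (with which all wires of a given circuit are shifted), intervals of wires, and gates that
are produced from lists of wires by a template (`PolyTimeComputable.template`). The description of the
ideal circuit is composed of such words (`polyTimeComputable_idealCircuit`).
-/

open scoped Matrix Kronecker ComplexOrder

noncomputable section

namespace QAuth

/-! ### Completely positive maps -/

section CP
variable {A B C : Type} [Fintype A] [Fintype B] [Fintype C]

theorem IsCPMap.add {Φ Ψ : Op A → Op B} (h : IsCPMap Φ) (k : IsCPMap Ψ) :
    IsCPMap fun X => Φ X + Ψ X :=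
  ⟨⟨fun X Y => by rw [h.1.map_add, k.1.map_add]; abel,
    fun c X => by rw [h.1.map_smul, k.1.map_smul, smul_add]⟩,
   fun m X hX => (h.2 m X hX).add (k.2 m X hX)⟩

theorem IsCPMap.comp {Φ : Op B → Op C} {Ψ : Op A → Op B} (h : IsCPMap Φ) (k : IsCPMap Ψ) :
    IsCPMap fun X => Φ (Ψ X) :=
  ⟨⟨fun X Y => by rw [k.1.map_add, h.1.map_add],
    fun c X => by rw [k.1.map_smul, h.1.map_smul]⟩,
   fun m X hX => h.2 m _ (k.2 m X hX)⟩

theorem onLeft_conj [DecidableEq A] {R : Type} [Fintype R] [DecidableEq R] (K : Matrix B A ℂ)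
    (X : Op (A × R)) :
    onLeft R (fun X => K * X * Kᴴ) X = (K ⊗ₖ (1 : Op R)) * X * (K ⊗ₖ (1 : Op R))ᴴ := by
  ext ⟨b, i⟩ ⟨b', i'⟩
  simp [onLeft, Matrix.mul_apply, Fintype.sum_prod_type, Matrix.one_apply, apply_ite]

theorem isCPMap_conj [DecidableEq A] (K : Matrix B A ℂ) :
    IsCPMap fun X : Op A => K * X * Kᴴ := by
  refine ⟨⟨fun X Y => by rw [Matrix.mul_add, Matrix.add_mul], fun c X => by simp⟩,
    fun m X hX => ?_⟩
  rw [onLeft_conj]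
  exact hX.mul_mul_conjTranspose_same _

theorem isCPMap_reindex (e : A ≃ B) : IsCPMap fun X : Op A => Matrix.reindex e e X :=
  ⟨⟨fun _ _ => rfl, fun _ _ => rfl⟩, fun _ _ hX =>
    hX.submatrix fun u : B × Fin _ => (e.symm u.1, u.2)⟩

theorem onLeft_traceSnd {R : Type} (X : Op ((A × B) × R)) :
    onLeft R traceSnd X =
      ∑ b, X.submatrix (fun u : A × R => ((u.1, b), u.2)) fun u : A × R => ((u.1, b), u.2) := by
  ext u v
  simp [onLeft, traceSnd, Matrix.sum_apply]

theorem isCPMap_traceSnd : IsCPMap (traceSnd : Op (A × B) → Op A) := by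
  refine ⟨⟨fun X Y => ?_, fun c X => ?_⟩, fun m X hX => ?_⟩
  · ext; simp [traceSnd, Finset.sum_add_distrib]
  · ext; simp [traceSnd, Finset.mul_sum]
  · rw [onLeft_traceSnd]
    exact Matrix.posSemidef_sum _ fun b _ => hX.submatrix _

theorem isCPMap_traceFst : IsCPMap (traceFst : Op (A × B) → Op B) := by
  refine ⟨⟨fun X Y => ?_, fun c X => ?_⟩, fun m X hX => ?_⟩
  · ext; simp [traceFst, Finset.sum_add_distrib]
  · ext; simp [traceFst, Finset.mul_sum]
  · have : onLeft (Fin m) traceFst X = ∑ a, X.submatrix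
        (fun u : B × Fin m => ((a, u.1), u.2)) fun u : B × Fin m => ((a, u.1), u.2) := by
      ext u v
      simp [onLeft, traceFst, Matrix.sum_apply]
    rw [this]
    exact Matrix.posSemidef_sum _ fun b _ => hX.submatrix _

theorem isCPMap_kronecker {σ : Op B} (hσ : σ.PosSemidef) :
    IsCPMap fun X : Op A => X ⊗ₖ σ := by
  refine ⟨⟨fun X Y => Matrix.add_kronecker _ _ _, fun c X => Matrix.smul_kronecker _ _ _⟩,
    fun m X hX => ?_⟩
  exact (hX.kronecker hσ).submatrix fun u : (A × B) × Fin m => ((u.1.1, u.2), u.1.2)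

theorem isCPMap_trace_smul {σ : Op B} (hσ : σ.PosSemidef) :
    IsCPMap fun X : Op A => X.trace • σ := by
  refine ⟨⟨fun X Y => by rw [Matrix.trace_add, add_smul], fun c X => by
    rw [Matrix.trace_smul, smul_assoc]⟩, fun m X hX => ?_⟩
  have h : (traceFst X).PosSemidef := by
    have : traceFst X = ∑ a, X.submatrix (fun u => (a, u)) fun u => (a, u) := by
      ext u v
      simp [traceFst, Matrix.sum_apply]
    rw [this]
    exact Matrix.posSemidef_sum _ fun b _ => hX.submatrix _
  have h2 : onLeft (Fin m) (fun X : Op A => X.trace • σ) X = σ ⊗ₖ traceFst X := by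
    ext u v
    simp [onLeft, traceFst, Matrix.trace, mul_comm]
  rw [h2]
  exact hσ.kronecker h

theorem trace_traceSnd (X : Op (A × B)) : (traceSnd X).trace = X.trace := by
  simp [traceSnd, Matrix.trace, Fintype.sum_prod_type]

theorem trace_traceFst (X : Op (A × B)) : (traceFst X).trace = X.trace := by
  simp only [traceFst, Matrix.trace, Fintype.sum_prod_type, Matrix.diag_apply, Matrix.of_apply]
  exact Finset.sum_comm

theorem trace_reindex (e : A ≃ B) (X : Op A) : (Matrix.reindex e e X).trace = X.trace := by
  simp only [Matrix.trace, Matrix.diag_apply, Matrix.reindex_apply, Matrix.submatrix_apply]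
  exact e.symm.sum_comp fun i => X i i

theorem traceSnd_kronecker (X : Op A) (Y : Op B) : traceSnd (X ⊗ₖ Y) = Y.trace • X := by
  ext a a'
  simp [traceSnd, Matrix.trace, Finset.mul_sum, mul_comm]

end CP

section Proj
variable {A : Type} [Fintype A] [DecidableEq A]

theorem proj_mul_self (a : A) : proj a * proj a = proj a := by simp [proj]

theorem proj_conjTranspose (a : A) : (proj a)ᴴ = proj a := by
  simp [proj, Matrix.conjTranspose_single]

theorem trace_proj (a : A) : (proj a).trace = 1 := by simp [proj]

theorem posSemidef_proj (a : A) : (proj a).PosSemidef := by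
  have h := Matrix.posSemidef_conjTranspose_mul_self (proj a)
  rwa [proj_conjTranspose, proj_mul_self] at h

/-- Conjugation by a projector and by its complement together preserve the trace. -/
theorem trace_compress_add {P : Op A} (h1 : P * P = P) (h2 : Pᴴ = P) (X : Op A) :
    (P * X * Pᴴ).trace + ((1 - P) * X * (1 - P)ᴴ).trace = X.trace := by
  have h3 : (1 - P) * (1 - P) = 1 - P := by
    rw [Matrix.mul_sub, Matrix.mul_one, Matrix.sub_mul, Matrix.one_mul, h1, sub_self, sub_zero]
  rw [Matrix.conjTranspose_sub, Matrix.conjTranspose_one, h2, Matrix.trace_mul_cycle, h1,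
    Matrix.trace_mul_cycle, h3, ← Matrix.trace_add, ← Matrix.add_mul, add_sub_cancel,
    Matrix.one_mul]

end Proj

/-! ### The Clifford code is an authentication scheme -/

theorem trace_accept : accept.trace = 1 := trace_proj _
theorem trace_reject : reject.trace = 1 := trace_proj _

theorem CliffordKey.isClifford {m : ℕ} (k : CliffordKey m) :
    IsClifford (Quotient.out k : {V : Matrix.unitaryGroup (Qubits m) ℂ // IsClifford V}).1 :=
  (Quotient.out k).2

theorem CliffordKey.conjTranspose_mul_op {m : ℕ} (k : CliffordKey m) : k.opᴴ * k.op = 1 :=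
  Matrix.mem_unitaryGroup_iff'.mp (Quotient.out k).1.2

theorem CliffordKey.op_mul_conjTranspose {m : ℕ} (k : CliffordKey m) : k.op * k.opᴴ = 1 :=
  Matrix.mem_unitaryGroup_iff.mp (Quotient.out k).1.2

theorem reindex_mul {A B : Type} [Fintype A] [Fintype B] (e : A ≃ B) (X Y : Op A) :
    Matrix.reindex e e (X * Y) = Matrix.reindex e e X * Matrix.reindex e e Y := by
  simp [Matrix.reindex_apply, Matrix.submatrix_mul_equiv]

theorem trapAcc_mul_self (n d : ℕ) : trapAcc n d * trapAcc n d = trapAcc n d := by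
  rw [trapAcc, ← reindex_mul, ← Matrix.mul_kronecker_mul, proj_mul_self, Matrix.one_mul]

theorem trapAcc_conjTranspose (n d : ℕ) : (trapAcc n d)ᴴ = trapAcc n d := by
  rw [trapAcc, Matrix.conjTranspose_reindex, Matrix.conjTranspose_kronecker, proj_conjTranspose,
    Matrix.conjTranspose_one]

theorem trapAcc_mul_code (n d : ℕ) (ρ : Op (Qubits n)) :
    trapAcc n d * Matrix.reindex (join n d) (join n d) (ρ ⊗ₖ proj (0 : Qubits d)) =
      Matrix.reindex (join n d) (join n d) (ρ ⊗ₖ proj (0 : Qubits d)) := by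
  rw [trapAcc, ← reindex_mul, ← Matrix.mul_kronecker_mul, proj_mul_self, Matrix.one_mul]

theorem code_mul_trapAcc (n d : ℕ) (ρ : Op (Qubits n)) :
    Matrix.reindex (join n d) (join n d) (ρ ⊗ₖ proj (0 : Qubits d)) * trapAcc n d =
      Matrix.reindex (join n d) (join n d) (ρ ⊗ₖ proj (0 : Qubits d)) := by
  rw [trapAcc, ← reindex_mul, ← Matrix.mul_kronecker_mul, proj_mul_self, Matrix.mul_one]

theorem trace_conj_of_mul_eq_one {A B : Type} [Fintype A] [Fintype B] [DecidableEq A]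
    {K : Matrix B A ℂ} (h : Kᴴ * K = 1) (X : Op A) : (K * X * Kᴴ).trace = X.trace := by
  rw [Matrix.trace_mul_cycle, h, Matrix.one_mul]

theorem cliffordCode_isAuthenticationScheme (n d : ℕ) {Ω : Op (Qubits n)} (hΩ : IsDensity Ω) :
    (cliffordCode n d Ω).IsAuthenticationScheme where
  enc_channel k := by
    refine ⟨(isCPMap_conj k.op).comp ((isCPMap_reindex (join n d)).comp
      (isCPMap_kronecker (posSemidef_proj (0 : Qubits d)))), fun X => ?_⟩
    change (k.op * _ * k.opᴴ).trace = _
    rw [trace_conj_of_mul_eq_one k.conjTranspose_mul_op, trace_reindex, Matrix.trace_kronecker,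
      trace_proj, mul_one]
  dec_channel k := by
    have hk : IsCPMap fun X : Op (Qubits (n + d)) => k.opᴴ * X * k.op := by
      simpa using isCPMap_conj k.opᴴ
    refine ⟨IsCPMap.add ((isCPMap_kronecker (posSemidef_proj _)).comp (isCPMap_traceSnd.comp
      ((isCPMap_reindex (join n d).symm).comp ((isCPMap_conj (trapAcc n d)).comp hk))))
      ((isCPMap_kronecker (posSemidef_proj _)).comp ((isCPMap_trace_smul hΩ.1).comp
      ((isCPMap_conj (trapRej n d)).comp hk))), fun X => ?_⟩
    change (_ ⊗ₖ accept + _ ⊗ₖ reject).trace = _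
    rw [Matrix.trace_add, Matrix.trace_kronecker, Matrix.trace_kronecker, trace_accept,
      trace_reject, Matrix.trace_smul, hΩ.2, trace_traceSnd, trace_reindex, mul_one, mul_one,
      smul_eq_mul, mul_one, trapRej,
      trace_compress_add (trapAcc_mul_self n d) (trapAcc_conjTranspose n d)]
    rw [Matrix.trace_mul_cycle, k.op_mul_conjTranspose, Matrix.one_mul]
  correct k ρ hρ := by
    have h : k.opᴴ * (k.op * Matrix.reindex (join n d) (join n d) (ρ ⊗ₖ proj (0 : Qubits d)) *
        k.opᴴ) * k.op = Matrix.reindex (join n d) (join n d) (ρ ⊗ₖ proj (0 : Qubits d)) := by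
      rw [Matrix.mul_assoc, Matrix.mul_assoc, k.conjTranspose_mul_op, Matrix.mul_one,
        ← Matrix.mul_assoc, k.conjTranspose_mul_op, Matrix.one_mul]
    simp only [cliffordCode]
    rw [h, trapRej, Matrix.sub_mul, Matrix.one_mul, trapAcc_mul_code, sub_self, Matrix.zero_mul,
      Matrix.trace_zero, zero_smul, Matrix.zero_kronecker, add_zero, trapAcc_conjTranspose,
      code_mul_trapAcc]
    congr 1
    have : Matrix.reindex (join n d).symm (join n d).symm
        (Matrix.reindex (join n d) (join n d) (ρ ⊗ₖ proj (0 : Qubits d))) =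
          ρ ⊗ₖ proj (0 : Qubits d) := by
      ext; simp
    rw [this, traceSnd_kronecker, trace_proj, one_smul]

/-! ### The simulator is a pair of completely positive maps -/

section Sim
variable {m : ℕ} {R : Type} [Fintype R] [DecidableEq R]

/-- The isometry `|r⟩ ↦ |r⟩ ⊗ |Φ⁺⟩^{⊗ m}`. -/
def eprIso (m : ℕ) (R : Type) [DecidableEq R] : Matrix ((Qubits m × R) × Qubits m) R ℂ :=
  Matrix.of fun u r => if u.1.2 = r then eprAmp u.1.1 u.2 else 0

theorem eprState_eq (ρ : Op R) : eprState ρ = eprIso m R * ρ * (eprIso m R)ᴴ := by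
  ext ⟨⟨a, r⟩, b⟩ ⟨⟨a', r'⟩, b'⟩
  simp only [eprState, eprIso, Matrix.mul_apply, Matrix.of_apply, Matrix.conjTranspose_apply]
  simp [apply_ite, Finset.sum_ite_eq]
  ring

theorem eprAmp_eq (x y : Qubits m) :
    eprAmp x y = if x = y then (((Real.sqrt 2 : ℝ) : ℂ)⁻¹) ^ m else 0 := by
  unfold eprAmp
  split_ifs with h
  · subst h; simp
  · obtain ⟨i, hi⟩ := Function.ne_iff.mp h
    exact Finset.prod_eq_zero (Finset.mem_univ i) (by simp [hi])

theorem sqrt_two_inv_mul_self :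
    (((Real.sqrt 2 : ℝ) : ℂ)⁻¹) * (((Real.sqrt 2 : ℝ) : ℂ)⁻¹) = 2⁻¹ := by
  rw [← mul_inv, ← Complex.ofReal_mul, Real.mul_self_sqrt (by norm_num)]
  norm_num

theorem star_eprAmp (x y : Qubits m) : star (eprAmp x y) = eprAmp x y := by
  rw [eprAmp_eq]
  split_ifs <;> simp

theorem eprIso_isometry : (eprIso m R)ᴴ * eprIso m R = 1 := by
  ext r r'
  simp only [Matrix.mul_apply, eprIso, Matrix.conjTranspose_apply, Matrix.of_apply,
    Fintype.sum_prod_type, apply_ite star, star_eprAmp, star_zero]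
  have h : ∀ x y : Qubits m, eprAmp x y * eprAmp x y = if x = y then (2⁻¹ : ℂ) ^ m else 0 := by
    intro x y
    rw [eprAmp_eq]
    split_ifs
    · rw [← mul_pow, sqrt_two_inv_mul_self]
    · simp
  have h2 : ∀ (x y : Qubits m) (s : R), ((if s = r then eprAmp x y else 0) *
      if s = r' then eprAmp x y else 0) = if s = r then (if s = r' then
        (if x = y then (2⁻¹ : ℂ) ^ m else 0) else 0) else 0 := by
    intro x y s
    rw [← h]
    split_ifs <;> simp
  simp only [h2]
  have h3 : ∀ x : Qubits m, ∀ s : R, (∑ y : Qubits m, if s = r then (if s = r' then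
        (if x = y then (2⁻¹ : ℂ) ^ m else 0) else 0) else 0) =
          if s = r then (if s = r' then (2⁻¹ : ℂ) ^ m else 0) else 0 := by
    intro x s
    split_ifs <;> simp
  simp only [h3, Finset.sum_ite_eq', Finset.mem_univ, if_true, Finset.sum_const, Matrix.one_apply]
  split_ifs <;> simp

/-- The accepting projector is the projector onto the range of `eprIso`. -/
theorem bellAcc_eq : bellAcc m R = eprIso m R * (eprIso m R)ᴴ := by
  rw [bellAcc, eprState_eq, Matrix.mul_one]

theorem bellAcc_conjTranspose : (bellAcc m R)ᴴ = bellAcc m R := by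
  simp [bellAcc_eq]

theorem bellAcc_mul_self : bellAcc m R * bellAcc m R = bellAcc m R := by
  rw [bellAcc_eq, Matrix.mul_assoc, ← Matrix.mul_assoc _ (eprIso m R), eprIso_isometry,
    Matrix.one_mul]

theorem isCPMap_attackedEpr (U : Matrix.unitaryGroup (Qubits m × R) ℂ) :
    IsCPMap (attackedEpr U) := by
  have h : (attackedEpr U : Op R → _) = fun ρ => ((U : Op (Qubits m × R)) ⊗ₖ (1 : Op (Qubits m))) *
      (eprIso m R * ρ * (eprIso m R)ᴴ) * ((U : Op (Qubits m × R)) ⊗ₖ (1 : Op (Qubits m)))ᴴ := by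
    funext ρ
    rw [attackedEpr, eprState_eq]
  rw [h]
  exact (isCPMap_conj _).comp (isCPMap_conj _)

theorem trace_attackedEpr (U : Matrix.unitaryGroup (Qubits m × R) ℂ) (ρ : Op R) :
    (attackedEpr U ρ).trace = ρ.trace := by
  have hU : (U : Op (Qubits m × R))ᴴ * (U : Op (Qubits m × R)) = 1 :=
    Matrix.mem_unitaryGroup_iff'.mp U.2
  rw [attackedEpr, eprState_eq, trace_conj_of_mul_eq_one, trace_conj_of_mul_eq_one eprIso_isometry]
  rw [Matrix.conjTranspose_kronecker, ← Matrix.mul_kronecker_mul, hU]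
  simp

/-- The two branches are the outcomes of a projective measurement, so together they keep the trace.
-/
theorem isSimulator (U : Matrix.unitaryGroup (Qubits m × R) ℂ) :
    IsSimulator (simAcc U) (simRej U) := by
  refine ⟨isCPMap_traceFst.comp (isCPMap_traceSnd.comp ((isCPMap_conj _).comp
    (isCPMap_attackedEpr U))), isCPMap_traceFst.comp (isCPMap_traceSnd.comp ((isCPMap_conj _).comp
    (isCPMap_attackedEpr U))), fun ρ => ?_⟩
  rw [Matrix.trace_add, simAcc, simRej, trace_traceFst, trace_traceFst, trace_traceSnd,
    trace_traceSnd, bellRej, trace_compress_add bellAcc_mul_self bellAcc_conjTranspose,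
    trace_attackedEpr]

end Sim

/-! ### The Pauli matrices -/

/-- The single-qubit Pauli matrix proportional to the product of two. -/
def pauliOneMul : Fin 4 → Fin 4 → Fin 4 :=
  ![![0, 1, 2, 3], ![1, 0, 3, 2], ![2, 3, 0, 1], ![3, 2, 1, 0]]

/-- `1` if two single-qubit Pauli matrices commute, `-1` if they anticommute. -/
def pauliOneSign (p q : Fin 4) : ℤ := if p = 0 ∨ q = 0 ∨ p = q then 1 else -1

theorem pauliOne_mul (p q : Fin 4) :
    ∃ c : ℂ, c ^ 4 = 1 ∧ pauliOne p * pauliOne q = c • pauliOne (pauliOneMul p q) := by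
  have hI : Complex.I ^ 4 = 1 := Complex.I_pow_four
  have hI' : (-Complex.I) ^ 4 = 1 := by rw [neg_pow, hI]; norm_num
  fin_cases p <;> fin_cases q <;>
  first
  | (refine ⟨1, by norm_num, ?_⟩; ext i j; fin_cases i <;> fin_cases j <;>
      simp [pauliOne, pauliOneMul, Matrix.mul_apply, Fin.sum_univ_two]; done)
  | (refine ⟨Complex.I, hI, ?_⟩; ext i j; fin_cases i <;> fin_cases j <;>
      simp [pauliOne, pauliOneMul, Matrix.mul_apply, Fin.sum_univ_two]; done)
  | (refine ⟨-Complex.I, hI', ?_⟩; ext i j; fin_cases i <;> fin_cases j <;>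
      simp [pauliOne, pauliOneMul, Matrix.mul_apply, Fin.sum_univ_two]; done)

theorem pauliOne_mul_comm (p q : Fin 4) :
    pauliOne p * pauliOne q = (pauliOneSign p q : ℂ) • (pauliOne q * pauliOne p) := by
  fin_cases p <;> fin_cases q <;> ext i j <;> fin_cases i <;> fin_cases j <;>
    simp [pauliOne, pauliOneSign, Matrix.mul_apply, Fin.sum_univ_two]

theorem pauliOne_mul_self (p : Fin 4) : pauliOne p * pauliOne p = 1 := by
  fin_cases p <;> ext i j <;> fin_cases i <;> fin_cases j <;>
    simp [pauliOne, Matrix.mul_apply, Fin.sum_univ_two]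

theorem star_pauliOne (p : Fin 4) (a b : Fin 2) :
    star (pauliOne p a b) = pauliOne p b a := by
  fin_cases p <;> fin_cases a <;> fin_cases b <;> simp [pauliOne]

theorem sum_pauliOne_mul_star (a b c d : Fin 2) :
    ∑ p, pauliOne p a b * star (pauliOne p c d) = if a = c ∧ b = d then 2 else 0 := by
  rw [Fin.sum_univ_four]
  fin_cases a <;> fin_cases b <;> fin_cases c <;> fin_cases d <;> simp [pauliOne] <;> norm_num

section Pauli
variable {m : ℕ}

/-- `1` if two Pauli matrices commute, `-1` if they anticommute. -/
def pauliSign (p q : Fin m → Fin 4) : ℤ := ∏ i, pauliOneSign (p i) (q i)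

theorem pauli_mul_apply (p q : Fin m → Fin 4) (x y : Qubits m) :
    (pauli p * pauli q) x y = ∏ i, (pauliOne (p i) * pauliOne (q i)) (x i) (y i) := by
  simp only [Matrix.mul_apply, pauli, Matrix.of_apply, ← Finset.prod_mul_distrib]
  exact (Fintype.prod_sum fun (i : Fin m) (z : Fin 2) =>
    pauliOne (p i) (x i) z * pauliOne (q i) z (y i)).symm

theorem pauli_mul (p q : Fin m → Fin 4) :
    ∃ c : ℂ, c ^ 4 = 1 ∧ pauli p * pauli q = c • pauli fun i => pauliOneMul (p i) (q i) := by
  choose c hc h using fun i => pauliOne_mul (p i) (q i)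
  refine ⟨∏ i, c i, by rw [← Finset.prod_pow]; simp [hc], ?_⟩
  ext x y
  rw [pauli_mul_apply]
  simp [h, pauli, Finset.prod_mul_distrib]

theorem pauli_mul_comm (p q : Fin m → Fin 4) :
    pauli p * pauli q = (pauliSign p q : ℂ) • (pauli q * pauli p) := by
  ext x y
  rw [pauli_mul_apply, Matrix.smul_apply, pauli_mul_apply, pauliSign, Int.cast_prod, smul_eq_mul,
    ← Finset.prod_mul_distrib]
  refine Finset.prod_congr rfl fun i _ => ?_
  rw [pauliOne_mul_comm]
  rfl

theorem one_apply_prod (x y : Qubits m) : (1 : Op (Qubits m)) x y =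
    ∏ i, (1 : Matrix (Fin 2) (Fin 2) ℂ) (x i) (y i) := by
  simp only [Matrix.one_apply]
  split_ifs with h
  · subst h; simp
  · obtain ⟨i, hi⟩ := Function.ne_iff.mp h
    exact (Finset.prod_eq_zero (Finset.mem_univ i) (if_neg hi)).symm

theorem pauli_mul_self (p : Fin m → Fin 4) : pauli p * pauli p = 1 := by
  ext x y
  rw [pauli_mul_apply, one_apply_prod]
  simp only [pauliOne_mul_self]

theorem pauli_zero : pauli (0 : Fin m → Fin 4) = 1 := by
  ext x y
  rw [one_apply_prod]
  rfl

theorem star_pauli (p : Fin m → Fin 4) (x y : Qubits m) : star (pauli p x y) = pauli p y x := by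
  simp only [pauli, Matrix.of_apply, star_prod, star_pauliOne]

theorem conjTranspose_pauli (p : Fin m → Fin 4) : (pauli p)ᴴ = pauli p := by
  ext x y
  exact star_pauli p y x

/-- The Pauli matrices, scaled by `2 ^ (-m / 2)`, form an orthonormal basis of all matrices. -/
theorem sum_pauli_mul_star (x y z w : Qubits m) :
    ∑ p, pauli p x y * star (pauli p z w) = if x = z ∧ y = w then 2 ^ m else 0 := by
  have h : ∑ p, pauli p x y * star (pauli p z w) =
      ∏ i, ∑ a, pauliOne a (x i) (y i) * star (pauliOne a (z i) (w i)) := by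
    simp only [pauli, Matrix.of_apply, star_prod, ← Finset.prod_mul_distrib]
    exact (Fintype.prod_sum fun (i : Fin m) (a : Fin 4) =>
      pauliOne a (x i) (y i) * star (pauliOne a (z i) (w i))).symm
  rw [h]
  simp only [sum_pauliOne_mul_star]
  split_ifs with hxy
  · simp [hxy.1, hxy.2]
  · by_cases hx : x = z
    · obtain ⟨i, hi⟩ := Function.ne_iff.mp fun hy => hxy ⟨hx, hy⟩
      exact Finset.prod_eq_zero (Finset.mem_univ i) (by simp [hi])
    · obtain ⟨i, hi⟩ := Function.ne_iff.mp hx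
      exact Finset.prod_eq_zero (Finset.mem_univ i) (by simp [hi])

theorem pauliSign_eq (p q : Fin m → Fin 4) : pauliSign p q = 1 ∨ pauliSign p q = -1 := by
  rw [← Int.isUnit_iff, pauliSign]
  refine Finset.prod_induction _ IsUnit (fun _ _ => IsUnit.mul) isUnit_one fun i _ => ?_
  unfold pauliOneSign
  split_ifs <;> simp

theorem pauliSign_update (i : Fin m) (r : Fin 4) (p q : Fin m → Fin 4) (hp : p i = 0) :
    pauliSign (Function.update p i r) q = pauliOneSign r (q i) * pauliSign p q := by
  unfold pauliSign
  rw [← Finset.mul_prod_erase _ _ (Finset.mem_univ i),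
    ← Finset.mul_prod_erase (a := i) _ (fun i => pauliOneSign (p i) (q i)) (Finset.mem_univ i)]
  have h : ∏ j ∈ Finset.univ.erase i, pauliOneSign (Function.update p i r j) (q j) =
      ∏ j ∈ Finset.univ.erase i, pauliOneSign (p j) (q j) :=
    Finset.prod_congr rfl fun j hj => by rw [Function.update_of_ne (Finset.ne_of_mem_erase hj)]
  rw [h, Function.update_self, hp]
  simp [pauliOneSign]

theorem pauliSign_zero (q : Fin m → Fin 4) : pauliSign 0 q = 1 := by
  simp [pauliSign, pauliOneSign]

/-- Different Pauli matrices are told apart by a single-qubit Pauli matrix that commutes with only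
one of them. -/
theorem exists_pauliSign_mul_eq_neg_one {p q : Fin m → Fin 4} (h : p ≠ q) :
    ∃ r, pauliSign r p * pauliSign r q = -1 := by
  obtain ⟨i, hi⟩ := Function.ne_iff.mp h
  have h1 : ∀ a b : Fin 4, a ≠ b → ∃ r, pauliOneSign r a * pauliOneSign r b = -1 := by decide
  obtain ⟨r, hr⟩ := h1 _ _ hi
  refine ⟨Function.update 0 i r, ?_⟩
  rw [pauliSign_update _ _ _ _ rfl, pauliSign_update _ _ _ _ rfl, pauliSign_zero, pauliSign_zero,
    mul_one, mul_one, hr]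

/-- Any two non-identity Pauli matrices have a common anticommuting Pauli matrix: it acts on one
qubit where neither of the two is trivial, or else on one qubit of each. -/
theorem exists_anticommuting {p q : Fin m → Fin 4} (hp : p ≠ 0) (hq : q ≠ 0) :
    ∃ r, pauliSign r p = -1 ∧ pauliSign r q = -1 := by
  have h1 : ∀ a : Fin 4, a ≠ 0 → ∃ r, pauliOneSign r a = -1 := by decide
  have h2 : ∀ a b : Fin 4, a ≠ 0 → b ≠ 0 → ∃ r, pauliOneSign r a = -1 ∧ pauliOneSign r b = -1 := by
    decide
  have h0 : ∀ r : Fin 4, pauliOneSign r 0 = 1 := by decide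
  obtain ⟨i, hi⟩ := Function.ne_iff.mp hp
  obtain ⟨j, hj⟩ := Function.ne_iff.mp hq
  simp only [Pi.zero_apply] at hi hj
  by_cases hqi : q i = 0
  · by_cases hpj : p j = 0
    -- `p` is trivial on `j` and `q` is trivial on `i`, so a factor is needed on each of these qubits
    · obtain ⟨r, hr⟩ := h1 _ hi
      obtain ⟨s, hs⟩ := h1 _ hj
      have hij : j ≠ i := by
        rintro rfl
        exact hi hpj
      refine ⟨Function.update (Function.update 0 i r) j s, ?_⟩
      have hz : Function.update (0 : Fin m → Fin 4) i r j = 0 := Function.update_of_ne hij _ _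
      rw [pauliSign_update j s _ p hz, pauliSign_update j s _ q hz,
        pauliSign_update _ _ _ _ rfl, pauliSign_update _ _ _ _ rfl, pauliSign_zero, pauliSign_zero,
        hr, hs, hqi, hpj, h0, h0]
      simp
    · obtain ⟨r, hr, hr'⟩ := h2 _ _ hpj hj
      refine ⟨Function.update 0 j r, ?_⟩
      rw [pauliSign_update _ _ _ _ rfl, pauliSign_update _ _ _ _ rfl, pauliSign_zero,
        pauliSign_zero, hr, hr']
      simp
  · obtain ⟨r, hr, hr'⟩ := h2 _ _ hi hqi
    refine ⟨Function.update 0 i r, ?_⟩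
    rw [pauliSign_update _ _ _ _ rfl, pauliSign_update _ _ _ _ rfl, pauliSign_zero,
      pauliSign_zero, hr, hr']
    simp

end Pauli

/-! ### Averages over the Clifford group -/

section Clifford
variable {m : ℕ}

/-- The phases in the definition of a Clifford unitary are the fourth roots of unity. -/
theorem phase_mem_iff (z : ℂ) : z ∈ ({1, -1, Complex.I, -Complex.I} : Set ℂ) ↔ z ^ 4 = 1 := by
  have h : z ^ 4 - 1 = (z - 1) * (z + 1) * ((z - Complex.I) * (z + Complex.I)) := by
    linear_combination (z ^ 2 - 1) * Complex.I_sq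
  rw [← sub_eq_zero, h]
  simp [sub_eq_zero, add_eq_zero_iff_eq_neg, or_assoc]

/-- `V P V† = γ Q` for a phase `γ`, which is `α⁻¹` in the definition. -/
theorem isClifford_iff (V : Matrix.unitaryGroup (Qubits m) ℂ) :
    IsClifford V ↔ ∀ p : Fin m → Fin 4, ∃ q : Fin m → Fin 4, ∃ c : ℂ, c ^ 4 = 1 ∧
      (V : Op (Qubits m)) * pauli p * (V : Op (Qubits m))ᴴ = c • pauli q := by
  refine forall_congr' fun p => exists_congr fun q => ?_
  constructor
  · rintro ⟨a, ha, h⟩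
    rw [phase_mem_iff] at ha
    have h0 : a ≠ 0 := by rintro rfl; simp at ha
    refine ⟨a⁻¹, by rw [inv_pow, ha, inv_one], ?_⟩
    rw [← h, smul_smul, inv_mul_cancel₀ h0, one_smul]
  · rintro ⟨a, ha, h⟩
    have h0 : a ≠ 0 := by rintro rfl; simp at ha
    refine ⟨a⁻¹, by rw [phase_mem_iff, inv_pow, ha, inv_one], ?_⟩
    rw [h, smul_smul, inv_mul_cancel₀ h0, one_smul]

theorem IsClifford.mul {V W : Matrix.unitaryGroup (Qubits m) ℂ} (hV : IsClifford V)
    (hW : IsClifford W) : IsClifford (V * W) := by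
  rw [isClifford_iff] at *
  intro p
  obtain ⟨q, c, hc, h⟩ := hW p
  obtain ⟨r, c', hc', h'⟩ := hV q
  refine ⟨r, c * c', by rw [mul_pow, hc, hc', one_mul], ?_⟩
  have : ((V * W : Matrix.unitaryGroup (Qubits m) ℂ) : Op (Qubits m)) = V * W := rfl
  rw [this, Matrix.conjTranspose_mul]
  calc (V : Op (Qubits m)) * W * pauli p * ((W : Op (Qubits m))ᴴ * (V : Op (Qubits m))ᴴ)
      = V * (W * pauli p * (W : Op (Qubits m))ᴴ) * (V : Op (Qubits m))ᴴ := by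
        simp only [Matrix.mul_assoc]
    _ = (c * c') • pauli r := by
        rw [h, Matrix.mul_smul, Matrix.smul_mul, h', smul_smul]

/-- The Pauli matrix as a unitary. -/
def pauliUnitary (p : Fin m → Fin 4) : Matrix.unitaryGroup (Qubits m) ℂ :=
  ⟨pauli p, Matrix.mem_unitaryGroup_iff.mpr (by
    rw [Matrix.star_eq_conjTranspose, conjTranspose_pauli, pauli_mul_self])⟩

theorem pauliSign_cast_sq (p q : Fin m → Fin 4) :
    (pauliSign p q : ℂ) * (pauliSign p q : ℂ) = 1 := by
  rcases pauliSign_eq p q with h | h <;> simp [h]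

theorem pauli_conj_pauli (p q : Fin m → Fin 4) :
    pauli p * pauli q * pauli p = (pauliSign p q : ℂ) • pauli q := by
  rw [pauli_mul_comm, Matrix.smul_mul, Matrix.mul_assoc, pauli_mul_self, Matrix.mul_one]

theorem isClifford_pauliUnitary (p : Fin m → Fin 4) : IsClifford (pauliUnitary p) := by
  rw [isClifford_iff]
  intro q
  refine ⟨q, pauliSign p q, ?_, ?_⟩
  · have h := pauliSign_cast_sq p q
    calc (pauliSign p q : ℂ) ^ 4 = (pauliSign p q * pauliSign p q) ^ 2 := by ring
      _ = 1 := by rw [h, one_pow]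
  · change pauli p * pauli q * (pauli p)ᴴ = _
    rw [conjTranspose_pauli, pauli_conj_pauli]

/-- `(P + Q) / √2`. -/
def pauliSwap (p q : Fin m → Fin 4) : Op (Qubits m) :=
  (((Real.sqrt 2 : ℝ) : ℂ)⁻¹) • (pauli p + pauli q)

theorem pauliSwap_conj (p q : Fin m → Fin 4) (X : Op (Qubits m)) :
    pauliSwap p q * X * pauliSwap p q =
      (2⁻¹ : ℂ) • ((pauli p + pauli q) * X * (pauli p + pauli q)) := by
  rw [pauliSwap, Matrix.smul_mul, Matrix.smul_mul, Matrix.mul_smul, smul_smul,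
    sqrt_two_inv_mul_self]

theorem conjTranspose_pauliSwap (p q : Fin m → Fin 4) : (pauliSwap p q)ᴴ = pauliSwap p q := by
  simp [pauliSwap, conjTranspose_pauli]

theorem pauli_anticomm {p q : Fin m → Fin 4} (h : pauliSign p q = -1) :
    pauli p * pauli q = -(pauli q * pauli p) := by
  rw [pauli_mul_comm, h]; simp

theorem pauliSwap_mul_self {p q : Fin m → Fin 4} (h : pauliSign p q = -1) :
    pauliSwap p q * pauliSwap p q = 1 := by
  have := pauliSwap_conj p q 1
  rw [Matrix.mul_one, Matrix.mul_one] at this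
  rw [this, Matrix.add_mul, Matrix.mul_add, Matrix.mul_add, pauli_mul_self, pauli_mul_self,
    pauli_anticomm h]
  ext x y
  simp only [Matrix.smul_apply, Matrix.add_apply, Matrix.neg_apply, smul_eq_mul]
  ring

/-- The Clifford unitary `(P + Q) / √2` exchanges the anticommuting Pauli matrices `P`, `Q`. -/
theorem pauliSwap_conj_pauli {p q : Fin m → Fin 4} (h : pauliSign p q = -1) :
    pauliSwap p q * pauli p * pauliSwap p q = pauli q := by
  have h1 : pauli q * pauli p * pauli q = - pauli p := by
    have := pauli_anticomm h
    rw [← neg_eq_iff_eq_neg] at this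
    rw [← this, Matrix.neg_mul, Matrix.mul_assoc, pauli_mul_self, Matrix.mul_one]
  rw [pauliSwap_conj, Matrix.add_mul, Matrix.mul_add, Matrix.add_mul, Matrix.add_mul,
    pauli_mul_self, Matrix.one_mul, h1, Matrix.mul_assoc, pauli_mul_self, Matrix.mul_one]
  ext x y
  simp only [Matrix.smul_apply, Matrix.add_apply, Matrix.neg_apply, smul_eq_mul, Matrix.one_mul]
  ring

/-- `(P + Q) / √2` as a unitary, for anticommuting `P`, `Q`. -/
def pauliSwapUnitary {p q : Fin m → Fin 4} (h : pauliSign p q = -1) :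
    Matrix.unitaryGroup (Qubits m) ℂ :=
  ⟨pauliSwap p q, Matrix.mem_unitaryGroup_iff.mpr (by
    rw [Matrix.star_eq_conjTranspose, conjTranspose_pauliSwap, pauliSwap_mul_self h])⟩

/-- With signs `a`, `b` from moving `R` past `P` and `Q`, the conjugate of `R` is `R (a P + b Q) (P
+ Q) / 2`. This is `± R` if `a = b` and `± R P Q` otherwise. -/
theorem isClifford_pauliSwapUnitary {p q : Fin m → Fin 4} (h : pauliSign p q = -1) :
    IsClifford (pauliSwapUnitary h) := by
  rw [isClifford_iff]
  intro r
  change ∃ q' c, _ ∧ pauliSwap p q * pauli r * (pauliSwap p q)ᴴ = _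
  rw [conjTranspose_pauliSwap]
  have key : pauliSwap p q * pauli r * pauliSwap p q = (2⁻¹ : ℂ) •
      (pauli r * (((pauliSign p r : ℂ) • pauli p + (pauliSign q r : ℂ) • pauli q) *
        (pauli p + pauli q))) := by
    rw [pauliSwap_conj, ← Matrix.mul_assoc, Matrix.add_mul (pauli p), pauli_mul_comm p,
      pauli_mul_comm q, Matrix.mul_add (pauli r), Matrix.mul_smul, Matrix.mul_smul]
  obtain ⟨c, hc, h1⟩ := pauli_mul p q
  obtain ⟨c', hc', h2⟩ := pauli_mul r fun i => pauliOneMul (p i) (q i)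
  have h3 : pauli r * (pauli p * pauli q) =
      (c * c') • pauli (fun i => pauliOneMul (r i) (pauliOneMul (p i) (q i))) := by
    rw [h1, Matrix.mul_smul, h2, smul_smul]
  have hcc : (c * c') ^ 4 = 1 := by rw [mul_pow, hc, hc', one_mul]
  -- with `Q P` rewritten as `- P Q`, the mixed products cancel or add up
  have h4 := pauli_anticomm h
  rw [← neg_eq_iff_eq_neg] at h4
  rw [key]
  -- `R` commutes with both, only with `P`, only with `Q`, or with neither
  rcases pauliSign_eq p r with hp | hp <;> rcases pauliSign_eq q r with hq | hq <;>
    rw [hp, hq]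
  · refine ⟨r, 1, by simp, ?_⟩
    have : ((((1 : ℤ) : ℂ) • pauli p + ((1 : ℤ) : ℂ) • pauli q) * (pauli p + pauli q)) =
        (2 : ℂ) • 1 := by
      simp only [Int.cast_one, one_smul, Matrix.add_mul, Matrix.mul_add, pauli_mul_self, ← h4,
        two_smul]
      abel
    rw [this, Matrix.mul_smul, smul_smul, Matrix.mul_one]
    norm_num
  · refine ⟨fun i => pauliOneMul (r i) (pauliOneMul (p i) (q i)), c * c', hcc, ?_⟩
    have : ((((1 : ℤ) : ℂ) • pauli p + ((-1 : ℤ) : ℂ) • pauli q) * (pauli p + pauli q)) =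
        (2 : ℂ) • (pauli p * pauli q) := by
      simp only [Int.cast_one, one_smul, Int.cast_neg, neg_smul, Matrix.add_mul, Matrix.mul_add,
        pauli_mul_self, ← h4, two_smul, Matrix.neg_mul]
      abel
    rw [this, Matrix.mul_smul, smul_smul, h3]
    norm_num
  · refine ⟨fun i => pauliOneMul (r i) (pauliOneMul (p i) (q i)), -(c * c'), by rw [neg_pow, hcc]; norm_num, ?_⟩
    have : ((((-1 : ℤ) : ℂ) • pauli p + ((1 : ℤ) : ℂ) • pauli q) * (pauli p + pauli q)) =
        (2 : ℂ) • -(pauli p * pauli q) := by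
      simp only [Int.cast_one, one_smul, Int.cast_neg, neg_smul, Matrix.add_mul, Matrix.mul_add,
        pauli_mul_self, ← h4, two_smul, Matrix.neg_mul]
      abel
    rw [this, Matrix.mul_smul, smul_smul, Matrix.mul_neg, h3]
    norm_num
  · refine ⟨r, -1, by norm_num, ?_⟩
    have : ((((-1 : ℤ) : ℂ) • pauli p + ((-1 : ℤ) : ℂ) • pauli q) * (pauli p + pauli q)) =
        (2 : ℂ) • -1 := by
      simp only [Int.cast_neg, Int.cast_one, one_smul, neg_smul, Matrix.add_mul, Matrix.mul_add,
        pauli_mul_self, ← h4, two_smul, Matrix.neg_mul]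
      abel
    rw [this, Matrix.mul_smul, smul_smul, Matrix.mul_neg, Matrix.mul_one]
    norm_num

/-- Left multiplication by a Clifford permutes the keys, so it does not change a sum over all keys
of a function that ignores global phases. -/
theorem sum_op_eq_sum_mul_op {α : Type*} [AddCommMonoid α] (f : Op (Qubits m) → α)
    (hf : ∀ (z : ℂ) (V : Op (Qubits m)), ‖z‖ = 1 → f (z • V) = f V)
    {W : Matrix.unitaryGroup (Qubits m) ℂ} (hW : IsClifford W) :
    ∑ k : CliffordKey m, f k.op = ∑ k : CliffordKey m, f ((W : Op (Qubits m)) * k.op) := by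
  have hWW : (W : Op (Qubits m))ᴴ * (W : Op (Qubits m)) = 1 :=
    Matrix.mem_unitaryGroup_iff'.mp W.2
  let g : CliffordKey m → CliffordKey m := fun k =>
    Quotient.mk (phaseSetoid m) ⟨W * (Quotient.out k).1, hW.mul k.isClifford⟩
  have hg : ∀ k, ∃ z : ℂ, ‖z‖ = 1 ∧ (W : Op (Qubits m)) * k.op = z • (g k).op := fun k =>
    Quotient.exact (Quotient.out_eq (g k))
  have hinj : Function.Injective g := by
    intro k l hkl
    obtain ⟨z, hz, h⟩ := hg k
    obtain ⟨w, hw, h'⟩ := hg l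
    rw [← hkl] at h'
    have hz0 : z ≠ 0 := by
      rintro rfl
      simp at hz
    have h1 : (g k).op = z⁻¹ • ((W : Op (Qubits m)) * k.op) := by
      rw [h, smul_smul, inv_mul_cancel₀ hz0, one_smul]
    rw [h1, smul_smul] at h'
    have h2 : l.op = (w * z⁻¹) • k.op := by
      have := congrArg (fun X => (W : Op (Qubits m))ᴴ * X) h'
      simpa only [Matrix.mul_smul, ← Matrix.mul_assoc, hWW, Matrix.one_mul] using this
    rw [← Quotient.out_eq k, ← Quotient.out_eq l]
    exact Quotient.sound ⟨w * z⁻¹, by simp [hz, hw], h2⟩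
  have hbij := Finite.injective_iff_bijective.mp hinj
  rw [← hbij.sum_comp fun k => f k.op]
  refine Finset.sum_congr rfl fun k _ => ?_
  obtain ⟨z, hz, h⟩ := hg k
  rw [h, hf z _ hz]

end Clifford

section Twirl
variable {m : ℕ} {R : Type} [Fintype R] [DecidableEq R]

/-- The term `((V† P V) ⊗ 𝟙) σ ((V† Q V) ⊗ 𝟙)†` of a Clifford twirl. -/
def twirlTerm (p q : Fin m → Fin 4) (σ : Op (Qubits m × R)) (V : Op (Qubits m)) :
    Op (Qubits m × R) :=
  ((Vᴴ * pauli p * V) ⊗ₖ (1 : Op R)) * σ * ((Vᴴ * pauli q * V) ⊗ₖ (1 : Op R))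

theorem conj_smul_phase {z : ℂ} (hz : ‖z‖ = 1) (V X : Op (Qubits m)) :
    (z • V)ᴴ * X * (z • V) = Vᴴ * X * V := by
  have h : star z * z = 1 := by
    have := Complex.normSq_eq_conj_mul_self (z := z)
    rw [Complex.normSq_eq_norm_sq, hz] at this
    simpa using this.symm
  rw [Matrix.conjTranspose_smul, Matrix.smul_mul, Matrix.smul_mul, Matrix.mul_smul, smul_smul, h,
    one_smul]

theorem twirlTerm_smul (p q : Fin m → Fin 4) (σ : Op (Qubits m × R)) (z : ℂ)
    (V : Op (Qubits m)) (hz : ‖z‖ = 1) : twirlTerm p q σ (z • V) = twirlTerm p q σ V := by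
  simp only [twirlTerm, conj_smul_phase hz]

/-- Multiplying the key by a Pauli matrix changes a term of the twirl only by a sign. -/
theorem twirlTerm_pauli_mul (r p q : Fin m → Fin 4) (σ : Op (Qubits m × R)) (V : Op (Qubits m)) :
    twirlTerm p q σ (pauli r * V) =
      ((pauliSign r p * pauliSign r q : ℤ) : ℂ) • twirlTerm p q σ V := by
  have h : ∀ q, (pauli r * V)ᴴ * pauli q * (pauli r * V) =
      (pauliSign r q : ℂ) • (Vᴴ * pauli q * V) := by
    intro q
    rw [Matrix.conjTranspose_mul, conjTranspose_pauli]
    calc Vᴴ * pauli r * pauli q * (pauli r * V) = Vᴴ * (pauli r * pauli q * pauli r) * V := by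
          simp only [Matrix.mul_assoc]
      _ = _ := by rw [pauli_conj_pauli, Matrix.mul_smul, Matrix.smul_mul]
  simp only [twirlTerm, h, Matrix.smul_kronecker, Matrix.smul_mul, Matrix.mul_smul, smul_smul,
    Int.cast_mul]
  rw [mul_comm]

/-- The cross terms of the twirl vanish: a Pauli that commutes with exactly one of `P`, `Q` flips
their sign. -/
theorem sum_twirlTerm_of_ne {p q : Fin m → Fin 4} (h : p ≠ q) (σ : Op (Qubits m × R)) :
    ∑ k : CliffordKey m, twirlTerm p q σ k.op = 0 := by
  obtain ⟨r, hr⟩ := exists_pauliSign_mul_eq_neg_one h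
  have h1 := sum_op_eq_sum_mul_op (twirlTerm p q σ) (twirlTerm_smul p q σ)
    (isClifford_pauliUnitary r)
  have h2 : ∀ k : CliffordKey m,
      twirlTerm p q σ ((pauliUnitary r : Op (Qubits m)) * k.op) = - twirlTerm p q σ k.op := by
    intro k
    change twirlTerm p q σ (pauli r * k.op) = _
    rw [twirlTerm_pauli_mul, hr]
    simp
  simp only [h2, Finset.sum_neg_distrib] at h1
  ext x y
  exact self_eq_neg.mp (congrFun (congrFun h1 x) y)

/-- The Clifford unitary that exchanges two anticommuting Pauli matrices permutes the keys. -/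
theorem sum_twirlTerm_of_anticommute {p r : Fin m → Fin 4} (h : pauliSign r p = -1)
    (σ : Op (Qubits m × R)) :
    ∑ k : CliffordKey m, twirlTerm r r σ k.op = ∑ k : CliffordKey m, twirlTerm p p σ k.op := by
  rw [sum_op_eq_sum_mul_op (twirlTerm r r σ) (twirlTerm_smul r r σ)
    (isClifford_pauliSwapUnitary h)]
  refine Finset.sum_congr rfl fun k _ => ?_
  change twirlTerm r r σ (pauliSwap r p * k.op) = _
  have h1 : (pauliSwap r p * k.op)ᴴ * pauli r * (pauliSwap r p * k.op) =
      k.opᴴ * pauli p * k.op := by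
    rw [Matrix.conjTranspose_mul, conjTranspose_pauliSwap]
    calc k.opᴴ * pauliSwap r p * pauli r * (pauliSwap r p * k.op)
        = k.opᴴ * (pauliSwap r p * pauli r * pauliSwap r p) * k.op := by
          simp only [Matrix.mul_assoc]
      _ = _ := by rw [pauliSwap_conj_pauli h]
  rw [twirlTerm, h1, twirlTerm]

/-- The Clifford group acts transitively on the non-identity Pauli matrices up to phases. -/
theorem sum_twirlTerm_eq {p q : Fin m → Fin 4} (hp : p ≠ 0) (hq : q ≠ 0)
    (σ : Op (Qubits m × R)) :
    ∑ k : CliffordKey m, twirlTerm p p σ k.op = ∑ k : CliffordKey m, twirlTerm q q σ k.op := by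
  obtain ⟨r, hr, hr'⟩ := exists_anticommuting hp hq
  rw [← sum_twirlTerm_of_anticommute hr, sum_twirlTerm_of_anticommute hr']

/-- An isometry on the system that is traced out has no effect. -/
theorem traceFst_conj {A B : Type} [Fintype A] [Fintype B] [DecidableEq A] {K : Matrix B A ℂ}
    (hK : Kᴴ * K = 1) (X : Op (A × R)) :
    traceFst ((K ⊗ₖ (1 : Op R)) * X * (K ⊗ₖ (1 : Op R))ᴴ) = traceFst X := by
  rw [← onLeft_conj]
  ext r r'
  have h := trace_conj_of_mul_eq_one hK (Matrix.of fun a a' => X (a, r) (a', r'))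
  simpa only [traceFst, onLeft, Matrix.of_apply, Matrix.trace, Matrix.diag_apply] using h

/-- The sum of the conjugations by all Pauli matrices is completely depolarizing. -/
theorem sum_pauli_conj (X : Op (Qubits m × R)) :
    ∑ p : Fin m → Fin 4, (pauli p ⊗ₖ (1 : Op R)) * X * (pauli p ⊗ₖ (1 : Op R)) =
      (2 ^ m : ℂ) • ((1 : Op (Qubits m)) ⊗ₖ traceFst X) := by
  have h : ∀ p : Fin m → Fin 4, (pauli p ⊗ₖ (1 : Op R)) * X * (pauli p ⊗ₖ (1 : Op R)) =
      onLeft R (fun X => pauli p * X * (pauli p)ᴴ) X := by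
    intro p
    rw [onLeft_conj, Matrix.conjTranspose_kronecker, conjTranspose_pauli,
      Matrix.conjTranspose_one]
  simp only [h]
  ext ⟨x, r⟩ ⟨y, s⟩
  simp only [onLeft, Matrix.sum_apply, Matrix.of_apply, Matrix.mul_apply,
    Matrix.conjTranspose_apply, Finset.sum_mul, Matrix.smul_apply, Matrix.kroneckerMap_apply,
    traceFst, smul_eq_mul]
  rw [Finset.sum_comm]
  have h2 : ∀ w : Qubits m, ∑ p : Fin m → Fin 4, ∑ z, pauli p x z * X (z, r) (w, s) *
      star (pauli p y w) = if x = y then 2 ^ m * X (w, r) (w, s) else 0 := by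
    intro w
    rw [Finset.sum_comm]
    have h3 : ∀ z, ∑ p : Fin m → Fin 4, pauli p x z * X (z, r) (w, s) * star (pauli p y w) =
        if z = w then (if x = y then 2 ^ m * X (w, r) (w, s) else 0) else 0 := by
      intro z
      have : ∀ p : Fin m → Fin 4, pauli p x z * X (z, r) (w, s) * star (pauli p y w) =
          (pauli p x z * star (pauli p y w)) * X (z, r) (w, s) := fun p => by ring
      simp only [this, ← Finset.sum_mul, sum_pauli_mul_star]
      by_cases hz : z = w
      · subst hz; by_cases hx : x = y <;> simp [hx]
      · simp [hz]
    simp only [h3, Finset.sum_ite_eq', Finset.mem_univ, if_true]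
  simp only [h2, Matrix.one_apply]
  by_cases hx : x = y
  · simp [hx, Finset.mul_sum]
  · simp [hx]

/-- For a fixed key, the diagonal terms of the twirl sum up to the completely depolarizing map: the
conjugates of the Pauli matrices are again all Pauli matrices up to phases. -/
theorem sum_twirlTerm_diag (σ : Op (Qubits m × R)) (k : CliffordKey m) :
    ∑ p : Fin m → Fin 4, twirlTerm p p σ k.op =
      (2 ^ m : ℂ) • ((1 : Op (Qubits m)) ⊗ₖ traceFst σ) := by
  have h : ∀ p : Fin m → Fin 4, twirlTerm p p σ k.op = (k.opᴴ ⊗ₖ (1 : Op R)) *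
      ((pauli p ⊗ₖ (1 : Op R)) * ((k.op ⊗ₖ (1 : Op R)) * σ * (k.op ⊗ₖ (1 : Op R))ᴴ) *
        (pauli p ⊗ₖ (1 : Op R))) * (k.op ⊗ₖ (1 : Op R)) := by
    intro p
    have h1 : (k.opᴴ * pauli p * k.op) ⊗ₖ (1 : Op R) =
        (k.opᴴ ⊗ₖ (1 : Op R)) * (pauli p ⊗ₖ (1 : Op R)) * (k.op ⊗ₖ (1 : Op R)) := by
      simp [← Matrix.mul_kronecker_mul]
    rw [twirlTerm, h1, Matrix.conjTranspose_kronecker, Matrix.conjTranspose_one]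
    simp only [Matrix.mul_assoc]
  simp only [h, ← Finset.sum_mul, ← Finset.mul_sum]
  rw [sum_pauli_conj, traceFst_conj k.conjTranspose_mul_op, Matrix.mul_smul, Matrix.smul_mul,
    ← Matrix.mul_kronecker_mul, ← Matrix.mul_kronecker_mul, Matrix.mul_one, Matrix.one_mul,
    Matrix.mul_one, k.conjTranspose_mul_op]

instance : Nonempty (CliffordKey m) :=
  ⟨Quotient.mk _ ⟨pauliUnitary 0, isClifford_pauliUnitary 0⟩⟩

/-- The twirl of the identity Pauli does nothing. -/
theorem twirlTerm_zero (σ : Op (Qubits m × R)) (k : CliffordKey m) :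
    twirlTerm 0 0 σ k.op = σ := by
  rw [twirlTerm, pauli_zero, Matrix.mul_one, k.conjTranspose_mul_op]
  simp

/-- The twirl of a non-identity Pauli mixes uniformly over all non-identity Paulis. -/
theorem average_twirlTerm {p : Fin m → Fin 4} (hp : p ≠ 0) (σ : Op (Qubits m × R)) :
    (Fintype.card (CliffordKey m) : ℂ)⁻¹ • ∑ k : CliffordKey m, twirlTerm p p σ k.op =
      ((4 : ℂ) ^ m - 1)⁻¹ • ((2 ^ m : ℂ) • ((1 : Op (Qubits m)) ⊗ₖ traceFst σ) - σ) := by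
  have hK : (Fintype.card (CliffordKey m) : ℂ) ≠ 0 := by simp
  have hm : m ≠ 0 := by
    rintro rfl
    exact hp (Subsingleton.elim _ _)
  have h4 : (4 : ℂ) ^ m - 1 ≠ 0 := by
    rw [sub_ne_zero]
    have : (4 : ℕ) ^ m ≠ 1 := (Nat.one_lt_pow hm (by norm_num)).ne'
    exact_mod_cast this
  -- the sum over all keys and all non-identity `q` is computed in two ways: all `q` contribute equally,
  -- and for a fixed key the sum over `q` is the depolarizing map without the identity term
  have h1 : ∑ q ∈ Finset.univ.erase (0 : Fin m → Fin 4), ∑ k : CliffordKey m,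
      twirlTerm q q σ k.op = ((4 : ℂ) ^ m - 1) • ∑ k : CliffordKey m, twirlTerm p p σ k.op := by
    rw [Finset.sum_congr rfl fun q hq => sum_twirlTerm_eq (Finset.ne_of_mem_erase hq) hp σ,
      Finset.sum_const, Finset.card_erase_of_mem (Finset.mem_univ _), ← Nat.cast_smul_eq_nsmul ℂ,
      Finset.card_univ, Nat.cast_sub Fintype.card_pos]
    simp
  have h2 : ∑ q ∈ Finset.univ.erase (0 : Fin m → Fin 4), ∑ k : CliffordKey m,
      twirlTerm q q σ k.op = (Fintype.card (CliffordKey m) : ℂ) •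
        ((2 ^ m : ℂ) • ((1 : Op (Qubits m)) ⊗ₖ traceFst σ) - σ) := by
    rw [Finset.sum_comm]
    have : ∀ k : CliffordKey m, ∑ q ∈ Finset.univ.erase (0 : Fin m → Fin 4), twirlTerm q q σ k.op =
        (2 ^ m : ℂ) • ((1 : Op (Qubits m)) ⊗ₖ traceFst σ) - σ := by
      intro k
      rw [← sum_twirlTerm_diag σ k, ← Finset.add_sum_erase _ _ (Finset.mem_univ 0),
        twirlTerm_zero]
      abel
    simp only [this, Finset.sum_const, Finset.card_univ, ← Nat.cast_smul_eq_nsmul ℂ]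
  rw [h1] at h2
  rw [eq_inv_smul_iff₀ h4, smul_comm, h2, inv_smul_smul₀ hK]

/-! ### The Pauli expansion of an attack -/

/-- The coefficient `U_P` in the expansion `U = ∑_P P ⊗ U_P`. -/
def pauliCoeff (U : Op (Qubits m × R)) (p : Fin m → Fin 4) : Op R :=
  Matrix.of fun r s => (2 ^ m : ℂ)⁻¹ * ∑ x, ∑ y, star (pauli p x y) * U (x, r) (y, s)

/-- The Pauli expansion of an operator. -/
theorem sum_pauli_kronecker_pauliCoeff (U : Op (Qubits m × R)) :
    ∑ p, pauli p ⊗ₖ pauliCoeff U p = U := by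
  ext ⟨x, r⟩ ⟨y, s⟩
  simp only [Matrix.sum_apply, Matrix.kroneckerMap_apply, pauliCoeff, Matrix.of_apply]
  have h1 : ∀ p : Fin m → Fin 4, pauli p x y * ((2 ^ m : ℂ)⁻¹ * ∑ z, ∑ w, star (pauli p z w) *
      U (z, r) (w, s)) = (2 ^ m : ℂ)⁻¹ * ∑ z, ∑ w, (pauli p x y * star (pauli p z w)) *
        U (z, r) (w, s) := by
    intro p
    simp only [Finset.mul_sum]
    exact Finset.sum_congr rfl fun _ _ => Finset.sum_congr rfl fun _ _ => by ring
  simp only [h1, ← Finset.mul_sum]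
  rw [Finset.sum_comm]
  have h2 : ∀ z : Qubits m, ∑ p, ∑ w, (pauli p x y * star (pauli p z w)) * U (z, r) (w, s) =
      if x = z then 2 ^ m * U (z, r) (y, s) else 0 := by
    intro z
    rw [Finset.sum_comm]
    simp only [← Finset.sum_mul, sum_pauli_mul_star]
    by_cases h : x = z <;> simp [h]
  simp only [h2, Finset.sum_ite_eq, Finset.mem_univ, if_true]
  rw [inv_mul_cancel_left₀ (by simp)]

/-- Averaging an attack over the Clifford group turns it into a probabilistic mixture: either
nothing happens to `C`, or a uniformly random non-identity Pauli is applied. -/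
theorem average_twirl (U σ : Op (Qubits m × R)) :
    (Fintype.card (CliffordKey m) : ℂ)⁻¹ • ∑ k : CliffordKey m,
        ((k.opᴴ ⊗ₖ (1 : Op R)) * (U * ((k.op ⊗ₖ (1 : Op R)) * σ * (k.op ⊗ₖ (1 : Op R))ᴴ) * Uᴴ) *
          (k.opᴴ ⊗ₖ (1 : Op R))ᴴ) =
      ((1 : Op (Qubits m)) ⊗ₖ pauliCoeff U 0) * σ * ((1 : Op (Qubits m)) ⊗ₖ pauliCoeff U 0)ᴴ +
      ∑ p ∈ Finset.univ.erase 0, ((1 : Op (Qubits m)) ⊗ₖ pauliCoeff U p) *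
        (((4 : ℂ) ^ m - 1)⁻¹ • ((2 ^ m : ℂ) • ((1 : Op (Qubits m)) ⊗ₖ traceFst σ) - σ)) *
          ((1 : Op (Qubits m)) ⊗ₖ pauliCoeff U p)ᴴ := by
  have h1 : ∀ k : CliffordKey m, (k.opᴴ ⊗ₖ (1 : Op R)) * U * (k.op ⊗ₖ (1 : Op R)) =
      ∑ p, ((1 : Op (Qubits m)) ⊗ₖ pauliCoeff U p) *
        ((k.opᴴ * pauli p * k.op) ⊗ₖ (1 : Op R)) := by
    intro k
    conv_lhs => rw [← sum_pauli_kronecker_pauliCoeff U]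
    rw [Finset.mul_sum, Finset.sum_mul]
    refine Finset.sum_congr rfl fun p _ => ?_
    simp [← Matrix.mul_kronecker_mul]
  have h2 : ∀ k : CliffordKey m, (k.opᴴ ⊗ₖ (1 : Op R)) *
      (U * ((k.op ⊗ₖ (1 : Op R)) * σ * (k.op ⊗ₖ (1 : Op R))ᴴ) * Uᴴ) * (k.opᴴ ⊗ₖ (1 : Op R))ᴴ =
      ∑ p, ∑ q, ((1 : Op (Qubits m)) ⊗ₖ pauliCoeff U p) * twirlTerm p q σ k.op *
        ((1 : Op (Qubits m)) ⊗ₖ pauliCoeff U q)ᴴ := by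
    intro k
    calc _ = ((k.opᴴ ⊗ₖ (1 : Op R)) * U * (k.op ⊗ₖ (1 : Op R))) * σ *
          ((k.opᴴ ⊗ₖ (1 : Op R)) * U * (k.op ⊗ₖ (1 : Op R)))ᴴ := by
          simp only [Matrix.conjTranspose_mul, Matrix.mul_assoc]
      _ = _ := by
          rw [h1, Matrix.conjTranspose_sum, Finset.sum_mul, Finset.sum_mul]
          refine Finset.sum_congr rfl fun p _ => ?_
          rw [Finset.mul_sum]
          refine Finset.sum_congr rfl fun q _ => ?_
          have h3 : ((k.opᴴ * pauli q * k.op) ⊗ₖ (1 : Op R))ᴴ =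
              (k.opᴴ * pauli q * k.op) ⊗ₖ (1 : Op R) := by
            rw [Matrix.conjTranspose_kronecker, Matrix.conjTranspose_one]
            simp [Matrix.mul_assoc, conjTranspose_pauli]
          rw [Matrix.conjTranspose_mul, h3, twirlTerm]
          simp only [Matrix.mul_assoc]
  simp only [h2]
  rw [Finset.sum_comm]
  -- only the diagonal terms survive the sum over the keys
  have h3 : ∀ p, ∑ k : CliffordKey m, ∑ q, ((1 : Op (Qubits m)) ⊗ₖ pauliCoeff U p) *
      twirlTerm p q σ k.op * ((1 : Op (Qubits m)) ⊗ₖ pauliCoeff U q)ᴴ =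
      ((1 : Op (Qubits m)) ⊗ₖ pauliCoeff U p) * (∑ k : CliffordKey m, twirlTerm p p σ k.op) *
        ((1 : Op (Qubits m)) ⊗ₖ pauliCoeff U p)ᴴ := by
    intro p
    rw [Finset.sum_comm]
    simp only [← Finset.sum_mul, ← Finset.mul_sum]
    refine Finset.sum_eq_single_of_mem p (Finset.mem_univ _) fun q _ hq => ?_
    rw [sum_twirlTerm_of_ne hq.symm, Matrix.mul_zero, Matrix.zero_mul]
  simp only [h3]
  rw [← Finset.add_sum_erase _ _ (Finset.mem_univ 0), smul_add, Finset.smul_sum]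
  congr 1
  · have hK : (Fintype.card (CliffordKey m) : ℂ) ≠ 0 := by simp
    simp only [twirlTerm_zero, Finset.sum_const, Finset.card_univ, ← Nat.cast_smul_eq_nsmul ℂ]
    rw [Matrix.mul_smul, Matrix.smul_mul, inv_smul_smul₀ hK]
  · refine Finset.sum_congr rfl fun p hp => ?_
    rw [← average_twirlTerm (Finset.ne_of_mem_erase hp), Matrix.mul_smul, Matrix.smul_mul]

/-- The partial trace over the EPR pairs is cyclic for the operators `eprIso` that act only on them.
-/
theorem ptrace_eprIso_mul (Z : Matrix R ((Qubits m × R) × Qubits m) ℂ) :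
    traceFst (traceSnd (eprIso m R * Z)) = Z * eprIso m R := by
  ext r s
  simp only [traceFst, traceSnd, Matrix.mul_apply, Matrix.of_apply, eprIso, ite_mul, zero_mul,
    mul_ite, mul_zero, Finset.sum_ite_eq, Finset.mem_univ, if_true, Fintype.sum_prod_type]
  refine Finset.sum_congr rfl fun x _ => ?_
  rw [Finset.sum_comm]
  refine Finset.sum_congr rfl fun y _ => ?_
  rw [Finset.sum_ite_eq', if_pos (Finset.mem_univ _), mul_comm]

theorem ptrace_mul_eprIso (Z : Matrix ((Qubits m × R) × Qubits m) R ℂ) :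
    traceFst (traceSnd (Z * (eprIso m R)ᴴ)) = (eprIso m R)ᴴ * Z := by
  have h := congrArg Matrix.conjTranspose (ptrace_eprIso_mul Zᴴ)
  rw [Matrix.conjTranspose_mul, Matrix.conjTranspose_conjTranspose] at h
  rw [← h]
  ext r s
  simp [traceFst, traceSnd, Matrix.mul_apply, mul_comm]

/-- The attacked EPR pairs carry the matrix entries of the attack: a half of the pairs serves as the
index of the input. -/
theorem kronecker_mul_eprIso (U : Op (Qubits m × R)) (u : (Qubits m × R) × Qubits m) (s : R) :
    ((U ⊗ₖ (1 : Op (Qubits m))) * eprIso m R) u s =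
      (((Real.sqrt 2 : ℝ) : ℂ)⁻¹) ^ m * U u.1 (u.2, s) := by
  obtain ⟨⟨x, r⟩, y⟩ := u
  simp only [Matrix.mul_apply, Fintype.sum_prod_type, Matrix.kroneckerMap_apply, eprIso,
    Matrix.of_apply, mul_ite, mul_zero, Matrix.one_apply, mul_one, ite_mul, zero_mul, eprAmp_eq]
  rw [Finset.sum_eq_single y]
  · rw [Finset.sum_eq_single s]
    · simp [mul_comm]
    · intro t _ ht; simp [ht]
    · simp
  · intro z _ hz
    refine Finset.sum_eq_zero fun t _ => ?_
    refine Finset.sum_eq_zero fun w _ => ?_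
    by_cases hw : y = w
    · subst hw; simp [hz]
    · simp [hw]
  · simp

theorem sqrt_two_inv_pow_mul_self (m : ℕ) :
    ((((Real.sqrt 2 : ℝ) : ℂ)⁻¹) ^ m) * ((((Real.sqrt 2 : ℝ) : ℂ)⁻¹) ^ m) = (2 ^ m : ℂ)⁻¹ := by
  rw [← mul_pow, sqrt_two_inv_mul_self, inv_pow]

/-- Projecting the attacked EPR pairs back onto EPR pairs extracts the identity coefficient. -/
theorem eprIso_conj_attack (U : Op (Qubits m × R)) :
    (eprIso m R)ᴴ * ((U ⊗ₖ (1 : Op (Qubits m))) * eprIso m R) = pauliCoeff U 0 := by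
  ext r s
  simp only [pauliCoeff, pauli_zero, Matrix.of_apply]
  rw [Matrix.mul_apply]
  simp only [kronecker_mul_eprIso]
  simp only [Matrix.conjTranspose_apply, eprIso, Matrix.of_apply, apply_ite star, star_eprAmp,
    star_zero, Fintype.sum_prod_type, ite_mul, zero_mul, Matrix.one_apply, star_one,
    one_mul, Finset.sum_ite_eq, Finset.mem_univ, if_true, Finset.mul_sum]
  refine Finset.sum_congr rfl fun x _ => ?_
  rw [Finset.sum_eq_single r]
  · simp only [if_true, eprAmp_eq, ite_mul, zero_mul, Finset.sum_ite_eq, Finset.mem_univ,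
      ← mul_assoc, sqrt_two_inv_pow_mul_self]
  · intro t _ ht; simp [ht]
  · simp

/-- Parseval's identity for the Pauli expansion. -/
theorem sum_pauliCoeff_mul_star (U : Op (Qubits m × R)) (r r' s t : R) :
    ∑ p, pauliCoeff U p r s * star (pauliCoeff U p r' t) =
      (2 ^ m : ℂ)⁻¹ * ∑ x, ∑ y, U (x, r) (y, s) * star (U (x, r') (y, t)) := by
  have h1 : ∀ x y, U (x, r) (y, s) = ∑ p, pauli p x y * pauliCoeff U p r s := by
    intro x y
    conv_lhs => rw [← sum_pauli_kronecker_pauliCoeff U]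
    simp [Matrix.sum_apply]
  have h2 : ∀ p : Fin m → Fin 4, star (pauliCoeff U p r' t) =
      (2 ^ m : ℂ)⁻¹ * ∑ x, ∑ y, pauli p x y * star (U (x, r') (y, t)) := by
    intro p
    simp [pauliCoeff]
  simp only [h1, h2, Finset.mul_sum, Finset.sum_mul]
  rw [Finset.sum_comm]
  refine Finset.sum_congr rfl fun x _ => ?_
  rw [Finset.sum_comm]
  exact Finset.sum_congr rfl fun y _ => Finset.sum_congr rfl fun p _ => by ring

/-- If the outcome of the Bell measurement is ignored, all coefficients of the attack contribute. -/
theorem ptrace_attackedEpr (U : Matrix.unitaryGroup (Qubits m × R) ℂ) (ρ : Op R) :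
    traceFst (traceSnd (attackedEpr U ρ)) =
      ∑ p, pauliCoeff (U.1) p * ρ * (pauliCoeff (U.1) p)ᴴ := by
  have h1 : attackedEpr U ρ = ((U.1 ⊗ₖ (1 : Op (Qubits m))) * eprIso m R) * ρ *
      ((U.1 ⊗ₖ (1 : Op (Qubits m))) * eprIso m R)ᴴ := by
    rw [attackedEpr, eprState_eq]
    simp only [Matrix.conjTranspose_mul, Matrix.mul_assoc]
  ext r r'
  rw [h1]
  simp only [traceFst, traceSnd, Matrix.of_apply]
  have h2 : ∀ (x y : Qubits m), (((U.1 ⊗ₖ (1 : Op (Qubits m))) * eprIso m R) * ρ *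
      ((U.1 ⊗ₖ (1 : Op (Qubits m))) * eprIso m R)ᴴ) ((x, r), y) ((x, r'), y) =
      ∑ t, ∑ s, (2 ^ m : ℂ)⁻¹ * (U.1 (x, r) (y, s) * star (U.1 (x, r') (y, t))) * ρ s t := by
    intro x y
    rw [Matrix.mul_apply]
    simp only [Matrix.mul_apply (N := ρ), Matrix.conjTranspose_apply, kronecker_mul_eprIso,
      Finset.sum_mul]
    refine Finset.sum_congr rfl fun t _ => Finset.sum_congr rfl fun s _ => ?_
    rw [← sqrt_two_inv_pow_mul_self]
    simp
    ring
  have h3 : (∑ p, pauliCoeff (U.1) p * ρ * (pauliCoeff (U.1) p)ᴴ) r r' =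
      ∑ t, ∑ s, (∑ p, pauliCoeff (U.1) p r s * star (pauliCoeff (U.1) p r' t)) * ρ s t := by
    simp only [Matrix.sum_apply, Matrix.mul_apply, Matrix.conjTranspose_apply, Finset.sum_mul]
    rw [Finset.sum_comm]
    refine Finset.sum_congr rfl fun t _ => ?_
    rw [Finset.sum_comm]
    exact Finset.sum_congr rfl fun s _ => Finset.sum_congr rfl fun p _ => by ring
  rw [h3]
  simp only [h2, sum_pauliCoeff_mul_star, Finset.mul_sum, Finset.sum_mul]
  rw [Finset.sum_congr rfl fun x _ => Finset.sum_comm, Finset.sum_comm]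
  refine Finset.sum_congr rfl fun t _ => ?_
  rw [Finset.sum_congr rfl fun x _ => Finset.sum_comm, Finset.sum_comm]

/-- The accepting branch of the simulator is the identity coefficient of the attack. -/
theorem simAcc_eq (U : Matrix.unitaryGroup (Qubits m × R) ℂ) (ρ : Op R) :
    simAcc U ρ = pauliCoeff (U.1) 0 * ρ * (pauliCoeff (U.1) 0)ᴴ := by
  rw [simAcc, bellAcc_conjTranspose, bellAcc_eq, attackedEpr, eprState_eq, Matrix.mul_assoc,
    Matrix.mul_assoc, ptrace_eprIso_mul, ← eprIso_conj_attack]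
  simp only [Matrix.conjTranspose_mul, Matrix.conjTranspose_conjTranspose, Matrix.mul_assoc,
    eprIso_isometry, Matrix.mul_one]

/-- The rejecting branch is what the accepting one leaves of the attacked state: the cross terms
between the two projectors vanish under the trace over the pairs. -/
theorem simRej_eq_sub (U : Matrix.unitaryGroup (Qubits m × R) ℂ) (ρ : Op R) :
    simRej U ρ = traceFst (traceSnd (attackedEpr U ρ)) - simAcc U ρ := by
  -- the trace over the pairs does not see whether the projector stands on one or on both sides
  have h1 : ∀ Y : Op ((Qubits m × R) × Qubits m), traceFst (traceSnd (bellAcc m R * Y)) =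
      traceFst (traceSnd (bellAcc m R * Y * bellAcc m R)) := by
    intro Y
    rw [bellAcc_eq, Matrix.mul_assoc, Matrix.mul_assoc, ptrace_eprIso_mul, Matrix.mul_assoc,
      ptrace_eprIso_mul]
    simp only [Matrix.mul_assoc, eprIso_isometry, Matrix.mul_one]
  have h2 : ∀ Y : Op ((Qubits m × R) × Qubits m), traceFst (traceSnd (Y * bellAcc m R)) =
      traceFst (traceSnd (bellAcc m R * Y * bellAcc m R)) := by
    intro Y
    rw [bellAcc_eq, ← Matrix.mul_assoc, ← Matrix.mul_assoc, ptrace_mul_eprIso, ptrace_mul_eprIso]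
    simp only [← Matrix.mul_assoc, eprIso_isometry, Matrix.one_mul]
  have hsub : ∀ X Y : Op ((Qubits m × R) × Qubits m), traceFst (traceSnd (X - Y)) =
      traceFst (traceSnd X) - traceFst (traceSnd Y) := by
    intro X Y
    ext r s
    simp [traceFst, traceSnd, Finset.sum_sub_distrib]
  rw [simRej, simAcc, bellRej, Matrix.conjTranspose_sub, Matrix.conjTranspose_one,
    bellAcc_conjTranspose, Matrix.mul_sub, Matrix.mul_one, Matrix.sub_mul, Matrix.one_mul,
    Matrix.sub_mul, hsub, hsub, hsub, h1 (attackedEpr U ρ),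
    h2 (attackedEpr U ρ), sub_self, sub_zero]

/-- The rejecting branch of the simulator consists of all other coefficients of the attack. -/
theorem simRej_eq (U : Matrix.unitaryGroup (Qubits m × R) ℂ) (ρ : Op R) :
    simRej U ρ = ∑ p ∈ Finset.univ.erase 0, pauliCoeff (U.1) p * ρ * (pauliCoeff (U.1) p)ᴴ := by
  rw [simRej_eq_sub, ptrace_attackedEpr, simAcc_eq,
    ← Finset.add_sum_erase _ _ (Finset.mem_univ 0), add_sub_cancel_left]

end Twirl

/-! ### The trace norm -/

theorem exists_diagonalization {A : Type} [Fintype A] [DecidableEq A] {X : Op A}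
    (hX : X.IsHermitian) : ∃ (V : Op A) (μ : A → ℝ), Vᴴ * V = 1 ∧ V * Vᴴ = 1 ∧
      X = V * Matrix.diagonal (fun i => (μ i : ℂ)) * Vᴴ := by
  refine ⟨hX.eigenvectorUnitary, hX.eigenvalues,
    Matrix.mem_unitaryGroup_iff'.mp hX.eigenvectorUnitary.2,
    Matrix.mem_unitaryGroup_iff.mp hX.eigenvectorUnitary.2, ?_⟩
  have h := hX.spectral_theorem
  rw [Unitary.conjStarAlgAut_apply] at h
  exact h

theorem charpoly_unitary_conj {A : Type} [Fintype A] [DecidableEq A] {V : Op A}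
    (h : V * Vᴴ = 1) (h' : Vᴴ * V = 1) (X : Op A) : (V * X * Vᴴ).charpoly = X.charpoly := by
  have e := Matrix.charpoly_units_conj (⟨V, Vᴴ, h, h'⟩ : (Op A)ˣ) X
  change (V * X * V⁻¹).charpoly = _ at e
  rwa [Matrix.inv_eq_right_inv h] at e

/-- The eigenvalues, in whatever order they are listed, are the entries of any diagonal form. -/
theorem map_eigenvalues_of_eq_conj_diagonal {A : Type} [Fintype A] [DecidableEq A] {X V : Op A}
    (hX : X.IsHermitian) {ν : A → ℝ} (h : V * Vᴴ = 1) (h' : Vᴴ * V = 1)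
    (hν : X = V * Matrix.diagonal (fun i => (ν i : ℂ)) * Vᴴ) :
    Multiset.map (fun i => (hX.eigenvalues i : ℂ)) Finset.univ.val =
      Multiset.map (fun i => (ν i : ℂ)) Finset.univ.val := by
  have h1 := hX.roots_charpoly_eq_eigenvalues
  have h2 : X.charpoly = ∏ i, (Polynomial.X - Polynomial.C (ν i : ℂ)) := by
    rw [hν, charpoly_unitary_conj h h', Matrix.charpoly_diagonal]
  rw [h2, Polynomial.roots_prod _ _ (Finset.prod_ne_zero_iff.mpr fun i _ =>
    Polynomial.X_sub_C_ne_zero _)] at h1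
  simp only [Polynomial.roots_X_sub_C, Multiset.bind_singleton] at h1
  exact h1.symm

/-- In an eigenbasis of `X - Y`, every eigenvalue is the difference of two nonnegative diagonal
entries. -/
theorem traceNorm_sub_le {A : Type} [Fintype A] [DecidableEq A] {X Y : Op A} (hX : X.PosSemidef)
    (hY : Y.PosSemidef) : traceNorm (X - Y) ≤ X.trace.re + Y.trace.re := by
  have hH : (X - Y).IsHermitian := hX.1.sub hY.1
  obtain ⟨V, μ, hVV, hVV', hspec⟩ := exists_diagonalization hH
  have hdiag : Vᴴ * X * V - Vᴴ * Y * V = Matrix.diagonal (fun i => (μ i : ℂ)) := by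
    rw [← Matrix.sub_mul, ← Matrix.mul_sub, hspec]
    simp only [Matrix.mul_assoc, hVV, Matrix.mul_one]
    rw [← Matrix.mul_assoc, hVV, Matrix.one_mul]
  have hsq : (X - Y)ᴴ * (X - Y) = V * Matrix.diagonal (fun i => ((μ i ^ 2 : ℝ) : ℂ)) * Vᴴ := by
    rw [hH.eq, hspec]
    calc _ = V * Matrix.diagonal (fun i => (μ i : ℂ)) * (Vᴴ * V) *
          Matrix.diagonal (fun i => (μ i : ℂ)) * Vᴴ := by simp only [Matrix.mul_assoc]
      _ = _ := by
        rw [hVV, Matrix.mul_one, Matrix.mul_assoc V, Matrix.diagonal_mul_diagonal]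
        congr 3
        funext i
        push_cast
        ring
  -- the eigenvalues of `(X - Y)† (X - Y)` are the squares of the eigenvalues of `X - Y`
  have hroots := map_eigenvalues_of_eq_conj_diagonal
    (Matrix.isHermitian_conjTranspose_mul_self (X - Y)) hVV' hVV hsq
  have hsum : traceNorm (X - Y) = ∑ i, |μ i| := by
    have h := congrArg (fun s : Multiset ℂ => (s.map fun z => Real.sqrt z.re).sum) hroots
    simp only [Multiset.map_map, Function.comp_def, Complex.ofReal_re, Real.sqrt_sq_eq_abs] at h
    exact h
  have hX' : ∀ i, 0 ≤ ((Vᴴ * X * V) i i).re := fun i =>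
    (Complex.le_def.mp (hX.conjTranspose_mul_mul_same V).diag_nonneg).1
  have hY' : ∀ i, 0 ≤ ((Vᴴ * Y * V) i i).re := fun i =>
    (Complex.le_def.mp (hY.conjTranspose_mul_mul_same V).diag_nonneg).1
  -- the trace is the sum of the diagonal entries in the eigenbasis as well
  have htr : ∀ Z : Op A, Z.trace.re = ∑ i, ((Vᴴ * Z * V) i i).re := by
    intro Z
    rw [← Complex.re_sum]
    change _ = (Vᴴ * Z * V).trace.re
    rw [Matrix.trace_mul_cycle, hVV', Matrix.one_mul]
  rw [hsum, htr X, htr Y, ← Finset.sum_add_distrib]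
  refine Finset.sum_le_sum fun i _ => ?_
  have h := congrArg Complex.re (congrFun (congrFun hdiag i) i)
  simp only [Matrix.sub_apply, Complex.sub_re, Matrix.diagonal_apply_eq, Complex.ofReal_re] at h
  rw [← h, abs_le]
  constructor <;> linarith [hX' i, hY' i]

/-! ### Security of the Clifford code -/

section Linear
variable {A B R : Type} {Φ : Op A → Op B}

theorem onLeft_add (h : IsLinearMap ℂ Φ)
    (X Y : Op (A × R)) : onLeft R Φ (X + Y) = onLeft R Φ X + onLeft R Φ Y := by
  ext u v
  exact congrFun (congrFun (h.map_add _ _) u.1) v.1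

theorem onLeft_smul (h : IsLinearMap ℂ Φ) (c : ℂ)
    (X : Op (A × R)) : onLeft R Φ (c • X) = c • onLeft R Φ X := by
  ext u v
  exact congrFun (congrFun (h.map_smul _ _) u.1) v.1

/-- `Φ ⊗ Id` as a linear map. -/
def onLeftLinear (R : Type) (h : IsLinearMap ℂ Φ) : Op (A × R) →ₗ[ℂ] Op (B × R) where
  toFun := onLeft R Φ
  map_add' := onLeft_add h
  map_smul' := onLeft_smul h

end Linear

section Security
variable {n d : ℕ} {R : Type} [Fintype R] [DecidableEq R]

theorem onLeft_kronecker {A B : Type} [Fintype A] {Φ : Op A → Op B} (h : IsLinearMap ℂ Φ)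
    (X : Op A) (Y : Op R) : onLeft R Φ (X ⊗ₖ Y) = Φ X ⊗ₖ Y := by
  ext u v
  have := congrFun (congrFun (h.map_smul (Y u.2 v.2) X) u.1) v.1
  simp only [onLeft, Matrix.of_apply, Matrix.kroneckerMap_apply]
  rw [mul_comm (Φ X u.1 v.1)]
  refine Eq.trans ?_ this
  congr 2
  ext a a'
  simp [mul_comm]

/-- Operations on different registers commute. -/
theorem onLeft_conj_right {A B : Type} [Fintype A] [Fintype B] [DecidableEq A] [DecidableEq B]
    {Φ : Op A → Op B} (h : IsLinearMap ℂ Φ) (V : Op R) (X : Op (A × R)) :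
    onLeft R Φ (((1 : Op A) ⊗ₖ V) * X * ((1 : Op A) ⊗ₖ V)ᴴ) =
      ((1 : Op B) ⊗ₖ V) * onLeft R Φ X * ((1 : Op B) ⊗ₖ V)ᴴ := by
  have hconj : ∀ (C : Type) [Fintype C] [DecidableEq C] (Z : Op (C × R)) (u v : C × R),
      (((1 : Op C) ⊗ₖ V) * Z * ((1 : Op C) ⊗ₖ V)ᴴ) u v =
        ∑ t, ∑ s, (V u.2 s * star (V v.2 t)) * Z (u.1, s) (v.1, t) := by
    intro C _ _ Z u v
    simp only [Matrix.mul_apply, Fintype.sum_prod_type, Matrix.kroneckerMap_apply,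
      Matrix.conjTranspose_apply, Matrix.one_apply, ite_mul, one_mul, zero_mul]
    rw [Finset.sum_eq_single v.1]
    · refine Finset.sum_congr rfl fun t _ => ?_
      rw [Finset.sum_eq_single u.1]
      · simp only [if_true, Finset.sum_mul]
        exact Finset.sum_congr rfl fun s _ => by ring
      · intro a _ ha; simp [ha.symm]
      · simp
    · intro a _ ha; simp [ha.symm]
    · simp
  ext u v
  rw [hconj B]
  let L : Op A →ₗ[ℂ] Op B := h.mk' Φ
  have h1 : (Matrix.of fun a a' => (((1 : Op A) ⊗ₖ V) * X * ((1 : Op A) ⊗ₖ V)ᴴ) (a, u.2) (a', v.2)) =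
      ∑ t, ∑ s, (V u.2 s * star (V v.2 t)) • (Matrix.of fun a a' => X (a, s) (a', t) : Op A) := by
    ext a a'
    simp [hconj A, Matrix.sum_apply]
  change L (Matrix.of fun a a' => (((1 : Op A) ⊗ₖ V) * X * ((1 : Op A) ⊗ₖ V)ᴴ) (a, u.2) (a', v.2))
    u.1 v.1 = _
  rw [h1]
  simp only [map_sum, map_smul, Matrix.sum_apply, Matrix.smul_apply, smul_eq_mul]
  rfl

/-- Encoding without the Clifford: the traps are appended. -/
def appendTraps (n d : ℕ) (X : Op (Qubits n)) : Op (Qubits (n + d)) :=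
  Matrix.reindex (join n d) (join n d) (X ⊗ₖ proj (0 : Qubits d))

/-- Decoding without the Clifford: the traps are measured. -/
def checkTraps (n d : ℕ) (Ω : Op (Qubits n)) (X : Op (Qubits (n + d))) :
    Op (Qubits n × Flag) :=
  traceSnd (Matrix.reindex (join n d).symm (join n d).symm
      (trapAcc n d * X * (trapAcc n d)ᴴ)) ⊗ₖ accept +
    ((trapRej n d * X * (trapRej n d)ᴴ).trace • Ω) ⊗ₖ reject

theorem isLinearMap_checkTraps (Ω : Op (Qubits n)) : IsLinearMap ℂ (checkTraps n d Ω) := by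
  refine ⟨fun X Y => ?_, fun c X => ?_⟩
  · have h : ∀ X Y : Op (Qubits (n + d)), traceSnd (Matrix.reindex (join n d).symm (join n d).symm
        (X + Y)) = traceSnd (Matrix.reindex (join n d).symm (join n d).symm X) +
          traceSnd (Matrix.reindex (join n d).symm (join n d).symm Y) := by
      intro X Y
      exact isCPMap_traceSnd.1.map_add _ _
    simp only [checkTraps, Matrix.mul_add, Matrix.add_mul, h, Matrix.trace_add, add_smul,
      Matrix.add_kronecker]
    abel
  · have h : ∀ X : Op (Qubits (n + d)), traceSnd (Matrix.reindex (join n d).symm (join n d).symm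
        (c • X)) = c • traceSnd (Matrix.reindex (join n d).symm (join n d).symm X) := by
      intro X
      exact isCPMap_traceSnd.1.map_smul _ _
    simp only [checkTraps, Matrix.mul_smul, Matrix.smul_mul, h, Matrix.trace_smul, smul_assoc,
      Matrix.smul_kronecker, smul_add]

theorem checkTraps_appendTraps (Ω : Op (Qubits n)) (X : Op (Qubits n)) :
    checkTraps n d Ω (appendTraps n d X) = X ⊗ₖ accept := by
  rw [checkTraps, appendTraps, trapRej, Matrix.sub_mul, Matrix.one_mul, trapAcc_mul_code, sub_self,
    Matrix.zero_mul, Matrix.trace_zero, zero_smul, Matrix.zero_kronecker, add_zero,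
    trapAcc_conjTranspose, code_mul_trapAcc]
  congr 1
  have : Matrix.reindex (join n d).symm (join n d).symm
      (Matrix.reindex (join n d) (join n d) (X ⊗ₖ proj (0 : Qubits d))) =
        X ⊗ₖ proj (0 : Qubits d) := by
    ext; simp
  rw [this, traceSnd_kronecker, trace_proj, one_smul]

theorem trace_trapAcc (n d : ℕ) : (trapAcc n d).trace = 2 ^ n := by
  rw [trapAcc, trace_reindex, Matrix.trace_kronecker, trace_proj]
  simp

/-- The maximally mixed state, up to its weight: a fraction `2 ^ n` of `2 ^ (n + d)` passes the
check of the traps. -/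
theorem checkTraps_one (Ω : Op (Qubits n)) : checkTraps n d Ω 1 =
    (1 : Op (Qubits n)) ⊗ₖ accept + ((2 ^ (n + d) - 2 ^ n : ℂ) • Ω) ⊗ₖ reject := by
  rw [checkTraps, Matrix.mul_one, Matrix.mul_one, trapAcc_conjTranspose, trapAcc_mul_self]
  congr 2
  · have : Matrix.reindex (join n d).symm (join n d).symm (trapAcc n d) =
        (1 : Op (Qubits n)) ⊗ₖ proj (0 : Qubits d) := by
      ext; simp [trapAcc]
    rw [this, traceSnd_kronecker, trace_proj, one_smul]
  · have h := trace_compress_add (trapAcc_mul_self n d) (trapAcc_conjTranspose n d) 1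
    rw [Matrix.mul_one, Matrix.mul_one, trapAcc_conjTranspose, trapAcc_mul_self, trace_trapAcc,
      ← eq_sub_iff_add_eq'] at h
    rw [trapRej, h]
    simp

/-- The `M R F` output for a state on `C R` that is checked for traps. -/
def output (Ω : Op (Qubits n)) : Op (Qubits (n + d) × R) →ₗ[ℂ] Op ((Qubits n × R) × Flag) :=
  (Matrix.reindexLinearEquiv ℂ ℂ (reorder (Qubits n) R) (reorder (Qubits n) R)).toLinearMap ∘ₗ
    onLeftLinear R (isLinearMap_checkTraps Ω)

/-- The check of the traps when `C` is completely mixed and uncorrelated with `R`. -/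
theorem output_conj_kronecker (Ω : Op (Qubits n)) (V σ : Op R) :
    output (d := d) Ω (((1 : Op (Qubits (n + d))) ⊗ₖ V) * ((1 : Op (Qubits (n + d))) ⊗ₖ σ) *
      ((1 : Op (Qubits (n + d))) ⊗ₖ V)ᴴ) =
    ((1 : Op (Qubits n)) ⊗ₖ (V * σ * Vᴴ)) ⊗ₖ accept +
      (2 ^ (n + d) - 2 ^ n : ℂ) • (Ω ⊗ₖ (V * σ * Vᴴ)) ⊗ₖ reject := by
  rw [Matrix.conjTranspose_kronecker, ← Matrix.mul_kronecker_mul, ← Matrix.mul_kronecker_mul,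
    Matrix.conjTranspose_one, Matrix.mul_one, Matrix.mul_one]
  change Matrix.reindex _ _ (onLeft R (checkTraps n d Ω) _) = _
  rw [onLeft_kronecker (isLinearMap_checkTraps Ω), checkTraps_one]
  ext ⟨⟨a, r⟩, f⟩ ⟨⟨a', r'⟩, f'⟩
  simp [reorder]
  ring

/-- The check of the traps when nothing happened to `C`. -/
theorem output_conj_appendTraps (Ω : Op (Qubits n)) (V : Op R) (ρ : Op (Qubits n × R)) :
    output Ω (((1 : Op (Qubits (n + d))) ⊗ₖ V) * onLeft R (appendTraps n d) ρ *
      ((1 : Op (Qubits (n + d))) ⊗ₖ V)ᴴ) =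
    (((1 : Op (Qubits n)) ⊗ₖ V) * ρ * ((1 : Op (Qubits n)) ⊗ₖ V)ᴴ) ⊗ₖ accept := by
  have hlin : IsLinearMap ℂ (appendTraps n d) :=
    ((isCPMap_reindex (join n d)).comp (isCPMap_kronecker (posSemidef_proj (0 : Qubits d)))).1
  rw [← onLeft_conj_right hlin]
  change Matrix.reindex _ _ (onLeft R (fun X => checkTraps n d Ω (appendTraps n d X)) _) = _
  simp only [checkTraps_appendTraps]
  ext ⟨⟨a, r⟩, f⟩ ⟨⟨a', r'⟩, f'⟩
  simp [reorder, onLeft]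

theorem traceFst_onLeft_appendTraps (ρ : Op (Qubits n × R)) :
    traceFst (onLeft R (appendTraps n d) ρ) = traceFst ρ := by
  ext r r'
  have h : (appendTraps n d (Matrix.of fun a a' => ρ (a, r) (a', r'))).trace =
      (Matrix.of fun a a' => ρ (a, r) (a', r') : Op (Qubits n)).trace := by
    rw [appendTraps, trace_reindex, Matrix.trace_kronecker, trace_proj, mul_one]
  exact h

/-- The real-world output is the ideal accepting branch plus, for every non-identity Pauli, an
error term in which the traps fail to notice the attack with small weight. -/
theorem realAverage_eq (Ω : Op (Qubits n)) (U : Matrix.unitaryGroup (Qubits (n + d) × R) ℂ)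
    (ρ : Op (Qubits n × R)) :
    (cliffordCode n d Ω).realAverage U ρ =
      (((1 : Op (Qubits n)) ⊗ₖ pauliCoeff U.1 0) * ρ *
        ((1 : Op (Qubits n)) ⊗ₖ pauliCoeff U.1 0)ᴴ) ⊗ₖ accept +
      ∑ p ∈ Finset.univ.erase 0, ((4 : ℂ) ^ (n + d) - 1)⁻¹ • ((2 ^ (n + d) : ℂ) •
        (((1 : Op (Qubits n)) ⊗ₖ (pauliCoeff U.1 p * traceFst ρ * (pauliCoeff U.1 p)ᴴ)) ⊗ₖ accept +
          (2 ^ (n + d) - 2 ^ n : ℂ) •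
            (Ω ⊗ₖ (pauliCoeff U.1 p * traceFst ρ * (pauliCoeff U.1 p)ᴴ)) ⊗ₖ reject) -
        (((1 : Op (Qubits n)) ⊗ₖ pauliCoeff U.1 p) * ρ *
          ((1 : Op (Qubits n)) ⊗ₖ pauliCoeff U.1 p)ᴴ) ⊗ₖ accept) := by
  have h1 : ∀ k, (cliffordCode n d Ω).real U k ρ = output Ω
      ((k.opᴴ ⊗ₖ (1 : Op R)) * (U.1 * ((k.op ⊗ₖ (1 : Op R)) * onLeft R (appendTraps n d) ρ *
        (k.op ⊗ₖ (1 : Op R))ᴴ) * U.1ᴴ) * (k.opᴴ ⊗ₖ (1 : Op R))ᴴ) := by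
    intro k
    rw [← onLeft_conj k.op, ← onLeft_conj k.opᴴ, Matrix.conjTranspose_conjTranspose]
    rfl
  rw [Scheme.realAverage]
  simp only [h1]
  rw [← map_sum, ← map_smul, average_twirl, map_add, output_conj_appendTraps, map_sum]
  congr 1
  refine Finset.sum_congr rfl fun p _ => ?_
  rw [Matrix.mul_smul, Matrix.smul_mul, map_smul, Matrix.mul_sub, Matrix.sub_mul, map_sub,
    Matrix.mul_smul, Matrix.smul_mul, map_smul, output_conj_appendTraps, output_conj_kronecker,
    traceFst_onLeft_appendTraps]

theorem onRight_conj {M : Type} [Fintype M] [DecidableEq M] (K : Op R) (X : Op (M × R)) :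
    onRight M (fun X => K * X * Kᴴ) X = ((1 : Op M) ⊗ₖ K) * X * ((1 : Op M) ⊗ₖ K)ᴴ := by
  ext ⟨b, i⟩ ⟨b', i'⟩
  simp [onRight, Matrix.mul_apply, Fintype.sum_prod_type, Matrix.one_apply, apply_ite]

theorem traceFst_onRight {M : Type} [Fintype M] {Φ : Op R → Op R} (h : IsLinearMap ℂ Φ)
    (X : Op (M × R)) : traceFst (onRight M Φ X) = Φ (traceFst X) := by
  have h1 : traceFst X = ∑ a, (Matrix.of fun r r' => X (a, r) (a, r') : Op R) := by
    ext r r'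
    simp [traceFst, Matrix.sum_apply]
  have h2 := map_sum (h.mk' Φ) (fun a => (Matrix.of fun r r' => X (a, r) (a, r') : Op R))
    Finset.univ
  rw [h1]
  change _ = (h.mk' Φ) _
  rw [h2]
  ext r r'
  simp [traceFst, onRight, Matrix.sum_apply]

/-- The ideal output, in terms of the Pauli coefficients of the attack. -/
theorem ideal_eq (Ω : Op (Qubits n)) (U : Matrix.unitaryGroup (Qubits (n + d) × R) ℂ)
    (ρ : Op (Qubits n × R)) :
    ideal Ω (simAcc U) (simRej U) ρ =
      (((1 : Op (Qubits n)) ⊗ₖ pauliCoeff U.1 0) * ρ *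
        ((1 : Op (Qubits n)) ⊗ₖ pauliCoeff U.1 0)ᴴ) ⊗ₖ accept +
      ∑ p ∈ Finset.univ.erase 0,
        (Ω ⊗ₖ (pauliCoeff U.1 p * traceFst ρ * (pauliCoeff U.1 p)ᴴ)) ⊗ₖ reject := by
  have h1 : (simAcc U : Op R → Op R) = fun X => pauliCoeff U.1 0 * X * (pauliCoeff U.1 0)ᴴ :=
    funext (simAcc_eq U)
  rw [ideal, traceFst_onRight (isSimulator U).2.1.1, simRej_eq, h1, onRight_conj]
  congr 1
  ext u v
  simp only [Matrix.sum_apply, Matrix.kroneckerMap_apply, Finset.mul_sum, Finset.sum_mul]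

/-- The non-identity coefficients have total weight at most `1`, being one branch of the simulator.
-/
theorem sum_trace_pauliCoeff_le (U : Matrix.unitaryGroup (Qubits (n + d) × R) ℂ)
    {σ : Op R} (hσ : IsDensity σ) :
    ∑ p ∈ Finset.univ.erase 0, (pauliCoeff U.1 p * σ * (pauliCoeff U.1 p)ᴴ).trace.re ≤ 1 := by
  have h := (isSimulator U).2.2 σ
  simp only [simAcc_eq, simRej_eq] at h
  rw [hσ.2, Matrix.trace_add, Matrix.trace_sum] at h
  have h2 := congrArg Complex.re h
  rw [Complex.add_re, Complex.re_sum, Complex.one_re] at h2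
  have h3 := (Complex.le_def.mp (hσ.1.mul_mul_conjTranspose_same (pauliCoeff U.1 0)).trace_nonneg).1
  rw [Complex.zero_re] at h3
  linarith

/-- The bound for the traces of the error terms. For `n + d = 0` there is no non-identity Pauli matrix, and the left
side is `0` by the convention `0⁻¹ = 0`. -/
theorem weight_le (n d : ℕ) :
    ((4 : ℝ) ^ (n + d) - 1)⁻¹ * (2 ^ (n + d) * 2 ^ n) ≤ 3 / 2 ^ d := by
  rcases Nat.eq_zero_or_pos (n + d) with h | h
  · rw [h]
    norm_num
    positivity
  · have h4 : (4 : ℝ) ≤ 4 ^ (n + d) := by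
      calc (4 : ℝ) = 4 ^ 1 := by norm_num
        _ ≤ _ := pow_le_pow_right₀ (by norm_num) h
    have h5 : (2 : ℝ) ^ (n + d) * 2 ^ n * 2 ^ d = 4 ^ (n + d) := by
      rw [mul_assoc, ← pow_add, ← mul_pow]
      norm_num
    rw [inv_mul_eq_div, div_le_div_iff₀ (by linarith) (by positivity), h5]
    linarith

theorem posSemidef_traceFst {A : Type} [Fintype A] {ρ : Op (A × R)} (h : ρ.PosSemidef) :
    (traceFst ρ).PosSemidef := by
  have : traceFst ρ = ∑ a, ρ.submatrix (fun u => (a, u)) fun u => (a, u) := by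
    ext u v
    simp [traceFst, Matrix.sum_apply]
  rw [this]
  exact Matrix.posSemidef_sum _ fun b _ => h.submatrix _

/-- The difference of the two worlds consists of error terms, one for every non-identity Pauli
matrix in the expansion of the attack. -/
theorem cliffordCode_secure {Ω : Op (Qubits n)} (hΩ : IsDensity Ω)
    (U : Matrix.unitaryGroup (Qubits (n + d) × R) ℂ) {ρ : Op (Qubits n × R)} (hρ : IsDensity ρ) :
    traceDist ((cliffordCode n d Ω).realAverage U ρ) (ideal Ω (simAcc U) (simRej U) ρ) ≤
      3 / 2 ^ d := by
  set S : Finset (Fin (n + d) → Fin 4) := Finset.univ.erase 0 with hS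
  set G : (Fin (n + d) → Fin 4) → Op R := fun p =>
    pauliCoeff U.1 p * traceFst ρ * (pauliCoeff U.1 p)ᴴ with hG
  set Q : (Fin (n + d) → Fin 4) → Op (Qubits n × R) := fun p =>
    ((1 : Op (Qubits n)) ⊗ₖ pauliCoeff U.1 p) * ρ * ((1 : Op (Qubits n)) ⊗ₖ pauliCoeff U.1 p)ᴴ
    with hQ
  -- the probability of each of the non-identity Pauli matrices
  set N : ℝ := ((4 : ℝ) ^ (n + d) - 1)⁻¹ with hN
  have hN0 : 0 ≤ N := inv_nonneg.mpr (sub_nonneg.mpr (one_le_pow₀ (by norm_num)))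
  have hNc : ((4 : ℂ) ^ (n + d) - 1)⁻¹ = (N : ℂ) := by rw [hN]; push_cast; rfl
  set c : ℝ := 2 ^ (n + d) * 2 ^ n - 1 with hc
  have hc0 : 0 ≤ c := by
    have h1 : (1 : ℝ) ≤ 2 ^ (n + d) := one_le_pow₀ (by norm_num)
    have h2 : (1 : ℝ) ≤ 2 ^ n := one_le_pow₀ (by norm_num)
    nlinarith
  have hσ : IsDensity (traceFst ρ) :=
    ⟨posSemidef_traceFst hρ.1, by rw [trace_traceFst, hρ.2]⟩
  -- the difference is written as a difference of two positive operators of equal trace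
  let X : Op ((Qubits n × R) × Flag) :=
    ∑ p ∈ S, ((N * 2 ^ (n + d) : ℝ) : ℂ) • (((1 : Op (Qubits n)) ⊗ₖ G p) ⊗ₖ accept)
  let Y : Op ((Qubits n × R) × Flag) :=
    ∑ p ∈ S, ((N : ℂ) • (Q p ⊗ₖ accept) + ((N * c : ℝ) : ℂ) • ((Ω ⊗ₖ G p) ⊗ₖ reject))
  have hdiff : (cliffordCode n d Ω).realAverage U ρ - ideal Ω (simAcc U) (simRej U) ρ = X - Y := by
    rw [realAverage_eq, ideal_eq, add_sub_add_left_eq_sub, ← Finset.sum_sub_distrib,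
      ← Finset.sum_sub_distrib]
    refine Finset.sum_congr rfl fun p hp => ?_
    have hm : n + d ≠ 0 := by
      intro h
      have : IsEmpty (Fin (n + d)) := by rw [h]; infer_instance
      exact Finset.ne_of_mem_erase hp (Subsingleton.elim _ _)
    -- with `N (4 ^ (n + d) - 1) = 1`, the weight `N 2 ^ (n + d) (2 ^ (n + d) - 2 ^ n)` of rejection in the
    -- real world falls short of the weight `1` in the ideal world by `N c`
    have h4 : (N : ℂ) * ((2 : ℂ) ^ (n + d) * 2 ^ (n + d)) = N + 1 := by
      have h5 : (2 : ℂ) ^ (n + d) * 2 ^ (n + d) = 4 ^ (n + d) := by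
        rw [← mul_pow]; norm_num
      have h6 : (4 : ℂ) ^ (n + d) - 1 ≠ 0 := by
        rw [sub_ne_zero]
        have : (4 : ℕ) ^ (n + d) ≠ 1 := (Nat.one_lt_pow hm (by norm_num)).ne'
        exact_mod_cast this
      rw [h5, ← hNc]
      field_simp
      ring
    rw [hNc]
    ext u v
    simp only [Matrix.sub_apply, Matrix.add_apply, Matrix.smul_apply, smul_eq_mul, hc]
    simp only [Matrix.kroneckerMap_apply, hG, hQ]
    push_cast
    linear_combination (Ω u.1.1 v.1.1 * (pauliCoeff U.1 p * traceFst ρ * (pauliCoeff U.1 p)ᴴ)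
      u.1.2 v.1.2 * reject u.2 v.2) * h4
  have hGp : ∀ p, (G p).PosSemidef := fun p => hσ.1.mul_mul_conjTranspose_same _
  have hQp : ∀ p, (Q p).PosSemidef := fun p => hρ.1.mul_mul_conjTranspose_same _
  have hacc : accept.PosSemidef := posSemidef_proj _
  have hrej : reject.PosSemidef := posSemidef_proj _
  have hXp : X.PosSemidef := Matrix.posSemidef_sum _ fun p _ =>
    ((Matrix.PosSemidef.one.kronecker (hGp p)).kronecker hacc).smul
      (Complex.zero_le_real.mpr (by positivity))
  have hYp : Y.PosSemidef := Matrix.posSemidef_sum _ fun p _ =>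
    (((hQp p).kronecker hacc).smul (Complex.zero_le_real.mpr hN0)).add
      (((hΩ.1.kronecker (hGp p)).kronecker hrej).smul (Complex.zero_le_real.mpr (by positivity)))
  -- `G p` is the state of `R` in `Q p`
  have hQtr : ∀ p, (Q p).trace = (G p).trace := by
    intro p
    have h := traceFst_onRight (isCPMap_conj (pauliCoeff U.1 p)).1 ρ
    rw [onRight_conj] at h
    rw [← trace_traceFst, h]
  have hXtr : X.trace.re = N * (2 ^ (n + d) * 2 ^ n) * ∑ p ∈ S, (G p).trace.re := by
    simp only [X, Matrix.trace_sum, Matrix.trace_smul, Matrix.trace_kronecker, trace_accept,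
      mul_one, Complex.re_sum, smul_eq_mul, Finset.mul_sum, Complex.re_ofReal_mul]
    refine Finset.sum_congr rfl fun p _ => ?_
    have : (1 : Op (Qubits n)).trace = ((2 ^ n : ℝ) : ℂ) := by simp
    rw [this, Complex.re_ofReal_mul]
    ring
  have hYtr : Y.trace.re = N * (2 ^ (n + d) * 2 ^ n) * ∑ p ∈ S, (G p).trace.re := by
    simp only [Y, Matrix.trace_sum, Matrix.trace_add, Matrix.trace_smul, Matrix.trace_kronecker,
      trace_accept, trace_reject, hΩ.2, hQtr, one_mul, mul_one, Complex.re_sum, smul_eq_mul,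
      Complex.add_re, Finset.mul_sum, Complex.re_ofReal_mul]
    exact Finset.sum_congr rfl fun p _ => by rw [hc]; ring
  have hsum : ∑ p ∈ S, (G p).trace.re ≤ 1 := sum_trace_pauliCoeff_le U hσ
  have hbound := traceNorm_sub_le hXp hYp
  rw [hXtr, hYtr] at hbound
  have hw := weight_le n d
  rw [← hN] at hw
  have hw0 : 0 ≤ N * (2 ^ (n + d) * 2 ^ n) := by positivity
  rw [traceDist, hdiff]
  calc 1 / 2 * traceNorm (X - Y) ≤ N * (2 ^ (n + d) * 2 ^ n) * ∑ p ∈ S, (G p).trace.re := by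
        linarith
    _ ≤ N * (2 ^ (n + d) * 2 ^ n) * 1 := mul_le_mul_of_nonneg_left hsum hw0
    _ ≤ 3 / 2 ^ d := by rw [mul_one]; exact hw

end Security

/-! ### Stack programs -/

/-- The program that uses the stack `σ i` in place of the stack `i`. -/
def Program.rename {Γ : Type} (σ : ℕ → ℕ) : Program Γ → Program Γ
  | .skip => .skip
  | .push i a => .push (σ i) a
  | .pop i => .pop (σ i)
  | .seq p q => .seq (p.rename σ) (q.rename σ)
  | .cond i c p q => .cond (σ i) c (p.rename σ) (q.rename σ)
  | .loop i c p => .loop (σ i) c (p.rename σ)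

/-- A renamed program runs on the renamed stacks and leaves all others alone. -/
theorem Runs.rename {Γ : Type} {σ : ℕ → ℕ} (hσ : Function.Injective σ) {p : Program Γ}
    {s s' : ℕ → List Γ} {t : ℕ} (h : Runs p s t s') :
    ∀ S : ℕ → List Γ, (∀ i, S (σ i) = s i) → ∃ S', Runs (p.rename σ) S t S' ∧
      (∀ i, S' (σ i) = s' i) ∧ ∀ j, (∀ i, σ i ≠ j) → S' j = S j := by
  induction h with
  | skip s => exact fun S hS => ⟨S, .skip S, hS, fun _ _ => rfl⟩
  | push i a s =>
    intro S hS
    refine ⟨_, .push (σ i) a S, fun k => ?_, fun j hj => ?_⟩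
    · by_cases hk : k = i
      · subst hk; simp [hS]
      · rw [Function.update_of_ne hk, Function.update_of_ne (hσ.ne hk), hS]
    · rw [Function.update_of_ne (hj i).symm]
  | pop i s =>
    intro S hS
    refine ⟨_, .pop (σ i) S, fun k => ?_, fun j hj => ?_⟩
    · by_cases hk : k = i
      · subst hk; simp [hS]
      · rw [Function.update_of_ne hk, Function.update_of_ne (hσ.ne hk), hS]
    · rw [Function.update_of_ne (hj i).symm]
  | seq _ _ ih1 ih2 =>
    intro S hS
    obtain ⟨S1, h1, h1', h1''⟩ := ih1 S hS
    obtain ⟨S2, h2, h2', h2''⟩ := ih2 S1 h1'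
    exact ⟨S2, .seq h1 h2, h2', fun j hj => (h2'' j hj).trans (h1'' j hj)⟩
  | condTrue hc _ ih =>
    intro S hS
    obtain ⟨S1, h1, h1', h1''⟩ := ih S hS
    exact ⟨S1, .condTrue (by rwa [hS]) h1, h1', h1''⟩
  | condFalse hc _ ih =>
    intro S hS
    obtain ⟨S1, h1, h1', h1''⟩ := ih S hS
    exact ⟨S1, .condFalse (by rwa [hS]) h1, h1', h1''⟩
  | loopDone hc => exact fun S hS => ⟨S, .loopDone (by rwa [hS]), hS, fun _ _ => rfl⟩
  | loopStep hc _ _ ih1 ih2 =>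
    intro S hS
    obtain ⟨S1, h1, h1', h1''⟩ := ih1 S hS
    obtain ⟨S2, h2, h2', h2''⟩ := ih2 S1 h1'
    exact ⟨S2, .loopStep (by rwa [hS]) h1 h2, h2', fun j hj => (h2'' j hj).trans (h1'' j hj)⟩

/-- Every step adds at most one symbol. -/
theorem Runs.length_le {Γ : Type} {p : Program Γ} {s s' : ℕ → List Γ} {t : ℕ}
    (h : Runs p s t s') : ∀ i, (s' i).length ≤ (s i).length + t := by
  induction h with
  | skip s => intro i; omega
  | push j a s =>
    intro i
    by_cases hi : i = j
    · subst hi; simp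
    · rw [Function.update_of_ne hi]; omega
  | pop j s =>
    intro i
    by_cases hi : i = j
    · subst hi; simp only [Function.update_self, List.length_tail]; omega
    · rw [Function.update_of_ne hi]; omega
  | seq _ _ ih1 ih2 => intro i; have := ih1 i; have := ih2 i; omega
  | condTrue _ _ ih => intro i; have := ih i; omega
  | condFalse _ _ ih => intro i; have := ih i; omega
  | loopDone _ => intro i; omega
  | loopStep _ _ _ ih1 ih2 => intro i; have := ih1 i; have := ih2 i; omega

/-- `Reach p s b s'`: started in `s`, the program halts in `s'` after at most `b` steps. -/
def Reach {Γ : Type} (p : Program Γ) (s : ℕ → List Γ) (b : ℕ) (s' : ℕ → List Γ) : Prop :=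
  ∃ t ≤ b, Runs p s t s'

section Reach
variable {Γ : Type} {p q : Program Γ} {s s' s'' : ℕ → List Γ} {a b : ℕ}

theorem Reach.mono (h : Reach p s a s') (hab : a ≤ b) : Reach p s b s' := by
  obtain ⟨t, ht, h⟩ := h
  exact ⟨t, ht.trans hab, h⟩

theorem Reach.cast (h : Reach p s a s') (hab : a ≤ b) (hs : s' = s'') : Reach p s b s'' :=
  hs ▸ h.mono hab

theorem Reach.push (i : ℕ) (a : Γ) (s : ℕ → List Γ) :
    Reach (.push i a) s 1 (Function.update s i (a :: s i)) := ⟨1, le_rfl, .push i a s⟩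

theorem Reach.pop (i : ℕ) (s : ℕ → List Γ) :
    Reach (.pop i) s 1 (Function.update s i (s i).tail) := ⟨1, le_rfl, .pop i s⟩

theorem Reach.seq (h : Reach p s a s') (k : Reach q s' b s'') : Reach (.seq p q) s (a + b) s'' := by
  obtain ⟨t, ht, h⟩ := h
  obtain ⟨u, hu, k⟩ := k
  exact ⟨t + u, add_le_add ht hu, .seq h k⟩

theorem Reach.loopDone {i : ℕ} {c : Option Γ → Bool} (h : c (s i).head? = false) :
    Reach (.loop i c p) s 1 s := ⟨1, le_rfl, .loopDone h⟩

theorem Reach.loopStep {i : ℕ} {c : Option Γ → Bool} (hc : c (s i).head? = true)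
    (h : Reach p s a s') (k : Reach (.loop i c p) s' b s'') :
    Reach (.loop i c p) s (a + b + 1) s'' := by
  obtain ⟨t, ht, h⟩ := h
  obtain ⟨u, hu, k⟩ := k
  exact ⟨t + u + 1, by omega, .loopStep hc h k⟩

end Reach

/-- The stacks with the given contents, all further ones being empty. -/
def st {Γ : Type} (l : List (List Γ)) : ℕ → List Γ := fun i => l.getD i []

theorem update_st {Γ : Type} (l : List (List Γ)) (i : ℕ) (x : List Γ) (h : i < l.length) :
    Function.update (st l) i x = st (l.set i x) := by
  funext j
  by_cases hj : j = i
  · subst hj; simp [st, h]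
  · rw [Function.update_of_ne hj]
    simp [st, Ne.symm hj]

/-! ### Closure properties of polynomial-time computable words -/

/-- A power of a polynomial, as a bound for the running time of a composed program. -/
theorem exists_polynomial_eval (P : Polynomial ℕ) (C k : ℕ) :
    ∃ T : Polynomial ℕ, ∀ n, T.eval n = C * (P.eval n + 1) ^ k :=
  ⟨Polynomial.C C * (P + 1) ^ k, fun n => by simp⟩

/-- A program that computes `F n` from the polynomial-time words `f n`, `g n`, `h n` in time
polynomial in their lengths shows that `F` is polynomial-time. -/
theorem PolyTimeComputable.of_program {f g h F : ℕ → List Sym} (hf : PolyTimeComputable f)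
    (hg : PolyTimeComputable g) (hh : PolyTimeComputable h) (p : Program Sym) (C k : ℕ)
    (hp : ∀ n, ∃ S, Reach p (st [f n, [], g n, h n])
      (C * ((f n).length + (g n).length + (h n).length + 1) ^ k) S ∧ S 1 = F n) :
    PolyTimeComputable F := by
  obtain ⟨pf, Tf, hf⟩ := hf
  obtain ⟨pg, Tg, hg⟩ := hg
  obtain ⟨ph, Th, hh⟩ := hh
  -- the four programs get disjoint stacks, except that the outputs of the first three are the
  -- inputs of the last one
  let σf : ℕ → ℕ := fun i => 4 * i + 5
  let σg : ℕ → ℕ := fun i => 4 * i + 6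
  let σh : ℕ → ℕ := fun i => 4 * i + 7
  -- the stacks `9`, `10`, `11` are the output stacks of the first three programs
  let σp : ℕ → ℕ := fun i =>
    if i = 0 then 9 else if i = 1 then 1 else if i = 2 then 10 else if i = 3 then 11 else 4 * i
  have hσf : Function.Injective σf := fun i j h => by simp only [σf] at h; omega
  have hσg : Function.Injective σg := fun i j h => by simp only [σg] at h; omega
  have hσh : Function.Injective σh := fun i j h => by simp only [σh] at h; omega
  have hσp : Function.Injective σp := fun i j h => by
    simp only [σp] at h
    split_ifs at h <;> omega
  -- the input `1 ^ n` is copied to the input stacks of the first three programs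
  let copy : Program Sym := .loop 0 (fun o => o.isSome)
    (.seq (.pop 0) (.seq (.push 5 .one) (.seq (.push 6 .one) (.push 7 .one))))
  have hcopy : ∀ n a b c, Reach copy
      (st [unary n, [], [], [], [], a, b, c]) (5 * n + 1)
      (st [[], [], [], [], [], unary n ++ a, unary n ++ b, unary n ++ c]) := by
    intro n
    induction n with
    | zero => exact fun a b c => Reach.loopDone rfl
    | succ n ih =>
      intro a b c
      have h1 := ih (.one :: a) (.one :: b) (.one :: c)
      refine (Reach.loopStep rfl (Reach.seq (Reach.pop _ _) (Reach.seq (Reach.push _ _ _)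
        (Reach.seq (Reach.push _ _ _) (Reach.push _ _ _)))) ?_).mono
        (show 1 + (1 + (1 + 1)) + (5 * n + 1) + 1 ≤ _ by omega)
      have e : ∀ l : List Sym, unary n ++ .one :: l = unary (n + 1) ++ l := by
        intro l
        rw [unary, unary, List.replicate_succ', List.append_assoc]
        rfl
      rw [e, e, e] at h1
      simp only [update_st, List.length_cons, List.length_nil, Nat.reduceAdd,
        Nat.reduceLT, List.set]
      exact h1
  obtain ⟨T, hT⟩ := exists_polynomial_eval (Tf + Tg + Th) C k
  refine ⟨.seq copy (.seq (pf.rename σf) (.seq (pg.rename σg) (.seq (ph.rename σh)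
    (p.rename σp)))), 5 * Polynomial.X + 1 + (Tf + (Tg + (Th + T))), fun n => ?_⟩
  obtain ⟨t0, ht0, h0⟩ := hcopy n [] [] []
  obtain ⟨tf, sf, hrf, hvf, htf⟩ := hf n
  obtain ⟨tg, sg, hrg, hvg, htg⟩ := hg n
  obtain ⟨th, sh, hrh, hvh, hth⟩ := hh n
  obtain ⟨sp, ⟨tp, htp, hrp⟩, hvp⟩ := hp n
  have hlf := hrf.length_le 1
  have hlg := hrg.length_le 1
  have hlh := hrh.length_le 1
  rw [hvf, Function.update_of_ne (by norm_num)] at hlf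
  rw [hvg, Function.update_of_ne (by norm_num)] at hlg
  rw [hvh, Function.update_of_ne (by norm_num)] at hlh
  simp only [List.length_nil, zero_add] at hlf hlg hlh
  set S1 : ℕ → List Sym := st [[], [], [], [], [], unary n ++ [], unary n ++ [], unary n ++ []]
    with hS1
  have hbig : ∀ j, 8 ≤ j → S1 j = [] := by
    intro j hj
    rw [hS1, st, List.getD_eq_default]
    simpa using hj
  obtain ⟨S2, hr2, hv2, hn2⟩ := hrf.rename hσf S1 (by
    rintro (_ | i)
    · simp [σf, hS1, st]
    · rw [Function.update_of_ne (by omega)]; exact hbig _ (by simp only [σf]; omega))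
  obtain ⟨S3, hr3, hv3, hn3⟩ := hrg.rename hσg S2 (by
    rintro (_ | i)
    · rw [hn2 _ (by intro i; simp only [σf, σg]; omega)]; simp [σg, hS1, st]
    · rw [hn2 _ (by intro i; simp only [σf, σg]; omega), Function.update_of_ne (by omega)]
      exact hbig _ (by simp only [σg]; omega))
  obtain ⟨S4, hr4, hv4, hn4⟩ := hrh.rename hσh S3 (by
    rintro (_ | i)
    · rw [hn3 _ (by intro i; simp only [σg, σh]; omega),
        hn2 _ (by intro i; simp only [σf, σh]; omega)]
      simp [σh, hS1, st]
    · rw [hn3 _ (by intro i; simp only [σg, σh]; omega),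
        hn2 _ (by intro i; simp only [σf, σh]; omega), Function.update_of_ne (by omega)]
      exact hbig _ (by simp only [σh]; omega))
  obtain ⟨S5, hr5, hv5, hn5⟩ := hrp.rename hσp S4 (by
    rintro (_ | _ | _ | _ | i)
    · change S4 9 = f n
      rw [hn4 _ (by intro i; simp only [σh]; omega), hn3 _ (by intro i; simp only [σg]; omega),
        ← hvf, ← hv2]
    · change S4 1 = []
      rw [hn4 _ (by intro i; simp only [σh]; omega), hn3 _ (by intro i; simp only [σg]; omega),
        hn2 _ (by intro i; simp only [σf]; omega)]
      rfl
    · change S4 10 = g n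
      rw [hn4 _ (by intro i; simp only [σh]; omega), ← hvg, ← hv3]
    · change S4 11 = h n
      rw [← hvh, ← hv4]
    · have e : σp (i + 1 + 1 + 1 + 1) = 4 * (i + 4) := by simp [σp]
      rw [e, hn4 _ (by intro i; simp only [σh]; omega), hn3 _ (by intro i; simp only [σg]; omega),
        hn2 _ (by intro i; simp only [σf]; omega), hbig _ (by omega)]
      rfl)
  have hstart : (Function.update (fun _ => []) 0 (unary n) : ℕ → List Sym) =
      st [unary n, [], [], [], [], [], [], []] := by
    funext j
    rcases j with _ | _ | _ | _ | _ | _ | _ | _ | j <;> rfl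
  refine ⟨_, S5, by rw [hstart]; exact .seq h0 (.seq hr2 (.seq hr3 (.seq hr4 hr5))), ?_, ?_⟩
  · rw [← hvp, ← hv5]
    rfl
  · have hle : tp ≤ C * ((Tf + Tg + Th).eval n + 1) ^ k := by
      refine htp.trans (Nat.mul_le_mul_left _ (Nat.pow_le_pow_left ?_ _))
      simp only [Polynomial.eval_add]
      omega
    simp only [Polynomial.eval_add, Polynomial.eval_mul, Polynomial.eval_X, Polynomial.eval_one,
      hT n, Polynomial.eval_ofNat]
    simp only [Polynomial.eval_add] at hle
    omega

/-- The version of `PolyTimeComputable.of_program` for finite lists of stacks, where the program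
uses `e` further stacks that are empty at the start. -/
theorem PolyTimeComputable.of_program_st {f g h F : ℕ → List Sym} (hf : PolyTimeComputable f)
    (hg : PolyTimeComputable g) (hh : PolyTimeComputable h) (p : Program Sym) (e C k : ℕ)
    (hp : ∀ n, ∃ L b, Reach p (st ([f n, [], g n, h n] ++ List.replicate e [])) b (st L) ∧
      L.getD 1 [] = F n ∧ b ≤ C * ((f n).length + (g n).length + (h n).length + 1) ^ k) :
    PolyTimeComputable F := by
  refine .of_program hf hg hh p C k fun n => ?_
  obtain ⟨L, b, h1, hL, hb⟩ := hp n
  refine ⟨st L, ?_, hL⟩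
  have h0 : st [f n, [], g n, h n] = st ([f n, [], g n, h n] ++ List.replicate e []) := by
    funext j
    rcases j with _ | _ | _ | _ | j
    · rfl
    · rfl
    · rfl
    · rfl
    · by_cases hj : j < e <;> simp [st, hj]
  rw [h0]
  exact h1.mono hb

/-- The symbols, in the order in which `caseTop` tests for them. -/
def Sym.all : List Sym :=
  [.one, .sep, .mark, .gate .hadamard, .gate .tGate, .gate .not, .gate .cnot, .gate .toffoli]

theorem Sym.mem_all (a : Sym) : a ∈ Sym.all := by
  cases a with
  | gate g => cases g <;> simp [Sym.all]
  | _ => simp [Sym.all]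

open Classical in
/-- The test whether the top symbol is `a`. -/
def topIs (a : Sym) (o : Option Sym) : Bool := decide (o = some a)

open Classical in
/-- The test whether there is a top symbol and it is not `a`. -/
def topIsNot (a : Sym) (o : Option Sym) : Bool := decide (o.isSome ∧ o ≠ some a)

/-- Branch on the top symbol of stack `i`. -/
def caseTop (i : ℕ) (k : Sym → Program Sym) : Program Sym :=
  Sym.all.foldr (fun a p => .cond i (topIs a) (k a) p) .skip

theorem reach_caseTop {i : ℕ} {k : Sym → Program Sym} {s s' : ℕ → List Sym} {a : Sym}
    {w : List Sym} {b : ℕ} (hs : s i = a :: w) (h : Reach (k a) s b s') :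
    Reach (caseTop i k) s (b + 8) s' := by
  have key : ∀ l : List Sym, a ∈ l →
      Reach (l.foldr (fun a p => .cond i (topIs a) (k a) p) .skip) s (b + l.length) s' := by
    intro l
    induction l with
    | nil => simp
    | cons c l ih =>
      intro ha
      by_cases hc : c = a
      · subst hc
        obtain ⟨t, ht, h⟩ := h
        exact ⟨t + 1, by simp only [List.length_cons]; omega,
          .condTrue (by simp [topIs, hs]) h⟩
      · obtain ⟨t, ht, h⟩ := ih ((List.mem_cons.mp ha).resolve_left (Ne.symm hc))
        exact ⟨t + 1, by simp only [List.length_cons]; omega,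
          .condFalse (by simp [topIs, hs, Ne.symm hc]) h⟩
  exact key _ (Sym.mem_all a)

/-- Move symbols from stack `i` to stack `j` as long as the top symbol satisfies `c`. -/
def moveWhile (c : Option Sym → Bool) (i j : ℕ) : Program Sym :=
  .loop i c (caseTop i fun a => .seq (.pop i) (.push j a))

/-- Move symbols from stack `i` to both stacks `j` and `k`. -/
def moveWhile₂ (c : Option Sym → Bool) (i j k : ℕ) : Program Sym :=
  .loop i c (caseTop i fun a => .seq (.pop i) (.seq (.push j a) (.push k a)))

theorem reach_moveWhile {c : Option Sym → Bool} (L : List (List Sym)) (i j : ℕ)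
    (w rest : List Sym) (hi : i < L.length) (hj : j < L.length) (hij : i ≠ j)
    (hL : L.getD i [] = w ++ rest) (hc : ∀ a ∈ w, c (some a) = true)
    (hrest : c rest.head? = false) :
    Reach (moveWhile c i j) (st L) (12 * w.length + 1)
      (st ((L.set i rest).set j (w.reverse ++ L.getD j []))) := by
  have key : ∀ (w : List Sym) (s : ℕ → List Sym), s i = w ++ rest → (∀ a ∈ w, c (some a) = true) →
      Reach (moveWhile c i j) s (12 * w.length + 1)
        (Function.update (Function.update s i rest) j (w.reverse ++ s j)) := by
    intro w
    induction w with
    | nil =>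
      intro s hs _
      have : Function.update (Function.update s i rest) j ([].reverse ++ s j) = s := by
        rw [show rest = s i by simpa using hs.symm]
        simp
      rw [this]
      exact Reach.loopDone (by rw [hs]; exact hrest)
    | cons a w ih =>
      intro s hs hc
      have h1 := reach_caseTop (k := fun a => .seq (.pop i) (.push j a)) hs
        ((Reach.pop i s).seq (Reach.push j a _))
      refine (Reach.loopStep (by rw [hs]; exact hc a (by simp)) h1
        (ih _ ?_ fun b hb => hc b (by simp [hb]))).cast
          (b := 12 * (a :: w).length + 1) (by simp only [List.length_cons]; omega) ?_
      · rw [Function.update_of_ne hij, Function.update_self, hs]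
        rfl
      · funext l
        by_cases hl : l = j
        · subst hl
          simp [Function.update_of_ne hij.symm]
        · by_cases hl' : l = i
          · subst hl'
            simp [Function.update_of_ne hij]
          · simp [Function.update_of_ne hl, Function.update_of_ne hl']
  have h := key w (st L) hL hc
  rwa [update_st _ _ _ hi, update_st _ _ _ (by simpa using hj)] at h

theorem reach_moveWhile₂ {c : Option Sym → Bool} (L : List (List Sym)) (i j k : ℕ)
    (w rest : List Sym) (hi : i < L.length) (hj : j < L.length) (hk : k < L.length) (hij : i ≠ j)
    (hik : i ≠ k) (hjk : j ≠ k)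
    (hL : L.getD i [] = w ++ rest) (hc : ∀ a ∈ w, c (some a) = true)
    (hrest : c rest.head? = false) :
    Reach (moveWhile₂ c i j k) (st L) (12 * w.length + 1)
      (st (((L.set i rest).set j (w.reverse ++ L.getD j [])).set k (w.reverse ++ L.getD k []))) := by
  have key : ∀ (w : List Sym) (s : ℕ → List Sym), s i = w ++ rest → (∀ a ∈ w, c (some a) = true) →
      Reach (moveWhile₂ c i j k) s (12 * w.length + 1)
        (Function.update (Function.update (Function.update s i rest) j (w.reverse ++ s j)) k
          (w.reverse ++ s k)) := by
    intro w
    induction w with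
    | nil =>
      intro s hs _
      have : Function.update (Function.update (Function.update s i rest) j ([].reverse ++ s j)) k
          ([].reverse ++ s k) = s := by
        rw [show rest = s i by simpa using hs.symm]
        simp
      rw [this]
      exact Reach.loopDone (by rw [hs]; exact hrest)
    | cons a w ih =>
      intro s hs hc
      have h1 := reach_caseTop (k := fun a => .seq (.pop i) (.seq (.push j a) (.push k a))) hs
        ((Reach.pop i s).seq ((Reach.push j a _).seq (Reach.push k a _)))
      refine (Reach.loopStep (by rw [hs]; exact hc a (by simp)) h1
        (ih _ ?_ fun b hb => hc b (by simp [hb]))).cast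
          (b := 12 * (a :: w).length + 1) (by simp only [List.length_cons]; omega) ?_
      · rw [Function.update_of_ne hik, Function.update_of_ne hij, Function.update_self, hs]
        rfl
      · funext l
        by_cases hl : l = k
        · subst hl
          simp [Function.update_of_ne hik.symm, Function.update_of_ne hjk.symm]
        · by_cases hl' : l = j
          · subst hl'
            simp [Function.update_of_ne hij.symm, Function.update_of_ne hjk]
          · by_cases hl'' : l = i
            · subst hl''
              simp [Function.update_of_ne hij, Function.update_of_ne hik]
            · simp [Function.update_of_ne hl, Function.update_of_ne hl', Function.update_of_ne hl'']
  have h := key w (st L) hL hc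
  rwa [update_st _ _ _ hi, update_st _ _ _ (by simpa using hj),
    update_st _ _ _ (by simpa using hk)] at h

/-- Move everything from stack `i` to stack `j`. -/
def moveAll (i j : ℕ) : Program Sym := moveWhile Option.isSome i j

theorem reach_moveAll (L : List (List Sym)) (i j : ℕ) (w : List Sym) (hi : i < L.length)
    (hj : j < L.length) (hij : i ≠ j) (hL : L.getD i [] = w) :
    Reach (moveAll i j) (st L) (12 * w.length + 1)
      (st ((L.set i []).set j (w.reverse ++ L.getD j []))) :=
  reach_moveWhile L i j w [] hi hj hij (by simpa using hL) (by simp) rfl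

/-- Put a reversed copy of stack `i` on stack `j`, with the help of the empty stack `k`. -/
def copyTo (i j k : ℕ) : Program Sym := .seq (moveWhile₂ Option.isSome i j k) (moveAll k i)

theorem reach_copyTo (L : List (List Sym)) (i j k : ℕ) (w : List Sym) (hi : i < L.length)
    (hj : j < L.length) (hk : k < L.length) (hij : i ≠ j) (hik : i ≠ k) (hjk : j ≠ k)
    (hL : L.getD i [] = w) (hk0 : L.getD k [] = []) :
    Reach (copyTo i j k) (st L) (24 * w.length + 2) (st (L.set j (w.reverse ++ L.getD j []))) := by
  have h1 := reach_moveWhile₂ (c := Option.isSome) L i j k w [] hi hj hk hij hik hjk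
    (by simpa using hL) (by simp) rfl
  have h2 := reach_moveAll (((L.set i []).set j (w.reverse ++ L.getD j [])).set k
    (w.reverse ++ L.getD k [])) k i w.reverse (by simpa using hk) (by simpa using hi) hik.symm
    (by rw [List.getD_eq_getElem _ _ (by simpa using hk), List.getElem_set_self, hk0,
      List.append_nil])
  refine (h1.seq h2).cast (by simp only [List.length_reverse]; omega) (congrArg st ?_)
  rw [List.getD_eq_getElem _ _ hi] at hL
  rw [List.getD_eq_getElem _ _ hk] at hk0
  refine List.ext_getElem (by simp) fun l h1 h2 => ?_
  simp only [List.getElem_set, List.reverse_reverse, List.getD_eq_getElem?_getD,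
    List.getElem?_set, List.length_set]
  by_cases hli : i = l
  · subst hli
    simp [hij.symm, hik.symm, hL, hi]
  · by_cases hlk : k = l
    · subst hlk
      simp [hjk, hli, hk0]
    · simp [hli, hlk]

theorem polyTimeComputable_unary : PolyTimeComputable unary := by
  let p : Program Sym := .loop 0 Option.isSome (.seq (.pop 0) (.push 1 Sym.one))
  have h : ∀ n a, Reach p (st [unary n, a]) (3 * n + 1) (st [[], unary n ++ a]) := by
    intro n
    induction n with
    | zero => exact fun a => Reach.loopDone rfl
    | succ n ih =>
      intro a
      have h1 := ih (.one :: a)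
      rw [show unary n ++ .one :: a = unary (n + 1) ++ a by
        rw [unary, unary, List.replicate_succ', List.append_assoc]; rfl] at h1
      refine (Reach.loopStep rfl (Reach.seq (Reach.pop _ _) (Reach.push _ _ _)) ?_).mono
        (show 1 + 1 + (3 * n + 1) + 1 ≤ _ by omega)
      rw [update_st _ _ _ (by simp), update_st _ _ _ (by simp)]
      exact h1
  refine ⟨p, 3 * Polynomial.X + 1, fun n => ?_⟩
  obtain ⟨t, ht, h⟩ := h n []
  have h0 : (Function.update (fun _ => []) 0 (unary n) : ℕ → List Sym) = st [unary n, []] := by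
    funext j
    rcases j with _ | _ | j <;> rfl
  exact ⟨t, _, h0 ▸ h, by simp [st], by simpa using ht⟩

theorem polyTimeComputable_const (w : List Sym) : PolyTimeComputable fun _ => w := by
  induction w with
  | nil => exact ⟨.skip, 1, fun n => ⟨1, _, .skip _, by simp, by simp⟩⟩
  | cons a w ih =>
    obtain ⟨p, T, hp⟩ := ih
    refine ⟨.seq p (.push 1 a), T + 1, fun n => ?_⟩
    obtain ⟨t, s, hr, hs, ht⟩ := hp n
    exact ⟨t + 1, _, .seq hr (.push 1 a s), by simp [hs], by simpa using ht⟩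

theorem PolyTimeComputable.append {f g : ℕ → List Sym} (hf : PolyTimeComputable f)
    (hg : PolyTimeComputable g) : PolyTimeComputable fun n => f n ++ g n := by
  refine .of_program_st hf hg hg (.seq (moveAll 0 4) (.seq (moveAll 2 5) (.seq (moveAll 5 1)
    (moveAll 4 1)))) 2 24 1 fun n => ?_
  have h1 := reach_moveAll [f n, [], g n, g n, [], []] 0 4 (f n) (by simp) (by simp) (by simp) rfl
  have h2 := reach_moveAll [[], [], g n, g n, (f n).reverse ++ [], []] 2 5 (g n) (by simp)
    (by simp) (by simp) rfl
  have h3 := reach_moveAll [[], [], [], g n, (f n).reverse ++ [], (g n).reverse ++ []] 5 1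
    ((g n).reverse ++ []) (by simp) (by simp) (by simp) rfl
  have h4 := reach_moveAll [[], ((g n).reverse ++ []).reverse ++ [], [], g n,
    (f n).reverse ++ [], []] 4 1 ((f n).reverse ++ []) (by simp) (by simp) (by simp) rfl
  refine ⟨_, _, (h1.seq (h2.seq (h3.seq h4))), by simp, ?_⟩
  · simp only [List.append_nil, List.length_reverse, pow_one]
    omega

/-- The part of a word before the first occurrence of a symbol. -/
theorem PolyTimeComputable.takeUntil {f w rest : ℕ → List Sym} (a : Sym)
    (hf : PolyTimeComputable f) (hw : ∀ n, a ∉ w n) (h : ∀ n, f n = w n ++ a :: rest n) :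
    PolyTimeComputable w := by
  refine .of_program_st hf hf hf (.seq (moveWhile (topIsNot a) 0 4) (moveAll 4 1)) 1 24 1
    fun n => ?_
  have h1 := reach_moveWhile (c := topIsNot a) [f n, [], f n, f n, []] 0 4 (w n) (a :: rest n)
    (by simp) (by simp) (by simp) (h n)
    (fun b hb => by simp only [topIsNot]; simp; rintro rfl; exact hw n hb) (by simp [topIsNot])
  have h2 := reach_moveAll [a :: rest n, [], f n, f n, (w n).reverse ++ []] 4 1
    ((w n).reverse ++ []) (by simp) (by simp) (by simp) rfl
  refine ⟨_, _, (h1.seq h2), by simp, ?_⟩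
  · have := congrArg List.length (h n)
    simp only [List.append_nil, List.length_reverse, List.length_append, pow_one] at this ⊢
    omega

/-- The part of a word after the first occurrence of a symbol. -/
theorem PolyTimeComputable.dropThrough {f w rest : ℕ → List Sym} (a : Sym)
    (hf : PolyTimeComputable f) (hw : ∀ n, a ∉ w n) (h : ∀ n, f n = w n ++ a :: rest n) :
    PolyTimeComputable rest := by
  refine .of_program_st hf hf hf (.seq (moveWhile (topIsNot a) 0 4) (.seq (.pop 0)
    (.seq (moveAll 0 5) (moveAll 5 1)))) 2 24 1 fun n => ?_
  have h1 := reach_moveWhile (c := topIsNot a) [f n, [], f n, f n, [], []] 0 4 (w n) (a :: rest n)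
    (by simp) (by simp) (by simp) (h n)
    (fun b hb => by simp only [topIsNot]; simp; rintro rfl; exact hw n hb) (by simp [topIsNot])
  have h2 := Reach.pop 0 (st [a :: rest n, [], f n, f n, (w n).reverse ++ [], []])
  rw [update_st _ _ _ (by simp)] at h2
  have h3 := reach_moveAll [rest n, [], f n, f n, (w n).reverse ++ [], []] 0 5
    (rest n) (by simp) (by simp) (by simp) rfl
  have h4 := reach_moveAll [[], [], f n, f n, (w n).reverse ++ [], (rest n).reverse ++ []] 5 1
    ((rest n).reverse ++ []) (by simp) (by simp) (by simp) rfl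
  refine ⟨_, _, (h1.seq (h2.seq (h3.seq h4))), by simp, ?_⟩
  · have := congrArg List.length (h n)
    simp only [List.append_nil, List.length_reverse, List.length_append, List.length_cons, pow_one] at this ⊢
    omega

open Classical in
/-- Replace every occurrence of the symbol `a` by a word. -/
def substWord (a : Sym) (g w : List Sym) : List Sym := w.flatMap fun b => if b = a then g else [b]

theorem length_substWord_le (a : Sym) (g w : List Sym) :
    (substWord a g w).length ≤ w.length * (g.length + 1) := by
  classical
  induction w with
  | nil => simp [substWord]
  | cons b w ih =>
    rw [substWord, List.flatMap_cons, List.length_append, List.length_cons]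
    have : (if b = a then g else [b]).length ≤ g.length + 1 := by split_ifs <;> simp
    rw [substWord] at ih
    linarith

/-- Scan the word, and push either the scanned symbol or a copy of the substituted word. -/
theorem PolyTimeComputable.subst {f g : ℕ → List Sym} (a : Sym) (hf : PolyTimeComputable f)
    (hg : PolyTimeComputable g) : PolyTimeComputable fun n => substWord a (g n) (f n) := by
  classical
  let body : Program Sym := caseTop 0 fun b =>
    if b = a then .seq (.pop 0) (copyTo 2 4 5) else .seq (.pop 0) (.push 4 b)
  have hloop : ∀ (g w acc : List Sym), Reach (.loop 0 Option.isSome body)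
      (st [w, [], g, g, acc, []]) (w.length * (24 * g.length + 12) + 1)
      (st [[], [], g, g, (substWord a g w).reverse ++ acc, []]) := by
    intro g w
    induction w with
    | nil => exact fun acc => (Reach.loopDone rfl).mono (by simp)
    | cons b w ih =>
      intro acc
      have h1 : Reach body (st [b :: w, [], g, g, acc, []]) (24 * g.length + 11)
          (st [w, [], g, g, (if b = a then g else [b]).reverse ++ acc, []]) := by
        refine (reach_caseTop (b := 24 * g.length + 3) (w := w) rfl ?_).mono (by omega)
        have h2 := Reach.pop 0 (st [b :: w, [], g, g, acc, []])
        rw [update_st _ _ _ (by simp)] at h2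
        split_ifs with hb
        · exact (h2.seq (reach_copyTo [w, [], g, g, acc, []] 2 4 5 g (by simp) (by simp) (by simp)
            (by simp) (by simp) (by simp) rfl rfl)).mono (by omega)
        · have h3 := Reach.push 4 b (st [w, [], g, g, acc, []])
          rw [update_st _ _ _ (by simp)] at h3
          exact (h2.seq h3).mono (by omega)
      refine (Reach.loopStep rfl h1 (ih _)).cast (by simp only [List.length_cons]; linarith) ?_
      simp [substWord]
  refine .of_program_st hf hg hg (.seq (.loop 0 Option.isSome body) (moveAll 4 1)) 2 50 2
    fun n => ?_
  have h2 := reach_moveAll [[], [], g n, g n, (substWord a (g n) (f n)).reverse ++ [], []] 4 1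
    ((substWord a (g n) (f n)).reverse ++ []) (by simp) (by simp) (by simp) rfl
  refine ⟨_, _, ((hloop (g n) (f n) []).seq h2), by simp, ?_⟩
  · have := length_substWord_le a (g n) (f n)
    simp only [List.append_nil, List.length_reverse]
    nlinarith

/-- The code of a list of wires. -/
def encodeList (l : List ℕ) : List Sym := l.flatMap encodeNat

theorem length_unary (i : ℕ) : (unary i).length = i := by simp [unary]

theorem reverse_unary (i : ℕ) : (unary i).reverse = unary i := by simp [unary]

theorem encodeList_cons (a : ℕ) (l : List ℕ) :
    encodeList (a :: l) = unary a ++ .sep :: encodeList l := by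
  simp [encodeList, encodeNat]

theorem topIs_one_of_mem_unary (k : ℕ) : ∀ a ∈ unary k, topIs .one (some a) = true := by
  intro a ha
  simp [topIs, List.eq_of_mem_replicate ha]

theorem length_encodeList_range'_le (k o B : ℕ) (h : o + k ≤ B) :
    (encodeList (List.range' o k)).length ≤ k * (B + 1) := by
  induction k generalizing o with
  | zero => simp [encodeList]
  | succ k ih =>
    have := ih (o + 1) (by omega)
    rw [List.range'_succ, encodeList_cons, List.length_append, length_unary, List.length_cons]
    linarith

/-- An interval of wires: a counter is written down and increased `k` times. -/
theorem PolyTimeComputable.range {o k : ℕ → ℕ} (ho : PolyTimeComputable fun n => unary (o n))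
    (hk : PolyTimeComputable fun n => unary (k n)) :
    PolyTimeComputable fun n => encodeList (List.range' (o n) (k n)) := by
  let p : Program Sym := .loop 2 Option.isSome (.seq (.pop 2) (.seq (copyTo 0 4 5)
    (.seq (.push 4 .sep) (.push 0 .one))))
  have hloop : ∀ (z : List Sym) (B k o : ℕ) (acc : List Sym), o + k ≤ B →
      Reach p (st [unary o, [], unary k, z, acc, []]) (k * (24 * B + 6) + 1)
      (st [unary (o + k), [], [], z, (encodeList (List.range' o k)).reverse ++ acc, []]) := by
    intro z B k
    induction k with
    | zero => exact fun o acc _ => (Reach.loopDone rfl).mono (by simp)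
    | succ k ih =>
      intro o acc hB
      have h1 := Reach.pop 2 (st [unary o, [], unary (k + 1), z, acc, []])
      have h2 := reach_copyTo [unary o, [], unary k, z, acc, []] 0 4 5 (unary o) (by simp)
        (by simp) (by simp) (by simp) (by simp) (by simp) rfl rfl
      have h3 := Reach.push 4 Sym.sep (st [unary o, [], unary k, z, (unary o).reverse ++ acc, []])
      have h4 := Reach.push 0 Sym.one
        (st [unary o, [], unary k, z, .sep :: ((unary o).reverse ++ acc), []])
      rw [update_st _ _ _ (by simp)] at h1 h3 h4
      have h5 := ih (o + 1) (.sep :: ((unary o).reverse ++ acc)) (by omega)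
      refine (Reach.loopStep rfl (h1.seq (h2.seq (h3.seq h4))) h5).cast ?_ ?_
      · rw [length_unary]
        nlinarith
      · rw [Nat.add_right_comm, Nat.add_assoc, List.range'_succ, encodeList_cons]
        simp
  refine .of_program_st ho hk hk (.seq p (moveAll 4 1)) 2 50 2 fun n => ?_
  have h2 := reach_moveAll [unary (o n + k n), [], [], unary (k n),
    (encodeList (List.range' (o n) (k n))).reverse ++ [], []] 4 1
    ((encodeList (List.range' (o n) (k n))).reverse ++ []) (by simp) (by simp) (by simp) rfl
  refine ⟨_, _, ((hloop _ _ (k n) (o n) [] le_rfl).seq h2), by simp, ?_⟩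
  · have := length_encodeList_range'_le (k n) (o n) _ le_rfl
    simp only [List.append_nil, List.length_reverse, length_unary]
    nlinarith

/-- A list of wires is cut after `k` entries by counting their end markers. -/
theorem PolyTimeComputable.split {k : ℕ → ℕ} {l l' : ℕ → List ℕ}
    (hl : PolyTimeComputable fun n => encodeList (l n ++ l' n)) (hlen : ∀ n, (l n).length = k n)
    (hk : PolyTimeComputable fun n => unary (k n)) :
    (PolyTimeComputable fun n => encodeList (l n)) ∧
      PolyTimeComputable fun n => encodeList (l' n) := by
  let p : Program Sym := .loop 2 Option.isSome (.seq (.pop 2) (.seq (moveWhile (topIs .one) 0 4)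
    (.seq (.pop 0) (.push 4 .sep))))
  have hloop : ∀ (z rest : List Sym) (l : List ℕ) (acc : List Sym),
      Reach p (st [encodeList l ++ rest, [], unary l.length, z, acc, []])
        (12 * (encodeList l).length + 1)
        (st [rest, [], [], z, (encodeList l).reverse ++ acc, []]) := by
    intro z rest l
    induction l with
    | nil => exact fun acc => (Reach.loopDone rfl).mono (by simp)
    | cons a l ih =>
      intro acc
      rw [encodeList_cons, List.append_assoc, List.cons_append, List.length_cons]
      have h1 := Reach.pop 2 (st [unary a ++ .sep :: (encodeList l ++ rest), [],
        unary (l.length + 1), z, acc, []])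
      have h2 := reach_moveWhile (c := topIs .one) [unary a ++ .sep :: (encodeList l ++ rest), [],
        unary l.length, z, acc, []] 0 4 (unary a) (.sep :: (encodeList l ++ rest)) (by simp)
        (by simp) (by simp) rfl (topIs_one_of_mem_unary a) (by simp [topIs])
      have h3 := Reach.pop 0 (st [.sep :: (encodeList l ++ rest), [],
        unary l.length, z, (unary a).reverse ++ acc, []])
      have h4 := Reach.push 4 Sym.sep (st [encodeList l ++ rest, [], unary l.length, z,
        (unary a).reverse ++ acc, []])
      rw [update_st _ _ _ (by simp)] at h1 h3 h4
      have h5 := ih (.sep :: ((unary a).reverse ++ acc))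
      refine (Reach.loopStep rfl (h1.seq (h2.seq (h3.seq h4))) h5).cast ?_ ?_
      · simp only [List.length_append, List.length_cons]
        omega
      · simp
  have hsplit : ∀ n, encodeList (l n ++ l' n) = encodeList (l n) ++ encodeList (l' n) := by
    intro n
    simp [encodeList]
  constructor
  · refine .of_program_st hl hk hk (.seq p (moveAll 4 1)) 2 24 1 fun n => ?_
    have h1 := hloop (unary (k n)) (encodeList (l' n)) (l n) []
    rw [hlen, ← hsplit] at h1
    have h2 := reach_moveAll [encodeList (l' n), [], [], unary (k n),
      (encodeList (l n)).reverse ++ [], []] 4 1 ((encodeList (l n)).reverse ++ []) (by simp)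
      (by simp) (by simp) rfl
    refine ⟨_, _, (h1.seq h2), by simp, ?_⟩
    · simp only [List.append_nil, List.length_reverse, hsplit, List.length_append, pow_one]
      omega
  · refine .of_program_st hl hk hk (.seq p (.seq (moveAll 0 5) (moveAll 5 1))) 2 24 1 fun n => ?_
    have h1 := hloop (unary (k n)) (encodeList (l' n)) (l n) []
    rw [hlen, ← hsplit] at h1
    have h2 := reach_moveAll [encodeList (l' n), [], [], unary (k n),
      (encodeList (l n)).reverse ++ [], []] 0 5 (encodeList (l' n)) (by simp)
      (by simp) (by simp) rfl
    have h3 := reach_moveAll [[], [], [], unary (k n),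
      (encodeList (l n)).reverse ++ [], (encodeList (l' n)).reverse ++ []] 5 1
      ((encodeList (l' n)).reverse ++ []) (by simp) (by simp) (by simp) rfl
    refine ⟨_, _, (h1.seq (h2.seq h3)), by simp, ?_⟩
    · simp only [List.append_nil, List.length_reverse, hsplit, List.length_append, pow_one]
      omega

/-- A template for gates on up to three wires: `inl a` stands for the symbol `a`, and `inr v` for
the `v`-th of the wires. -/
abbrev Template : Type := List (Sym ⊕ Fin 3)

/-- The word that a template stands for. -/
def Template.expand (T : Template) (w : Fin 3 → ℕ) : List Sym :=
  T.flatMap fun tok => tok.elim (fun a => [a]) fun v => encodeNat (w v)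

/-- Push one token of a template, for the wires on the stacks `5`, `6`, `7`. -/
def emitToken : Sym ⊕ Fin 3 → Program Sym
  | .inl a => .push 4 a
  | .inr 0 => .seq (copyTo 5 4 8) (.push 4 .sep)
  | .inr 1 => .seq (copyTo 6 4 8) (.push 4 .sep)
  | .inr 2 => .seq (copyTo 7 4 8) (.push 4 .sep)

/-- Push the word that a template stands for, in reverse order. -/
def emit (T : Template) : Program Sym := T.foldr (fun tok p => .seq (emitToken tok) p) .skip

theorem reach_emit (X Y Z : List Sym) (w : Fin 3 → ℕ) (B : ℕ) (hB : ∀ v, w v ≤ B)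
    (T : Template) : ∀ acc : List Sym, Reach (emit T)
      (st [X, [], Y, Z, acc, unary (w 0), unary (w 1), unary (w 2), []])
      (T.length * (24 * B + 3) + 1)
      (st [X, [], Y, Z, (T.expand w).reverse ++ acc, unary (w 0), unary (w 1), unary (w 2), []]) := by
  induction T with
  | nil => exact fun acc => ⟨1, by simp, .skip _⟩
  | cons tok T ih =>
    intro acc
    have h1 : Reach (emitToken tok)
        (st [X, [], Y, Z, acc, unary (w 0), unary (w 1), unary (w 2), []]) (24 * B + 3)
        (st [X, [], Y, Z, (tok.elim (fun a => [a]) fun v => encodeNat (w v)).reverse ++ acc,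
          unary (w 0), unary (w 1), unary (w 2), []]) := by
      have hvar : ∀ v, (fun v => encodeNat (w v)) v = unary (w v) ++ [.sep] := fun _ => rfl
      rcases tok with a | v
      · have h := Reach.push 4 a (st [X, [], Y, Z, acc, unary (w 0), unary (w 1), unary (w 2), []])
        rw [update_st _ _ _ (by simp)] at h
        exact h.mono (by omega)
      · have h0 := hB v
        fin_cases v
        · have h := reach_copyTo [X, [], Y, Z, acc, unary (w 0), unary (w 1), unary (w 2), []] 5 4 8
            (unary (w 0)) (by simp) (by simp) (by simp) (by simp) (by simp) (by simp) rfl rfl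
          have h' := Reach.push 4 Sym.sep (st [X, [], Y, Z, (unary (w 0)).reverse ++ acc,
            unary (w 0), unary (w 1), unary (w 2), []])
          rw [update_st _ _ _ (by simp)] at h'
          rw [length_unary] at h
          refine (h.seq h').cast (by simp only [Fin.zero_eta] at h0; omega) ?_
          simp [hvar, st]
        · have h := reach_copyTo [X, [], Y, Z, acc, unary (w 0), unary (w 1), unary (w 2), []] 6 4 8
            (unary (w 1)) (by simp) (by simp) (by simp) (by simp) (by simp) (by simp) rfl rfl
          have h' := Reach.push 4 Sym.sep (st [X, [], Y, Z, (unary (w 1)).reverse ++ acc,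
            unary (w 0), unary (w 1), unary (w 2), []])
          rw [update_st _ _ _ (by simp)] at h'
          rw [length_unary] at h
          refine (h.seq h').cast (by simp only [Fin.mk_one] at h0; omega) ?_
          simp [hvar, st]
        · have h := reach_copyTo [X, [], Y, Z, acc, unary (w 0), unary (w 1), unary (w 2), []] 7 4 8
            (unary (w 2)) (by simp) (by simp) (by simp) (by simp) (by simp) (by simp) rfl rfl
          have h' := Reach.push 4 Sym.sep (st [X, [], Y, Z, (unary (w 2)).reverse ++ acc,
            unary (w 0), unary (w 1), unary (w 2), []])
          rw [update_st _ _ _ (by simp)] at h'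
          rw [length_unary] at h
          refine (h.seq h').cast (by simp only [Fin.reduceFinMk] at h0; omega) ?_
          simp [hvar, st]
    refine (h1.seq (ih _)).cast ?_ ?_
    · simp only [List.length_cons]
      linarith
    · simp [Template.expand]

/-- Empty stack `i`. -/
def clear (i : ℕ) : Program Sym := .loop i Option.isSome (.pop i)

theorem reach_clear (L : List (List Sym)) (i : ℕ) (w : List Sym) (hi : i < L.length)
    (hL : L.getD i [] = w) : Reach (clear i) (st L) (2 * w.length + 1) (st (L.set i [])) := by
  have key : ∀ (w : List Sym) (s : ℕ → List Sym), s i = w →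
      Reach (clear i) s (2 * w.length + 1) (Function.update s i []) := by
    intro w
    induction w with
    | nil =>
      intro s hs
      have h0 : Function.update s i [] = s := by
        rw [← hs, Function.update_eq_self]
      rw [h0]
      exact Reach.loopDone (by rw [hs]; rfl)
    | cons a w ih =>
      intro s hs
      refine (Reach.loopStep (by simp [hs]) (Reach.pop i s) (ih _ (by simp [hs]))).cast
        (by simp only [List.length_cons]; omega) (by simp)
  have h := key w (st L) hL
  rwa [update_st _ _ _ hi] at h

/-- Move the first wire from stack `i` to stack `j`. -/
def takeWire (i j : ℕ) : Program Sym := .seq (moveWhile (topIs .one) i j) (.pop i)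

theorem reach_takeWire (L : List (List Sym)) (i j a : ℕ) (l : List ℕ) (hi : i < L.length)
    (hj : j < L.length) (hij : i ≠ j) (hL : L.getD i [] = encodeList (a :: l))
    (hj0 : L.getD j [] = []) :
    Reach (takeWire i j) (st L) (12 * a + 2)
      (st ((L.set i (encodeList l)).set j (unary a))) := by
  have h1 := reach_moveWhile (c := topIs .one) L i j (unary a) (.sep :: encodeList l) hi hj hij
    (by rw [hL, encodeList_cons]) (topIs_one_of_mem_unary a) (by simp [topIs])
  have h2 := Reach.pop i (st ((L.set i (.sep :: encodeList l)).set j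
    ((unary a).reverse ++ L.getD j [])))
  refine (h1.seq h2).cast (by rw [length_unary]) ?_
  rw [update_st _ _ _ (by simpa using hi), hj0, reverse_unary, List.append_nil,
    List.set_comm _ _ hij.symm, List.set_set]
  congr 3
  simp [st, hi, hij.symm]

theorem length_encodeList_le (l : List ℕ) : l.length ≤ (encodeList l).length := by
  induction l with
  | nil => simp
  | cons a l ih =>
    rw [encodeList_cons]
    simp only [List.length_cons, List.length_append]
    omega

theorem le_length_encodeList {a : ℕ} {l : List ℕ} (h : a ∈ l) : a ≤ (encodeList l).length := by
  induction l with
  | nil => simp at h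
  | cons b l ih =>
    rw [encodeList_cons]
    simp only [List.length_cons, List.length_append, length_unary]
    rcases List.mem_cons.mp h with h | h
    · omega
    · have := ih h
      omega

theorem Template.length_expand_le (T : Template) (w : Fin 3 → ℕ) (B : ℕ) (hB : ∀ v, w v ≤ B) :
    (T.expand w).length ≤ T.length * (B + 1) := by
  induction T with
  | nil => simp [Template.expand]
  | cons tok T ih =>
    have h : (tok.elim (fun a => [a]) fun v => encodeNat (w v)).length ≤ B + 1 := by
      rcases tok with a | v
      · simp
      · simpa [encodeNat, length_unary] using hB v
    simp only [Template.expand, List.flatMap_cons, List.length_append, List.length_cons] at ih ⊢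
    linarith

theorem length_flatMap_expand_le (T : Template) (l : List (Fin 3 → ℕ)) (B : ℕ)
    (hB : ∀ w ∈ l, ∀ v, w v ≤ B) :
    (l.flatMap T.expand).length ≤ l.length * (T.length * (B + 1)) := by
  induction l with
  | nil => simp
  | cons w l ih =>
    have h1 := ih fun w' hw' => hB w' (by simp [hw'])
    have h2 := T.length_expand_le w B (hB w (by simp))
    simp only [List.flatMap_cons, List.length_append, List.length_cons]
    linarith

/-- Three lists of wires are turned into gates by a template. -/
theorem PolyTimeComputable.template (T : Template) {l : ℕ → List (Fin 3 → ℕ)}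
    (h0 : PolyTimeComputable fun n => encodeList ((l n).map fun w => w 0))
    (h1 : PolyTimeComputable fun n => encodeList ((l n).map fun w => w 1))
    (h2 : PolyTimeComputable fun n => encodeList ((l n).map fun w => w 2)) :
    PolyTimeComputable fun n => (l n).flatMap T.expand := by
  let body : Program Sym := .seq (takeWire 0 5) (.seq (takeWire 2 6) (.seq (takeWire 3 7)
    (.seq (emit T) (.seq (clear 5) (.seq (clear 6) (clear 7))))))
  have hloop : ∀ (B : ℕ) (l : List (Fin 3 → ℕ)), (∀ w ∈ l, ∀ v, w v ≤ B) → ∀ acc : List Sym,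
      Reach (.loop 0 Option.isSome body)
        (st [encodeList (l.map fun w => w 0), [], encodeList (l.map fun w => w 1),
          encodeList (l.map fun w => w 2), acc, [], [], [], []])
        (l.length * (T.length * (24 * B + 3) + 42 * B + 11) + 1)
        (st [[], [], [], [], (l.flatMap T.expand).reverse ++ acc, [], [], [], []]) := by
    intro B l
    induction l with
    | nil => exact fun _ acc => (Reach.loopDone rfl).mono (by simp)
    | cons w l ih =>
      intro hB acc
      have hw := hB w (by simp)
      have hw0 := hw 0
      have hw1 := hw 1
      have hw2 := hw 2
      set X := encodeList (l.map fun w => w 0) with hX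
      set Y := encodeList (l.map fun w => w 1) with hY
      set Z := encodeList (l.map fun w => w 2) with hZ
      simp only [List.map_cons]
      have e1 := reach_takeWire [encodeList (w 0 :: l.map fun w => w 0), [],
        encodeList (w 1 :: l.map fun w => w 1), encodeList (w 2 :: l.map fun w => w 2), acc,
        [], [], [], []] 0 5 (w 0) _ (by simp) (by simp) (by simp) rfl rfl
      have e2 := reach_takeWire [X, [],
        encodeList (w 1 :: l.map fun w => w 1), encodeList (w 2 :: l.map fun w => w 2), acc,
        unary (w 0), [], [], []] 2 6 (w 1) _ (by simp) (by simp) (by simp) rfl rfl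
      have e3 := reach_takeWire [X, [], Y, encodeList (w 2 :: l.map fun w => w 2), acc,
        unary (w 0), unary (w 1), [], []] 3 7 (w 2) _ (by simp) (by simp) (by simp) rfl rfl
      have e4 := reach_emit X Y Z w B hw T acc
      have e5 := reach_clear [X, [], Y, Z, (T.expand w).reverse ++ acc,
        unary (w 0), unary (w 1), unary (w 2), []] 5 (unary (w 0)) (by simp) rfl
      have e6 := reach_clear [X, [], Y, Z, (T.expand w).reverse ++ acc,
        [], unary (w 1), unary (w 2), []] 6 (unary (w 1)) (by simp) rfl
      have e7 := reach_clear [X, [], Y, Z, (T.expand w).reverse ++ acc,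
        [], [], unary (w 2), []] 7 (unary (w 2)) (by simp) rfl
      have e8 := ih (fun w' hw' => hB w' (by simp [hw'])) ((T.expand w).reverse ++ acc)
      have hne : (st [encodeList (w 0 :: l.map fun w => w 0), [],
          encodeList (w 1 :: l.map fun w => w 1), encodeList (w 2 :: l.map fun w => w 2), acc,
          [], [], [], []] 0).head?.isSome = true := by
        change (encodeList (w 0 :: l.map fun w => w 0)).head?.isSome = true
        rw [encodeList_cons]
        cases unary (w 0) <;> rfl
      refine (Reach.loopStep hne (e1.seq (e2.seq (e3.seq (e4.seq (e5.seq (e6.seq e7)))))) e8).cast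
        ?_ ?_
      · simp only [length_unary, List.length_cons]
        linarith
      · simp
  refine .of_program_st h0 h1 h2 (.seq (.loop 0 Option.isSome body) (moveAll 4 1)) 5
    (100 * (T.length + 1)) 2 fun n => ?_
  -- all wire numbers, and the number of wires, are bounded by the lengths of the words
  set B := (encodeList ((l n).map fun w => w 0)).length +
    (encodeList ((l n).map fun w => w 1)).length + (encodeList ((l n).map fun w => w 2)).length
    with hBdef
  have hB : ∀ w ∈ l n, ∀ v, w v ≤ B := by
    intro w hw v
    have g0 := le_length_encodeList (List.mem_map_of_mem (f := fun w : Fin 3 → ℕ => w 0) hw)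
    have g1 := le_length_encodeList (List.mem_map_of_mem (f := fun w : Fin 3 → ℕ => w 1) hw)
    have g2 := le_length_encodeList (List.mem_map_of_mem (f := fun w : Fin 3 → ℕ => w 2) hw)
    fin_cases v <;> simp only [Fin.zero_eta, Fin.mk_one, Fin.reduceFinMk] <;> omega
  have hlen : (l n).length ≤ B := by
    have := length_encodeList_le ((l n).map fun w => w 0)
    rw [List.length_map] at this
    omega
  have e1 := hloop B (l n) hB []
  have e2 := reach_moveAll [[], [], [], [], ((l n).flatMap T.expand).reverse ++ [], [], [], [], []]
    4 1 (((l n).flatMap T.expand).reverse ++ []) (by simp) (by simp) (by simp) rfl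
  refine ⟨_, _, e1.seq e2, by simp, ?_⟩
  have h3 := length_flatMap_expand_le T (l n) B hB
  simp only [List.append_nil, List.length_reverse]
  have h4 : (l n).length * (T.length * (B + 1)) ≤ B * (T.length * (B + 1)) :=
    Nat.mul_le_mul_right _ hlen
  have h5 : (l n).length * (T.length * (24 * B + 3) + 42 * B + 11) ≤
      B * (T.length * (24 * B + 3) + 42 * B + 11) := Nat.mul_le_mul_right _ hlen
  have h6 : B * (T.length * (24 * B + 3) + 42 * B + 11) + 12 * (B * (T.length * (B + 1))) + 2 ≤
      100 * (T.length + 1) * (B + 1) ^ 2 := by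
    nlinarith [Nat.zero_le (T.length * B), Nat.zero_le (T.length * (B * B)), Nat.zero_le B]
  linarith

/-! ### Operators on some of the wires -/

section Wires
set_option linter.unusedSectionVars false

variable {A B C W : Type} [Fintype A] [Fintype B] [Fintype C] [Fintype W]
  [DecidableEq A] [DecidableEq B] [DecidableEq C] [DecidableEq W]

open Classical in
/-- The operator `M` on the wires `f`, tensored with the identity on the others. -/
def onWires (f : A ↪ W) (M : Op (A → Fin 2)) : Op (W → Fin 2) :=
  Matrix.of fun x y =>
    if ∀ j ∉ Set.range f, x j = y j then M (fun i => x (f i)) (fun i => y (f i)) else 0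

open Classical in
/-- The isometry that places its input on the wires `f` and `|0⟩` on all others. -/
def prepWires (f : A ↪ W) : Matrix (W → Fin 2) (A → Fin 2) ℂ :=
  Matrix.of fun z x => if (∀ i, z (f i) = x i) ∧ ∀ j ∉ Set.range f, z j = 0 then 1 else 0

open Classical in
/-- Partial trace over all wires outside `f`. -/
def traceWires (f : A ↪ W) (Y : Op (W → Fin 2)) : Op (A → Fin 2) :=
  Matrix.of fun x y => ∑ z, ∑ w,
    if (∀ i, z (f i) = x i) ∧ (∀ i, w (f i) = y i) ∧ ∀ j ∉ Set.range f, z j = w j then Y z w else 0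

theorem extend_of_notMem (f : A ↪ W) (u : A → Fin 2) (z : W → Fin 2) {j : W}
    (hj : j ∉ Set.range f) : Function.extend f u z j = z j :=
  Function.extend_apply' _ _ _ fun ⟨a, ha⟩ => hj ⟨a, ha⟩

theorem extend_wire (f : A ↪ W) (u : A → Fin 2) (z : W → Fin 2) (i : A) :
    Function.extend f u z (f i) = u i := f.injective.extend_apply _ _ _

theorem eq_extend_iff (f : A ↪ W) (u : A → Fin 2) (z w : W → Fin 2) :
    w = Function.extend f u z ↔ (∀ i, w (f i) = u i) ∧ ∀ j ∉ Set.range f, w j = z j := by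
  constructor
  · rintro rfl
    exact ⟨extend_wire f u z, fun j hj => extend_of_notMem f u z hj⟩
  · rintro ⟨h1, h2⟩
    funext j
    by_cases hj : j ∈ Set.range f
    · obtain ⟨i, rfl⟩ := hj
      rw [h1, extend_wire]
    · rw [h2 j hj, extend_of_notMem f u z hj]

theorem onWires_mul_apply {T : Type*} (f : A ↪ W) (M : Op (A → Fin 2))
    (Y : Matrix (W → Fin 2) T ℂ) (z : W → Fin 2) (t : T) :
    (onWires f M * Y) z t = ∑ u, M (fun i => z (f i)) u * Y (Function.extend f u z) t := by
  rw [Matrix.mul_apply]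
  symm
  refine Fintype.sum_of_injective (fun u => Function.extend f u z) ?_ _ _ ?_ ?_
  · intro u v h
    funext i
    have := congrFun h (f i)
    simpa only [extend_wire] using this
  · intro w hw
    rw [onWires, Matrix.of_apply, if_neg, zero_mul]
    intro h
    exact hw ⟨fun i => w (f i), ((eq_extend_iff f _ z w).mpr
      ⟨fun _ => rfl, fun j hj => (h j hj).symm⟩).symm⟩
  · intro u
    rw [onWires, Matrix.of_apply, if_pos fun j hj => (extend_of_notMem f u z hj).symm]
    simp only [extend_wire]

theorem onWires_mul (f : A ↪ W) (M N : Op (A → Fin 2)) :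
    onWires f (M * N) = onWires f M * onWires f N := by
  ext z w
  rw [onWires_mul_apply]
  by_cases h : ∀ j ∉ Set.range f, z j = w j
  · rw [onWires, Matrix.of_apply, if_pos h, Matrix.mul_apply]
    refine Finset.sum_congr rfl fun u _ => ?_
    rw [onWires, Matrix.of_apply, if_pos fun j hj => by rw [extend_of_notMem f u z hj, h j hj]]
    simp only [extend_wire]
  · rw [onWires, Matrix.of_apply, if_neg h]
    refine (Finset.sum_eq_zero fun u _ => ?_).symm
    rw [onWires, Matrix.of_apply, if_neg, mul_zero]
    intro h'
    exact h fun j hj => by rw [← h' j hj, extend_of_notMem f u z hj]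

theorem onWires_one (f : A ↪ W) : onWires f 1 = 1 := by
  ext z w
  by_cases h : ∀ j ∉ Set.range f, z j = w j
  · rw [onWires, Matrix.of_apply, if_pos h, Matrix.one_apply, Matrix.one_apply]
    refine if_congr ⟨fun h' => ?_, fun h' => by rw [h']⟩ rfl rfl
    funext j
    by_cases hj : j ∈ Set.range f
    · obtain ⟨i, rfl⟩ := hj
      exact congrFun h' i
    · exact h j hj
  · rw [onWires, Matrix.of_apply, if_neg h, Matrix.one_apply_ne]
    rintro rfl
    exact h fun _ _ => rfl

theorem onWires_conjTranspose (f : A ↪ W) (M : Op (A → Fin 2)) :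
    (onWires f M)ᴴ = onWires f Mᴴ := by
  ext z w
  simp only [Matrix.conjTranspose_apply, onWires, Matrix.of_apply, apply_ite star, star_zero]
  exact if_congr ⟨fun h j hj => (h j hj).symm, fun h j hj => (h j hj).symm⟩ rfl rfl

theorem onWires_onWires (f : A ↪ B) (g : B ↪ W) (M : Op (A → Fin 2)) :
    onWires g (onWires f M) = onWires (f.trans g) M := by
  ext z w
  simp only [onWires, Matrix.of_apply, Function.Embedding.trans_apply]
  rw [← ite_and]
  refine if_congr ⟨fun h j hj => ?_, fun h => ⟨fun j hj => ?_, fun i hi => ?_⟩⟩ rfl rfl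
  · by_cases hg : j ∈ Set.range g
    · obtain ⟨i, rfl⟩ := hg
      exact h.2 i fun ⟨a, ha⟩ => hj ⟨a, by simp [ha]⟩
    · exact h.1 j hg
  · exact h j fun ⟨a, ha⟩ => hj ⟨f a, ha⟩
  · refine h (g i) fun ⟨a, ha⟩ => hi ⟨a, g.injective ha⟩

theorem prepWires_apply (f : A ↪ W) (z : W → Fin 2) (x : A → Fin 2) :
    prepWires f z x = if z = Function.extend f x 0 then 1 else 0 := by
  rw [prepWires, Matrix.of_apply]
  exact if_congr (eq_extend_iff f x 0 z).symm rfl rfl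

theorem mul_prepWires_apply {T : Type*} (f : A ↪ W) (Y : Matrix T (W → Fin 2) ℂ) (t : T)
    (x : A → Fin 2) : (Y * prepWires f) t x = Y t (Function.extend f x 0) := by
  simp [Matrix.mul_apply, prepWires_apply]

theorem prepWires_mul_apply {T : Type*} (f : A ↪ W) (Y : Matrix (A → Fin 2) T ℂ) (z : W → Fin 2)
    (t : T) : (prepWires f * Y) z t =
      if ∀ j ∉ Set.range f, z j = 0 then Y (fun i => z (f i)) t else 0 := by
  rw [Matrix.mul_apply]
  split_ifs with h
  · rw [Finset.sum_eq_single fun i => z (f i)]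
    · rw [prepWires, Matrix.of_apply, if_pos ⟨fun _ => rfl, h⟩, one_mul]
    · intro x _ hx
      rw [prepWires, Matrix.of_apply, if_neg fun h' => hx (funext fun i => (h'.1 i).symm),
        zero_mul]
    · simp
  · refine Finset.sum_eq_zero fun x _ => ?_
    rw [prepWires, Matrix.of_apply, if_neg fun h' => h h'.2, zero_mul]

theorem mul_prepWires_conjTranspose_apply {T : Type*} (f : A ↪ W) (Y : Matrix T (A → Fin 2) ℂ)
    (t : T) (z : W → Fin 2) : (Y * (prepWires f)ᴴ) t z =
      if ∀ j ∉ Set.range f, z j = 0 then Y t (fun i => z (f i)) else 0 := by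
  have h := congrArg star (prepWires_mul_apply f Yᴴ z t)
  rw [← Matrix.conjTranspose_apply, Matrix.conjTranspose_mul,
    Matrix.conjTranspose_conjTranspose] at h
  rw [h]
  split_ifs <;> simp

theorem prepWires_trans (f : A ↪ B) (g : B ↪ W) :
    prepWires (f.trans g) = prepWires g * prepWires f := by
  ext z x
  rw [mul_prepWires_apply, prepWires_apply, prepWires_apply]
  refine if_congr (Eq.congr_right ?_) rfl rfl
  symm
  rw [eq_extend_iff]
  refine ⟨fun i => ?_, fun j hj => ?_⟩
  · rw [Function.Embedding.trans_apply, extend_wire, extend_wire]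
  · by_cases hg : j ∈ Set.range g
    · obtain ⟨i, rfl⟩ := hg
      rw [extend_wire, extend_of_notMem]
      · rfl
      · exact fun ⟨a, ha⟩ => hj ⟨a, by simp [ha]⟩
    · rw [extend_of_notMem _ _ _ hg]

theorem onWires_mul_prepWires (g : B ↪ W) (M : Op (B → Fin 2)) :
    onWires g M * prepWires g = prepWires g * M := by
  ext z x
  rw [mul_prepWires_apply, prepWires_mul_apply, onWires, Matrix.of_apply]
  refine ite_congr (propext (forall₂_congr fun j hj => ?_)) (fun _ => ?_) fun _ => rfl
  · rw [extend_of_notMem _ _ _ hj]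
    rfl
  · simp only [extend_wire]

theorem onWires_trans_mul_prepWires (f : A ↪ B) (g : B ↪ W) (M : Op (A → Fin 2)) :
    onWires (f.trans g) M * prepWires g = prepWires g * onWires f M := by
  rw [← onWires_onWires, onWires_mul_prepWires]

theorem traceWires_apply (f : A ↪ W) (Y : Op (W → Fin 2)) (x y : A → Fin 2) :
    traceWires f Y x y = ∑ w, if (∀ i, w (f i) = y i) then Y (Function.extend f x w) w else 0 := by
  classical
  rw [traceWires, Matrix.of_apply, Finset.sum_comm]
  refine Finset.sum_congr rfl fun w _ => ?_
  rw [Finset.sum_eq_single (Function.extend f x w)]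
  · refine if_congr ⟨fun h => h.2.1, fun h => ⟨extend_wire f x w, h, fun j hj =>
      extend_of_notMem f x w hj⟩⟩ rfl rfl
  · intro z _ hz
    exact if_neg fun h => hz ((eq_extend_iff f x w z).mpr ⟨h.1, h.2.2⟩)
  · simp

theorem traceWires_conjTranspose (f : A ↪ W) (Y : Op (W → Fin 2)) :
    (traceWires f Y)ᴴ = traceWires f Yᴴ := by
  ext x y
  simp only [Matrix.conjTranspose_apply, traceWires, Matrix.of_apply, star_sum, apply_ite star,
    star_zero]
  rw [Finset.sum_comm]
  refine Finset.sum_congr rfl fun w _ => Finset.sum_congr rfl fun z _ => if_congr ?_ rfl rfl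
  exact ⟨fun h => ⟨h.2.1, h.1, fun j hj => (h.2.2 j hj).symm⟩,
    fun h => ⟨h.2.1, h.1, fun j hj => (h.2.2 j hj).symm⟩⟩

theorem traceWires_onWires_mul (f : A ↪ W) (M : Op (A → Fin 2)) (Y : Op (W → Fin 2)) :
    traceWires f (onWires f M * Y) = M * traceWires f Y := by
  ext x y
  simp only [traceWires_apply, Matrix.mul_apply (M := M), onWires_mul_apply, extend_wire,
    Finset.mul_sum, mul_ite, mul_zero]
  rw [Finset.sum_comm]
  refine Finset.sum_congr rfl fun w _ => ?_
  split_ifs with h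
  · refine Finset.sum_congr rfl fun u _ => ?_
    congr 2
    rw [eq_extend_iff]
    refine ⟨fun i => extend_wire f u _ i, fun j hj => ?_⟩
    rw [extend_of_notMem _ _ _ hj, extend_of_notMem _ _ _ hj]
  · rw [Finset.sum_const_zero]

/-- Operations on the wires that are kept can be done after the others are traced out. -/
theorem traceWires_conj (f : A ↪ W) (M : Op (A → Fin 2)) (Y : Op (W → Fin 2)) :
    traceWires f (onWires f M * Y * (onWires f M)ᴴ) = M * traceWires f Y * Mᴴ := by
  rw [Matrix.mul_assoc, traceWires_onWires_mul, Matrix.mul_assoc]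
  congr 1
  have h := congrArg Matrix.conjTranspose (traceWires_onWires_mul f M Yᴴ)
  rw [traceWires_conjTranspose, Matrix.conjTranspose_mul, Matrix.conjTranspose_mul,
    Matrix.conjTranspose_conjTranspose, traceWires_conjTranspose,
    Matrix.conjTranspose_conjTranspose] at h
  exact h

theorem traceWires_trans (f : A ↪ B) (g : B ↪ W) (Y : Op (W → Fin 2)) :
    traceWires (f.trans g) Y = traceWires f (traceWires g Y) := by
  ext x y
  simp only [traceWires_apply]
  have h1 : ∀ v : B → Fin 2, (if ∀ i, v (f i) = y i then ∑ w, if ∀ i, w (g i) = v i then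
        Y (Function.extend g (Function.extend f x v) w) w else 0 else 0) =
      ∑ w : W → Fin 2, if v = fun i => w (g i) then if ∀ i, w (g (f i)) = y i then
        Y (Function.extend (f.trans g) x w) w else 0 else 0 := by
    intro v
    rw [show ∀ (p : Prop) [Decidable p] (F : (W → Fin 2) → ℂ), (if p then ∑ w, F w else 0) =
        ∑ w, if p then F w else 0 from fun p _ F => by split_ifs <;> simp]
    refine Finset.sum_congr rfl fun w _ => ?_
    by_cases hv : v = fun i => w (g i)
    · subst hv
      have h2 : Function.extend g (Function.extend f x fun i => w (g i)) w =
          Function.extend (f.trans g) x w := by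
        rw [eq_extend_iff]
        refine ⟨fun i => ?_, fun j hj => ?_⟩
        · rw [Function.Embedding.trans_apply, extend_wire, extend_wire]
        · by_cases hg : j ∈ Set.range g
          · obtain ⟨i, rfl⟩ := hg
            rw [extend_wire, extend_of_notMem]
            exact fun ⟨a, ha⟩ => hj ⟨a, by simp [ha]⟩
          · rw [extend_of_notMem _ _ _ hg]
      simp [h2]
    · rw [if_neg hv]
      split_ifs with h2 h3
      · exact absurd (funext fun i => (h3 i).symm) hv
      · rfl
      · rfl
  simp only [h1]
  rw [Finset.sum_comm]
  simp

/-- Fresh wires that are discarded at once have no effect. -/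
theorem traceWires_prepWires (g : B ↪ W) (Y : Op (B → Fin 2)) :
    traceWires g (prepWires g * Y * (prepWires g)ᴴ) = Y := by
  ext x y
  have h : ∀ z w, (prepWires g * Y * (prepWires g)ᴴ) z w =
      if ∀ j ∉ Set.range g, z j = 0 then
        (if ∀ j ∉ Set.range g, w j = 0 then Y (fun i => z (g i)) (fun i => w (g i)) else 0) else 0 := by
    intro z w
    rw [Matrix.mul_assoc, prepWires_mul_apply]
    congr 1
    exact mul_prepWires_conjTranspose_apply g Y _ w
  rw [traceWires_apply, Finset.sum_eq_single (Function.extend g y 0)]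
  · rw [if_pos fun i => extend_wire _ _ _ i, h, if_pos, if_pos]
    · simp only [extend_wire]
    · intro j hj; rw [extend_of_notMem _ _ _ hj]; rfl
    · intro j hj; rw [extend_of_notMem _ _ _ hj, extend_of_notMem _ _ _ hj]; rfl
  · intro w _ hw
    split_ifs with hwy
    · rw [h]
      split_ifs with h1 h2
      · exact absurd ((eq_extend_iff g y 0 w).mpr ⟨hwy, h2⟩) hw
      · rfl
      · rfl
    · rfl
  · simp

/-! ### Two groups of wires -/

/-- `inl ↦ f`, and the wires of `B` are kept. -/
def keepRight (B : Type) (f : A ↪ W) : A ⊕ B ↪ W ⊕ B := f.sumMap (Function.Embedding.refl B)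

/-- `inr ↦ f`, and the wires of `B` are kept. -/
def keepLeft (B : Type) (f : A ↪ W) : B ⊕ A ↪ B ⊕ W := (Function.Embedding.refl B).sumMap f

open Classical in
/-- `K ⊗ Id`, where the identity is on the wires `B`. -/
def padRight (B : Type) (K : Matrix (W → Fin 2) (A → Fin 2) ℂ) :
    Matrix (W ⊕ B → Fin 2) (A ⊕ B → Fin 2) ℂ :=
  Matrix.of fun z x => if ∀ b, z (.inr b) = x (.inr b) then
    K (fun i => z (.inl i)) (fun i => x (.inl i)) else 0

/-- The block of an operator with fixed labels on the wires `B`. -/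
def slice (X : Op (A ⊕ B → Fin 2)) (b b' : B → Fin 2) : Op (A → Fin 2) :=
  Matrix.of fun a a' => X (Sum.elim a b) (Sum.elim a' b')

/-- `Φ ⊗ Id`, for maps between qubit registers. -/
def onLeftWires (B : Type) (Φ : Op (A → Fin 2) → Op (C → Fin 2)) (X : Op (A ⊕ B → Fin 2)) :
    Op (C ⊕ B → Fin 2) :=
  Matrix.of fun u v => Φ (slice X (fun b => u (.inr b)) fun b => v (.inr b))
    (fun c => u (.inl c)) fun c => v (.inl c)

theorem padRight_of_eq (K : Matrix (W → Fin 2) (A → Fin 2) ℂ) {z : W ⊕ B → Fin 2}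
    {x : A ⊕ B → Fin 2} (h : ∀ b, z (.inr b) = x (.inr b)) :
    padRight B K z x = K (fun i => z (.inl i)) fun i => x (.inl i) := if_pos h

theorem padRight_of_ne (K : Matrix (W → Fin 2) (A → Fin 2) ℂ) {z : W ⊕ B → Fin 2}
    {x : A ⊕ B → Fin 2} (h : ¬∀ b, z (.inr b) = x (.inr b)) : padRight B K z x = 0 := if_neg h

theorem padRight_mul_apply {T : Type*} (K : Matrix (W → Fin 2) (A → Fin 2) ℂ)
    (Y : Matrix (A ⊕ B → Fin 2) T ℂ) (z : W ⊕ B → Fin 2) (t : T) :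
    (padRight B K * Y) z t =
      ∑ u, K (fun i => z (.inl i)) u * Y (Sum.elim u fun b => z (.inr b)) t := by
  rw [Matrix.mul_apply]
  symm
  refine Fintype.sum_of_injective (fun u => Sum.elim u fun b => z (.inr b)) ?_ _ _ ?_ ?_
  · intro u v h
    exact funext fun i => congrFun h (.inl i)
  · intro w hw
    rw [padRight, Matrix.of_apply, if_neg, zero_mul]
    intro h
    refine hw ⟨fun i => w (.inl i), funext fun j => ?_⟩
    rcases j with i | b
    · rfl
    · exact h b
  · intro u
    rw [padRight, Matrix.of_apply, if_pos fun b => by rfl]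
    rfl

theorem padRight_mul (K : Matrix (W → Fin 2) (A → Fin 2) ℂ) (L : Matrix (A → Fin 2) (C → Fin 2) ℂ) :
    padRight B (K * L) = padRight B K * padRight B L := by
  ext z x
  rw [padRight_mul_apply]
  by_cases h : ∀ b, z (.inr b) = x (.inr b)
  · rw [padRight_of_eq _ h, Matrix.mul_apply]
    exact Finset.sum_congr rfl fun u _ => by rw [padRight_of_eq _ (by exact h)]; rfl
  · rw [padRight_of_ne _ h]
    exact (Finset.sum_eq_zero fun u _ => by rw [padRight_of_ne _ (by exact h), mul_zero]).symm

theorem padRight_conj_apply (K : Matrix (W → Fin 2) (A → Fin 2) ℂ) (X : Op (A ⊕ B → Fin 2))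
    (z w : W ⊕ B → Fin 2) : (padRight B K * X * (padRight B K)ᴴ) z w =
      (K * slice X (fun b => z (.inr b)) (fun b => w (.inr b)) * Kᴴ)
        (fun i => z (.inl i)) (fun i => w (.inl i)) := by
  rw [Matrix.mul_assoc, padRight_mul_apply, Matrix.mul_assoc, Matrix.mul_apply]
  refine Finset.sum_congr rfl fun u _ => ?_
  congr 1
  have h := congrArg star (padRight_mul_apply K Xᴴ w (Sum.elim u fun b => z (.inr b)))
  rw [← Matrix.conjTranspose_apply, Matrix.conjTranspose_mul,
    Matrix.conjTranspose_conjTranspose] at h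
  rw [h, star_sum, Matrix.mul_apply]
  refine Finset.sum_congr rfl fun v _ => ?_
  simp [slice, mul_comm]

theorem padRight_prepWires (f : A ↪ W) : padRight B (prepWires f) = prepWires (keepRight B f) := by
  ext z x
  have key : ((∀ i, z (keepRight B f i) = x i) ∧ ∀ j ∉ Set.range (keepRight B f), z j = 0) ↔
      (∀ b, z (.inr b) = x (.inr b)) ∧
        (∀ i, z (.inl (f i)) = x (.inl i)) ∧ ∀ j ∉ Set.range f, z (.inl j) = 0 := by
    constructor
    · refine fun h => ⟨fun b => h.1 (.inr b), fun i => h.1 (.inl i), fun j hj => h.2 (.inl j) ?_⟩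
      rintro ⟨a | b, ha⟩
      · exact hj ⟨a, Sum.inl_injective ha⟩
      · simp [keepRight] at ha
    · refine fun h => ⟨fun j => ?_, fun j hj => ?_⟩
      · rcases j with i | b
        · exact h.2.1 i
        · exact h.1 b
      · rcases j with i | b
        · exact h.2.2 i fun ⟨a, ha⟩ => hj ⟨.inl a, by simp [keepRight, ha]⟩
        · exact absurd ⟨.inr b, rfl⟩ hj
  by_cases h1 : ∀ b, z (.inr b) = x (.inr b)
  · rw [padRight_of_eq _ h1]
    exact if_congr (by rw [key, and_iff_right h1]) rfl rfl
  · rw [padRight_of_ne _ h1]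
    exact (if_neg fun h => h1 (key.mp h).1).symm

theorem padRight_eq_onWires (M : Op (W → Fin 2)) :
    padRight B M = onWires (Function.Embedding.inl : W ↪ W ⊕ B) M := by
  ext z x
  rw [onWires, Matrix.of_apply]
  by_cases h : ∀ b, z (.inr b) = x (.inr b)
  · rw [padRight_of_eq _ h, if_pos]
    · rfl
    · rintro (i | b) hj
      · simp at hj
      · exact h b
  · rw [padRight_of_ne _ h, if_neg fun h' => h fun b => h' _ (by simp)]

theorem traceWires_keepRight (f : A ↪ W) (Y : Op (W ⊕ B → Fin 2)) :
    traceWires (keepRight B f) Y = onLeftWires B (traceWires f) Y := by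
  ext x y
  rw [onLeftWires, Matrix.of_apply, traceWires_apply, traceWires_apply]
  symm
  refine Fintype.sum_of_injective (fun u => Sum.elim u fun b => y (.inr b)) ?_ _ _ ?_ ?_
  · intro u v h
    exact funext fun i => congrFun h (.inl i)
  · intro w hw
    rw [if_neg]
    intro h
    refine hw ⟨fun i => w (.inl i), funext fun j => ?_⟩
    rcases j with i | b
    · rfl
    · exact (h (.inr b)).symm
  · intro u
    have h : (∀ i, u (f i) = y (.inl i)) ↔
        ∀ i, Sum.elim u (fun b => y (.inr b)) (keepRight B f i) = y i := by
      constructor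
      · rintro h (i | b)
        · exact h i
        · rfl
      · exact fun h i => h (.inl i)
    refine if_congr h ?_ rfl
    rw [slice, Matrix.of_apply]
    congr 1
    rw [eq_extend_iff]
    refine ⟨fun j => ?_, fun j hj => ?_⟩
    · rcases j with i | b
      · exact extend_wire f (fun c => x (.inl c)) u i
      · rfl
    · rcases j with i | b
      · exact extend_of_notMem f (fun c => x (.inl c)) u (j := i) fun ⟨a, ha⟩ =>
          hj ⟨.inl a, by simp [keepRight, ha]⟩
      · exact absurd ⟨.inr b, rfl⟩ hj

/-- A circuit that runs next to the wires `B` performs its map on its own wires. -/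
theorem traceWires_subcircuit (ι : A ↪ W) (o : C ↪ W) (V : Op (W → Fin 2))
    (X : Op (A ⊕ B → Fin 2)) :
    traceWires (keepRight B o) (onWires .inl V *
        (prepWires (keepRight B ι) * X * (prepWires (keepRight B ι))ᴴ) * (onWires .inl V)ᴴ) =
      onLeftWires B (fun Y => traceWires o (V * (prepWires ι * Y * (prepWires ι)ᴴ) * Vᴴ)) X := by
  rw [traceWires_keepRight, ← padRight_prepWires, ← padRight_eq_onWires]
  have h : padRight B V * (padRight B (prepWires ι) * X * (padRight B (prepWires ι))ᴴ) *
      (padRight B V)ᴴ = padRight B (V * prepWires ι) * X * (padRight B (V * prepWires ι))ᴴ := by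
    simp only [padRight_mul, Matrix.conjTranspose_mul, Matrix.mul_assoc]
  rw [h]
  ext u v
  simp only [onLeftWires, Matrix.of_apply]
  congr 1
  ext a a'
  rw [slice, Matrix.of_apply, padRight_conj_apply]
  simp only [Matrix.conjTranspose_mul, Matrix.mul_assoc]
  rfl

theorem onLeftWires_conj (K : Matrix (C → Fin 2) (A → Fin 2) ℂ) (X : Op (A ⊕ B → Fin 2)) :
    onLeftWires B (fun Y => K * Y * Kᴴ) X = padRight B K * X * (padRight B K)ᴴ := by
  ext u v
  rw [padRight_conj_apply]
  rfl

/-- `Ω ⊗ Z`, for qubit registers. -/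
def attach (Ω : Op (A → Fin 2)) (Z : Op (B → Fin 2)) : Op (A ⊕ B → Fin 2) :=
  Matrix.of fun u v => Ω (fun a => u (.inl a)) (fun a => v (.inl a)) *
    Z (fun b => u (.inr b)) fun b => v (.inr b)

/-- A circuit without input that runs next to the wires `B` prepares its state. -/
theorem onLeftWires_prepare (Ω : Op (C → Fin 2)) (Z : Op (B → Fin 2)) :
    onLeftWires B (fun Y : Op (Fin 0 → Fin 2) => Y.trace • Ω)
      (prepWires (Function.Embedding.inr : B ↪ Fin 0 ⊕ B) * Z *
        (prepWires (Function.Embedding.inr : B ↪ Fin 0 ⊕ B))ᴴ) = attach Ω Z := by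
  have hr : ∀ j : Fin 0 ⊕ B, j ∈ Set.range (Function.Embedding.inr : B ↪ Fin 0 ⊕ B) := by
    rintro (i | b)
    · exact i.elim0
    · exact ⟨b, rfl⟩
  have h (u v : Fin 0 ⊕ B → Fin 2) : (prepWires (Function.Embedding.inr : B ↪ Fin 0 ⊕ B) * Z *
      (prepWires (Function.Embedding.inr : B ↪ Fin 0 ⊕ B))ᴴ) u v =
        Z (fun b => u (.inr b)) fun b => v (.inr b) := by
    rw [Matrix.mul_assoc, prepWires_mul_apply, if_pos fun j hj => absurd (hr j) hj]
    refine (mul_prepWires_conjTranspose_apply _ Z _ v).trans ?_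
    rw [if_pos fun j hj => absurd (hr j) hj]
    rfl
  ext u v
  simp [onLeftWires, attach, slice, Matrix.trace, h, mul_comm]

theorem attach_apply (Ω : Op (A → Fin 2)) (Z : Op (B → Fin 2)) (u v : A ⊕ B → Fin 2) :
    attach Ω Z u v = Ω (fun a => u (.inl a)) (fun a => v (.inl a)) *
      Z (fun b => u (.inr b)) fun b => v (.inr b) := rfl

/-- A partial trace of a tensor product that concerns only the second factor. -/
theorem traceWires_attach (Ω : Op (C → Fin 2)) (g : A ↪ B) (Z : Op (B → Fin 2)) :
    traceWires (keepLeft C g) (attach Ω Z) = attach Ω (traceWires g Z) := by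
  ext x y
  rw [attach_apply, traceWires_apply, traceWires_apply, Finset.mul_sum]
  symm
  refine Fintype.sum_of_injective (fun u => Sum.elim (fun c => y (.inl c)) u) ?_ _ _ ?_ ?_
  · intro u v h
    exact funext fun i => congrFun h (.inr i)
  · intro w hw
    rw [if_neg]
    intro h
    refine hw ⟨fun i => w (.inr i), funext fun j => ?_⟩
    rcases j with i | b
    · exact (h (.inl i)).symm
    · rfl
  · intro u
    have h : (∀ i, u (g i) = y (.inr i)) ↔
        ∀ i, Sum.elim (fun c => y (.inl c)) u (keepLeft C g i) = y i := by
      constructor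
      · rintro h (i | b)
        · rfl
        · exact h b
      · exact fun h i => h (.inr i)
    rw [mul_ite, mul_zero]
    refine if_congr h ?_ rfl
    have h3 : Function.extend (keepLeft C g) x (Sum.elim (fun c => y (.inl c)) u) =
        Sum.elim (fun c => x (.inl c)) (Function.extend g (fun i => x (.inr i)) u) := by
      symm
      rw [eq_extend_iff]
      refine ⟨fun j => ?_, fun j hj => ?_⟩
      · rcases j with i | b
        · rfl
        · exact extend_wire g (fun c => x (.inr c)) u b
      · rcases j with i | b
        · exact absurd ⟨.inl i, rfl⟩ hj
        · exact extend_of_notMem g (fun c => x (.inr c)) u (j := b) fun ⟨a, ha⟩ =>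
            hj ⟨.inr a, by simp [keepLeft, ha]⟩
    rw [h3]
    rfl

end Wires

/-! ### Gates on labelled wires -/

/-- A gate applied to distinct wires, where the wires carry labels in an arbitrary type. -/
structure WGate (W : Type) where
  kind : GateKind
  wires : Fin kind.arity ↪ W

section Gates
set_option linter.unusedSectionVars false

variable {A W : Type} [Fintype A] [Fintype W] [DecidableEq A] [DecidableEq W]

/-- The operator that a gate performs on all wires. -/
def WGate.matrix (g : WGate W) : Op (W → Fin 2) := onWires g.wires g.kind.matrix

/-- The same gate on renamed wires. -/
def WGate.map (f : A ↪ W) (g : WGate A) : WGate W := ⟨g.kind, g.wires.trans f⟩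

theorem WGate.matrix_map (f : A ↪ W) (g : WGate A) : (g.map f).matrix = onWires f g.matrix :=
  (onWires_onWires g.wires f g.kind.matrix).symm

/-- The product of a list of gates, the first gate rightmost. -/
def gatesMatrix (l : List (WGate W)) : Op (W → Fin 2) := l.foldl (fun V g => g.matrix * V) 1

theorem foldl_gates (l : List (WGate W)) (V : Op (W → Fin 2)) :
    l.foldl (fun V g => g.matrix * V) V = gatesMatrix l * V := by
  induction l generalizing V with
  | nil => simp [gatesMatrix]
  | cons g l ih => rw [gatesMatrix, List.foldl_cons, List.foldl_cons, ih, ih, Matrix.mul_one,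
      Matrix.mul_assoc]

@[simp] theorem gatesMatrix_nil : gatesMatrix ([] : List (WGate W)) = 1 := rfl

theorem gatesMatrix_append (l l' : List (WGate W)) :
    gatesMatrix (l ++ l') = gatesMatrix l' * gatesMatrix l := by
  rw [gatesMatrix, List.foldl_append, foldl_gates]
  rfl

theorem gatesMatrix_cons (g : WGate W) (l : List (WGate W)) :
    gatesMatrix (g :: l) = gatesMatrix l * g.matrix := by
  rw [gatesMatrix, List.foldl_cons, foldl_gates, Matrix.mul_one]

theorem gatesMatrix_singleton (g : WGate W) : gatesMatrix [g] = g.matrix := by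
  rw [gatesMatrix_cons, gatesMatrix_nil, Matrix.one_mul]

theorem gatesMatrix_map (f : A ↪ W) (l : List (WGate A)) :
    gatesMatrix (l.map (WGate.map f)) = onWires f (gatesMatrix l) := by
  induction l with
  | nil => simp [onWires_one]
  | cons g l ih => rw [List.map_cons, gatesMatrix_cons, gatesMatrix_cons, ih, onWires_mul,
      WGate.matrix_map]

theorem gatesMatrix_isometry {l : List (WGate W)} (h : ∀ g ∈ l, g.matrixᴴ * g.matrix = 1) :
    (gatesMatrix l)ᴴ * gatesMatrix l = 1 := by
  induction l with
  | nil => simp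
  | cons g l ih =>
    rw [gatesMatrix_cons, Matrix.conjTranspose_mul, Matrix.mul_assoc,
      ← Matrix.mul_assoc _ (gatesMatrix l), ih fun g' hg' => h g' (List.mem_cons_of_mem g hg'),
      Matrix.one_mul, h g List.mem_cons_self]

/-- The adjoint of a circuit of self-adjoint gates runs them backwards. -/
theorem gatesMatrix_conjTranspose {l : List (WGate W)} (h : ∀ g ∈ l, g.matrixᴴ = g.matrix) :
    (gatesMatrix l)ᴴ = gatesMatrix l.reverse := by
  induction l with
  | nil => simp
  | cons g l ih =>
    rw [gatesMatrix_cons, Matrix.conjTranspose_mul, List.reverse_cons, gatesMatrix_append,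
      ih fun g' hg' => h g' (List.mem_cons_of_mem g hg'), h g List.mem_cons_self,
      gatesMatrix_singleton]

/-! ### Circuits on labelled wires -/

/-- A gate on numbered wires, as one on wires labelled by their numbers. -/
def Gate.toWGate {N : ℕ} (g : Gate N) : WGate (Fin N) := ⟨g.kind, g.wires⟩

/-- A gate on labelled wires, where `e` numbers the wires. -/
def WGate.toGate {N : ℕ} (e : W ≃ Fin N) (g : WGate W) : Gate N :=
  ⟨g.kind, g.wires.trans e.toEmbedding⟩

/-- The two sides may use different decision procedures. -/
theorem ite_congr_decidable {α : Type*} {p q : Prop} {hp : Decidable p} {hq : Decidable q} {x y : α}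
    (h : p ↔ q) : (if p then x else y) = if q then x else y := if_congr h rfl rfl

theorem Gate.matrix_eq {N : ℕ} (g : Gate N) : g.matrix = g.toWGate.matrix := by
  ext x y
  exact ite_congr_decidable Iff.rfl

theorem Circuit.unitary_eq {a b : ℕ} (Q : Circuit a b) :
    Q.unitary = gatesMatrix (Q.gates.map Gate.toWGate) := by
  rw [gatesMatrix, List.foldl_map, Circuit.unitary]
  congr 1
  funext V g
  rw [Gate.matrix_eq]

theorem Circuit.prepare_eq {a b : ℕ} (Q : Circuit a b) : Q.prepare = prepWires Q.input := by
  ext z x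
  exact ite_congr_decidable Iff.rfl

theorem Circuit.discard_eq {a b : ℕ} (Q : Circuit a b) (Y : Op (Qubits Q.N)) :
    Q.discard Y = traceWires Q.output Y := by
  ext x y
  exact Finset.sum_congr rfl fun z _ => Finset.sum_congr rfl fun w _ =>
    ite_congr_decidable Iff.rfl

/-- The map that a circuit performs, in terms of operators on labelled wires. -/
theorem Circuit.channel_eq {a b : ℕ} (Q : Circuit a b) (X : Op (Qubits a)) :
    Q.channel X = traceWires Q.output (gatesMatrix (Q.gates.map Gate.toWGate) *
      (prepWires Q.input * X * (prepWires Q.input)ᴴ) *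
      (gatesMatrix (Q.gates.map Gate.toWGate))ᴴ) := by
  rw [← Circuit.unitary_eq, ← Circuit.prepare_eq, ← Circuit.discard_eq, Circuit.channel]

/-- The circuit with the given wires, gates, input and output, where `e` numbers the wires. -/
def circuitOf {a b N : ℕ} (e : W ≃ Fin N) (input : Fin a ↪ W) (gates : List (WGate W))
    (output : Fin b ↪ W) : Circuit a b where
  N := N
  input := input.trans e.toEmbedding
  gates := gates.map (WGate.toGate e)
  output := output.trans e.toEmbedding

/-- The numbering of the wires does not matter for the map that a circuit performs. -/
theorem circuitOf_channel {a b N : ℕ} (e : W ≃ Fin N) (input : Fin a ↪ W) (gates : List (WGate W))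
    (output : Fin b ↪ W) (X : Op (Qubits a)) : (circuitOf e input gates output).channel X =
      traceWires output (gatesMatrix gates * (prepWires input * X * (prepWires input)ᴴ) *
        (gatesMatrix gates)ᴴ) := by
  have h1 : (circuitOf e input gates output).gates.map Gate.toWGate =
      gates.map (WGate.map e.toEmbedding) := by
    exact List.map_map
  rw [Circuit.channel_eq, h1]
  change traceWires (output.trans e.toEmbedding) (gatesMatrix (gates.map (WGate.map e.toEmbedding)) *
    (prepWires (input.trans e.toEmbedding) * X * (prepWires (input.trans e.toEmbedding))ᴴ) *
    (gatesMatrix (gates.map (WGate.map e.toEmbedding)))ᴴ) = _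
  rw [gatesMatrix_map, prepWires_trans, traceWires_trans]
  congr 1
  rw [Matrix.conjTranspose_mul, ← Matrix.mul_assoc (onWires _ _), ← Matrix.mul_assoc (onWires _ _),
    ← Matrix.mul_assoc (onWires _ _), onWires_mul_prepWires, Matrix.mul_assoc _ _ (onWires _ _)ᴴ,
    Matrix.mul_assoc _ _ (onWires _ _)ᴴ, ← Matrix.conjTranspose_mul, onWires_mul_prepWires,
    Matrix.conjTranspose_mul]
  rw [← traceWires_prepWires e.toEmbedding
    (gatesMatrix gates * (prepWires input * X * (prepWires input)ᴴ) * (gatesMatrix gates)ᴴ)]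
  simp only [Matrix.mul_assoc]

/-! ### Classical gates -/

/-- The operator that maps the basis vector `|w⟩` to `|φ w⟩`. -/
def funMat {Z : Type} [DecidableEq Z] (φ : Z → Z) : Op Z :=
  Matrix.of fun z w => if z = φ w then 1 else 0

theorem funMat_mul {Z : Type} [DecidableEq Z] [Fintype Z] (φ ψ : Z → Z) :
    funMat φ * funMat ψ = funMat (φ ∘ ψ) := by
  ext z w
  simp [Matrix.mul_apply, funMat]

theorem funMat_mul_apply {Z T : Type} [DecidableEq Z] [Fintype Z] {φ : Z → Z}
    (hφ : Function.Involutive φ) (Y : Matrix Z T ℂ) (z : Z) (t : T) :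
    (funMat φ * Y) z t = Y (φ z) t := by
  have h (w : Z) : z = φ w ↔ w = φ z := by rw [← hφ.eq_iff, eq_comm]
  simp [Matrix.mul_apply, funMat, h]

theorem funMat_conjTranspose {Z : Type} [DecidableEq Z] [Fintype Z] {φ : Z → Z}
    (hφ : Function.Involutive φ) : (funMat φ)ᴴ = funMat φ := by
  ext z w
  have h : w = φ z ↔ z = φ w := by rw [← hφ.eq_iff, eq_comm]
  simp [funMat, h, apply_ite star]

theorem funMat_conj_apply {Z : Type} [DecidableEq Z] [Fintype Z] {φ : Z → Z}
    (hφ : Function.Injective φ) (Y : Op Z) (z w : Z) :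
    (funMat φ * Y * (funMat φ)ᴴ) (φ z) (φ w) = Y z w := by
  simp [Matrix.mul_apply, funMat, hφ.eq_iff, apply_ite star]

/-- The entry of a partial trace after a permutation `φ` of the basis states: the sum runs over the
pairs of basis states whose images match the entry on the kept wires and agree on all others. -/
theorem traceWires_funMat {φ : (W → Fin 2) → W → Fin 2} (hφ : Function.Bijective φ) (o : A ↪ W)
    (Y : Op (W → Fin 2)) (x y : A → Fin 2) :
    traceWires o (funMat φ * Y * (funMat φ)ᴴ) x y = ∑ w, ∑ z,
      open Classical in if (∀ i, φ z (o i) = x i) ∧ (∀ i, φ w (o i) = y i) ∧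
        ∀ j ∉ Set.range o, φ z j = φ w j then Y z w else 0 := by
  rw [traceWires, Matrix.of_apply, Finset.sum_comm]
  rw [← (Equiv.ofBijective φ hφ).sum_comp]
  refine Finset.sum_congr rfl fun w _ => ?_
  rw [← (Equiv.ofBijective φ hφ).sum_comp]
  refine Finset.sum_congr rfl fun z _ => ?_
  simp only [Equiv.ofBijective_apply, funMat_conj_apply hφ.1]

theorem onWires_funMat (f : A ↪ W) (κ : (A → Fin 2) → A → Fin 2) :
    onWires f (funMat κ) = funMat fun w => Function.extend f (κ fun i => w (f i)) w := by
  ext z w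
  have h := eq_extend_iff f (κ fun i => w (f i)) w z
  by_cases h1 : ∀ j ∉ Set.range f, z j = w j
  · refine (if_pos h1).trans ?_
    exact ite_congr_decidable (by rw [h, and_iff_left h1, funext_iff])
  · exact (if_neg h1).trans (if_neg fun h' => h1 (h.mp h').2).symm

/-- Adding to the bit on the wire `t` a value that does not depend on that bit. -/
theorem involutive_update_add (t : W) (F : (W → Fin 2) → Fin 2)
    (hF : ∀ z v, F (Function.update z t v) = F z) :
    Function.Involutive fun z => Function.update z t (z t + F z) := by
  intro z
  have h : ∀ x y : Fin 2, x + y + y = x := by decide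
  simp [hF, h]

/-- A list of one wire. -/
def wire1 (t : W) : Fin 1 ↪ W := ⟨![t], fun i j _ => Subsingleton.elim i j⟩

/-- A list of two wires. -/
def wire2 (c t : W) (h : c ≠ t) : Fin 2 ↪ W := ⟨![c, t], by
  intro i j hij
  fin_cases i <;> fin_cases j <;> simp_all [eq_comm]⟩

/-- A list of three wires. -/
def wire3 (c c' t : W) (h : c ≠ c') (h1 : c ≠ t) (h2 : c' ≠ t) : Fin 3 ↪ W := ⟨![c, c', t], by
  intro i j hij
  fin_cases i <;> fin_cases j <;> simp_all [eq_comm]⟩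

/-- The matrix of a gate kind, with its arity evaluated. -/
def hadamardOp : Op (Fin 1 → Fin 2) := GateKind.hadamard.matrix

def notOp : Op (Fin 1 → Fin 2) := GateKind.not.matrix

def cnotOp : Op (Fin 2 → Fin 2) := GateKind.cnot.matrix

def toffoliOp : Op (Fin 3 → Fin 2) := GateKind.toffoli.matrix

/-- Hadamard gate on the wire `t`. -/
def hadamardGate (t : W) : WGate W := ⟨.hadamard, wire1 t⟩

/-- `X` gate on the wire `t`. -/
def notGate (t : W) : WGate W := ⟨.not, wire1 t⟩

/-- Gate with control `c` and target `t`. -/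
def cnotGate (c t : W) (h : c ≠ t) : WGate W := ⟨.cnot, wire2 c t h⟩

/-- Gate with controls `c`, `c'` and target `t`. -/
def toffoliGate (c c' t : W) (h : c ≠ c') (h1 : c ≠ t) (h2 : c' ≠ t) : WGate W :=
  ⟨.toffoli, wire3 c c' t h h1 h2⟩

theorem extend_wire1 (t : W) (u : Fin 1 → Fin 2) (z : W → Fin 2) :
    Function.extend (wire1 t) u z = Function.update z t (u 0) := by
  symm
  rw [eq_extend_iff]
  refine ⟨fun i => ?_, fun j hj => Function.update_of_ne (fun h => hj ⟨0, h.symm⟩) _ _⟩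
  rw [Subsingleton.elim i 0]
  exact Function.update_self _ _ _

theorem matrix_notGate (t : W) :
    (notGate t).matrix = funMat fun z => Function.update z t (z t + 1) := by
  have h : notOp = funMat fun y _ => y 0 + 1 := by
    ext x y
    refine ite_congr_decidable ⟨fun h => funext fun i => ?_, fun h => congrFun h 0⟩
    rw [Subsingleton.elim i 0]
    exact h
  change onWires (wire1 t) notOp = _
  rw [h, onWires_funMat]
  simp only [extend_wire1]
  rfl

theorem matrix_cnotGate (c t : W) (hct : c ≠ t) :
    (cnotGate c t hct).matrix = funMat fun z => Function.update z t (z t + z c) := by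
  have h : cnotOp = funMat fun y => ![y 0, y 1 + y 0] := by
    ext x y
    refine ite_congr_decidable ⟨fun h => funext fun i => ?_, fun h => ⟨congrFun h 0, congrFun h 1⟩⟩
    fin_cases i
    · exact h.1
    · exact h.2
  change onWires (wire2 c t hct) cnotOp = _
  rw [h, onWires_funMat]
  congr 1
  funext w
  symm
  rw [eq_extend_iff]
  refine ⟨fun i => ?_, fun j hj => Function.update_of_ne (fun h => hj ⟨1, h.symm⟩) _ _⟩
  fin_cases i
  · exact Function.update_of_ne hct _ _
  · exact Function.update_self _ _ _

theorem matrix_toffoliGate (c c' t : W) (h : c ≠ c') (h1 : c ≠ t) (h2 : c' ≠ t) :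
    (toffoliGate c c' t h h1 h2).matrix =
      funMat fun z => Function.update z t (z t + z c * z c') := by
  have hm : toffoliOp =
      funMat fun y => ![y 0, y 1, y 2 + y 0 * y 1] := by
    ext x y
    refine ite_congr_decidable ⟨fun h => funext fun i => ?_,
      fun h => ⟨congrFun h 0, congrFun h 1, congrFun h 2⟩⟩
    fin_cases i
    · exact h.1
    · exact h.2.1
    · exact h.2.2
  change onWires (wire3 c c' t h h1 h2) toffoliOp = _
  rw [hm, onWires_funMat]
  congr 1
  funext w
  symm
  rw [eq_extend_iff]
  refine ⟨fun i => ?_, fun j hj => Function.update_of_ne (fun h => hj ⟨2, h.symm⟩) _ _⟩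
  fin_cases i
  · exact Function.update_of_ne h1 _ _
  · exact Function.update_of_ne h2 _ _
  · exact Function.update_self _ _ _

theorem matrix_hadamardGate_mul_apply {T : Type*} (t : W) (Y : Matrix (W → Fin 2) T ℂ)
    (z : W → Fin 2) (x : T) : ((hadamardGate t).matrix * Y) z x =
      ((Real.sqrt 2 : ℝ) : ℂ)⁻¹ * (Y (Function.update z t 0) x +
        (if z t = 1 then -1 else 1) * Y (Function.update z t 1) x) := by
  have h : hadamardOp = Matrix.of fun x y =>
      ((Real.sqrt 2 : ℝ) : ℂ)⁻¹ * (if x 0 = 1 ∧ y 0 = 1 then -1 else 1) := rfl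
  change (onWires (wire1 t) hadamardOp * Y) z x = _
  rw [onWires_mul_apply, h, ← (Equiv.funUnique (Fin 1) (Fin 2)).symm.sum_comp, Fin.sum_univ_two]
  have hz : z (wire1 t 0) = z t := rfl
  simp only [extend_wire1, Matrix.of_apply, hz]
  simp [mul_add]

theorem matrix_hadamardGate_conjTranspose (t : W) :
    (hadamardGate t).matrixᴴ = (hadamardGate t).matrix := by
  rw [WGate.matrix, onWires_conjTranspose]
  congr 1
  change (Matrix.of fun (x y : Fin 1 → Fin 2) =>
    ((Real.sqrt 2 : ℝ) : ℂ)⁻¹ * (if x 0 = 1 ∧ y 0 = 1 then -1 else 1))ᴴ = Matrix.of fun x y =>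
    ((Real.sqrt 2 : ℝ) : ℂ)⁻¹ * (if x 0 = 1 ∧ y 0 = 1 then -1 else 1)
  ext x y
  simp [Matrix.conjTranspose_apply, and_comm, apply_ite star]

theorem ite_neg_one (p : Prop) [Decidable p] :
    (if p then (-1 : ℂ) else 0) = -if p then 1 else 0 := by split_ifs <;> simp

theorem matrix_hadamardGate_mul_self (t : W) :
    (hadamardGate t).matrix * (hadamardGate t).matrix = 1 := by
  have h2 := sqrt_two_inv_mul_self
  ext z w
  have h3 (v : W → Fin 2) := matrix_hadamardGate_mul_apply t (1 : Op (W → Fin 2)) v w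
  simp only [Matrix.mul_one, Matrix.one_apply] at h3
  have h01 : z t = 0 ∨ z t = 1 := by omega
  have hz : Function.update z t (z t) = z := Function.update_eq_self t z
  have hi : ∀ a b : Fin 2, Function.update (Function.update z t a) t b = Function.update z t b :=
    fun a b => Function.update_idem (β := fun _ => Fin 2) a b z
  rw [matrix_hadamardGate_mul_apply, h3, h3, Matrix.one_apply]
  rcases h01 with h0 | h0
  · rw [h0] at hz
    simp only [hi, h0, Function.update_self, hz]
    norm_num [ite_neg_one]
    linear_combination (2 * if z = w then 1 else 0) * h2
  · rw [h0] at hz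
    simp only [hi, h0, Function.update_self, hz]
    norm_num [ite_neg_one]
    linear_combination (2 * if z = w then 1 else 0) * h2

end Gates

/-! ### Preparing and undoing EPR pairs -/

section Epr
variable {m : ℕ}

/-- From `|00⟩`, these gates prepare an EPR pair on the `j`-th wires of the two registers. -/
def pairGates (j : Fin m) : List (WGate (Fin m ⊕ Fin m)) :=
  [hadamardGate (.inr j), cnotGate (.inr j) (.inl j) Sum.inr_ne_inl]

/-- The inverse of `pairGates`: it maps the Bell basis to the computational basis. -/
def unpairGates (j : Fin m) : List (WGate (Fin m ⊕ Fin m)) :=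
  [cnotGate (.inr j) (.inl j) Sum.inr_ne_inl, hadamardGate (.inr j)]

/-- The gates that prepare an EPR pair on every pair of corresponding wires. -/
def eprGates (m : ℕ) : List (WGate (Fin m ⊕ Fin m)) := (List.finRange m).flatMap pairGates

/-- The gates that map the EPR pairs back to `|0⟩`, and so the Bell basis to the computational
basis. -/
def bellGates (m : ℕ) : List (WGate (Fin m ⊕ Fin m)) := (List.finRange m).flatMap unpairGates

theorem involutive_cnot {W : Type} [Fintype W] [DecidableEq W] {c t : W} (h : c ≠ t) :
    Function.Involutive fun z : W → Fin 2 => Function.update z t (z t + z c) :=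
  involutive_update_add t (fun z => z c) fun z v => Function.update_of_ne h v z

/-- The amplitudes after EPR pairs have been prepared at the positions in `S`. -/
theorem gatesMatrix_pairGates_apply_zero {S : List (Fin m)} (hS : S.Nodup)
    (u : Fin m ⊕ Fin m → Fin 2) : gatesMatrix (S.flatMap pairGates) u 0 =
      ∏ j, if j ∈ S then (if u (.inl j) = u (.inr j) then ((Real.sqrt 2 : ℝ) : ℂ)⁻¹ else 0)
        else if u (.inl j) = 0 ∧ u (.inr j) = 0 then 1 else 0 := by
  induction S using List.reverseRecOn generalizing u with
  | nil =>
    rw [List.flatMap_nil, gatesMatrix_nil, Matrix.one_apply]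
    simp only [List.not_mem_nil, if_false]
    rw [Finset.prod_ite_zero]
    simp only [Finset.prod_const_one]
    refine ite_congr_decidable ⟨fun h j _ => by simp [h], fun h => funext fun j => ?_⟩
    rcases j with j | j
    · exact (h j (Finset.mem_univ j)).1
    · exact (h j (Finset.mem_univ j)).2
  | append_singleton S j ih =>
    have hj : j ∉ S := by
      rw [List.nodup_append] at hS
      exact fun h => hS.2.2 j h j (by simp) rfl
    have ih' := ih (List.nodup_append.mp hS).1
    rw [List.flatMap_append, gatesMatrix_append, List.flatMap_singleton, pairGates,
      gatesMatrix_cons, gatesMatrix_singleton, matrix_cnotGate, Matrix.mul_assoc,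
      funMat_mul_apply (involutive_cnot Sum.inr_ne_inl), matrix_hadamardGate_mul_apply]
    set u' := Function.update u (.inl j) (u (.inl j) + u (.inr j)) with hu'
    have h1 : gatesMatrix (S.flatMap pairGates) (Function.update u' (.inr j) 1) 0 = 0 := by
      rw [ih']
      refine Finset.prod_eq_zero (Finset.mem_univ j) ?_
      simp [hj]
    rw [h1, mul_zero, add_zero, ih', ← Finset.mul_prod_erase _ _ (Finset.mem_univ j),
      ← Finset.mul_prod_erase _ _ (Finset.mem_univ j), ← mul_assoc]
    congr 1
    · have h2 : ∀ x y : Fin 2, x + y = 0 ↔ x = y := by decide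
      simp [hj, hu', h2]
    · refine Finset.prod_congr rfl fun i hi => ?_
      have hij : i ≠ j := Finset.ne_of_mem_erase hi
      simp [hij, hu']

theorem gatesMatrix_eprGates_apply_zero (u : Fin m ⊕ Fin m → Fin 2) :
    gatesMatrix (eprGates m) u 0 = eprAmp (fun j => u (.inl j)) fun j => u (.inr j) := by
  rw [eprGates, gatesMatrix_pairGates_apply_zero (List.nodup_finRange m), eprAmp]
  simp

theorem conjTranspose_pairGate {j : Fin m} {g : WGate (Fin m ⊕ Fin m)} (hg : g ∈ unpairGates j) :
    g.matrixᴴ = g.matrix ∧ g.matrix * g.matrix = 1 := by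
  simp only [unpairGates, List.mem_cons, List.not_mem_nil, or_false] at hg
  rcases hg with rfl | rfl
  · have h := involutive_cnot (c := Sum.inr j) (t := Sum.inl j)
      (W := Fin m ⊕ Fin m) Sum.inr_ne_inl
    rw [matrix_cnotGate]
    refine ⟨funMat_conjTranspose h, ?_⟩
    ext z w
    rw [funMat_mul_apply h, Matrix.one_apply]
    exact ite_congr_decidable h.injective.eq_iff
  · exact ⟨matrix_hadamardGate_conjTranspose _, matrix_hadamardGate_mul_self _⟩

theorem bellGates_isometry : (gatesMatrix (bellGates m))ᴴ * gatesMatrix (bellGates m) = 1 := by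
  refine gatesMatrix_isometry fun g hg => ?_
  obtain ⟨j, -, hj⟩ := List.mem_flatMap.mp hg
  rw [(conjTranspose_pairGate hj).1, (conjTranspose_pairGate hj).2]

/-- The amplitude of `|0⟩` after the undoing of a basis state. -/
theorem gatesMatrix_bellGates_zero_apply (u : Fin m ⊕ Fin m → Fin 2) :
    gatesMatrix (bellGates m) 0 u = eprAmp (fun j => u (.inl j)) fun j => u (.inr j) := by
  have h1 : (gatesMatrix (bellGates m))ᴴ =
      gatesMatrix ((List.finRange m).reverse.flatMap pairGates) := by
    rw [gatesMatrix_conjTranspose, bellGates, List.reverse_flatMap]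
    · rfl
    · intro g hg
      obtain ⟨j, -, hj⟩ := List.mem_flatMap.mp hg
      exact (conjTranspose_pairGate hj).1
  have h2 := congrFun (congrFun h1 u) 0
  rw [gatesMatrix_pairGates_apply_zero (List.nodup_reverse.mpr (List.nodup_finRange m)),
    Matrix.conjTranspose_apply] at h2
  have h3 := congrArg star h2
  rw [star_star] at h3
  rw [h3, ← star_eprAmp, eprAmp]
  simp

end Epr

/-! ### Classical subcircuits -/

section Classical
set_option linter.unusedSectionVars false

variable {W : Type} [Fintype W] [DecidableEq W]

/-- Classical gates that are composed perform the composed map on basis states. -/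
theorem gatesMatrix_flatMap_funMat {ι : Type} {L : ι → List (WGate W)}
    {step : ι → (W → Fin 2) → W → Fin 2} (h : ∀ j, gatesMatrix (L j) = funMat (step j))
    (S : List ι) :
    gatesMatrix (S.flatMap L) = funMat fun z => S.foldl (fun z j => step j z) z := by
  induction S with
  | nil =>
    ext z w
    exact (Matrix.one_apply).trans rfl
  | cons j S ih => rw [List.flatMap_cons, gatesMatrix_append, ih, h, funMat_mul]; rfl

theorem foldl_bijective {ι Z : Type} {step : ι → Z → Z} (h : ∀ j, Function.Bijective (step j))
    (S : List ι) : Function.Bijective fun z => S.foldl (fun z j => step j z) z := by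
  induction S with
  | nil => exact Function.bijective_id
  | cons j S ih => exact ih.comp (h j)

section And
variable {K : ℕ} (b : Fin K → W) (f : Fin (K + 1) → W) (hf : Function.Injective f)
  (hbf : ∀ i j, b i ≠ f j)

/-- Negate the bit `b j`, and set the flag `f (j + 1)` if now this bit and the flag `f j` are
set. -/
def andStepGates (j : Fin K) : List (WGate W) :=
  [notGate (b j), toffoliGate (b j) (f j.castSucc) (f j.succ) (hbf _ _) (hbf _ _)
    (hf.ne (Fin.castSucc_lt_succ).ne)]

/-- The map that `andStepGates` performs on basis states. -/
def andStep (j : Fin K) (z : W → Fin 2) : W → Fin 2 :=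
  let y := Function.update z (b j) (z (b j) + 1)
  Function.update y (f j.succ) (y (f j.succ) + y (b j) * y (f j.castSucc))

/-- The flag `f j` records whether the first `j` of the bits `b` are zero. The flag `f 0` is set to
`1` at the start, and all bits are left negated. -/
def andGates : List (WGate W) :=
  notGate (f 0) :: (List.finRange K).flatMap (andStepGates b f hf hbf)

/-- The map that `andGates` performs on basis states. -/
def andFun (z : W → Fin 2) : W → Fin 2 :=
  (List.finRange K).foldl (fun z j => andStep b f j z) (Function.update z (f 0) (z (f 0) + 1))

theorem involutive_not (t : W) :
    Function.Involutive fun z : W → Fin 2 => Function.update z t (z t + 1) :=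
  involutive_update_add t (fun _ => 1) fun _ _ => rfl

theorem involutive_toffoli {c c' t : W} (h : c ≠ t) (h' : c' ≠ t) :
    Function.Involutive fun z : W → Fin 2 => Function.update z t (z t + z c * z c') :=
  involutive_update_add t (fun z => z c * z c') fun z v => by
    simp only [Function.update_of_ne h, Function.update_of_ne h']

theorem gatesMatrix_andGates : gatesMatrix (andGates b f hf hbf) = funMat (andFun b f) := by
  rw [andGates, gatesMatrix_cons, gatesMatrix_flatMap_funMat (step := andStep b f),
    matrix_notGate, funMat_mul]
  · rfl
  · intro j
    rw [andStepGates, gatesMatrix_cons, gatesMatrix_singleton, matrix_notGate, matrix_toffoliGate,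
      funMat_mul]
    rfl

include hf hbf in
theorem andFun_bijective : Function.Bijective (andFun b f) := by
  refine (foldl_bijective (fun j => ?_) _).comp (involutive_not (f 0)).bijective
  exact (involutive_toffoli (hbf j j.succ) (hf.ne (Fin.castSucc_lt_succ).ne)).bijective.comp
    (involutive_not (b j)).bijective

/-- The values of all wires after the computation of the flags, in terms of those after the first
`NOT` gate. -/
theorem foldl_andStep {K : ℕ} (b : Fin K → W) (f : Fin (K + 1) → W) (hb : Function.Injective b)
    (hf : Function.Injective f) (hbf : ∀ i j, b i ≠ f j) (z : W → Fin 2) (h0 : z (f 0) = 1)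
    (hz : ∀ j : Fin K, z (f j.succ) = 0) :
    (∀ i, (List.finRange K).foldl (fun z j => andStep b f j z) z (b i) = z (b i) + 1) ∧
    (∀ j : Fin (K + 1), (List.finRange K).foldl (fun z j => andStep b f j z) z (f j) =
      if ∀ i : Fin K, i.castSucc < j → z (b i) = 0 then 1 else 0) ∧
    ∀ w, w ∉ Set.range b → w ∉ Set.range f →
      (List.finRange K).foldl (fun z j => andStep b f j z) z w = z w := by
  induction K with
  | zero =>
    refine ⟨fun i => i.elim0, fun j => ?_, fun w _ _ => rfl⟩
    rw [Fin.eq_zero j, if_pos fun i => i.elim0]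
    exact h0
  | succ K ih =>
    obtain ⟨h1, h2, h3⟩ := ih (fun i => b i.castSucc) (fun j => f j.castSucc)
      (hb.comp (Fin.castSucc_injective K)) (hf.comp (Fin.castSucc_injective _))
      (fun i j => hbf _ _) h0 (fun j => hz j.castSucc)
    -- the last step is split off, and the others concern the first `K` bits and `K + 1` flags
    have hfold : (List.finRange (K + 1)).foldl (fun z j => andStep b f j z) z =
        andStep b f (Fin.last K) ((List.finRange K).foldl
          (fun z j => andStep (fun i => b i.castSucc) (fun j => f j.castSucc) j z) z) := by
      rw [List.finRange_succ_last, List.foldl_append, List.foldl_map]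
      rfl
    rw [hfold]
    set y := (List.finRange K).foldl
      (fun z j => andStep (fun i => b i.castSucc) (fun j => f j.castSucc) j z) z with hy
    have hylast : y (b (Fin.last K)) = z (b (Fin.last K)) := by
      refine h3 _ ?_ ?_
      · rintro ⟨i, hi⟩
        exact (Fin.castSucc_lt_last i).ne (hb hi)
      · rintro ⟨i, hi⟩
        exact hbf _ _ hi.symm
    have hyf : y (f (Fin.last (K + 1))) = 0 := by
      rw [h3, ← Fin.succ_last, hz]
      · rintro ⟨i, hi⟩
        exact hbf _ _ hi
      · rintro ⟨i, hi⟩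
        exact (Fin.castSucc_lt_last i).ne (hf hi)
    refine ⟨fun i => ?_, fun j => ?_, fun w hwb hwf => ?_⟩
    · rw [andStep, Function.update_of_ne (hbf _ _)]
      refine Fin.lastCases ?_ (fun i => ?_) i
      · rw [Function.update_self, hylast]
      · rw [Function.update_of_ne (hb.ne (Fin.castSucc_lt_last i).ne), h1]
    · refine Fin.lastCases ?_ (fun j => ?_) j
      · have h4 : y (f (Fin.last K).castSucc) = _ := h2 (Fin.last K)
        simp only [andStep, Fin.succ_last, Function.update_self]
        rw [Function.update_of_ne (hbf _ _).symm, Function.update_of_ne (hbf _ _).symm, hyf, hylast,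
          h4, zero_add]
        have h5 : ∀ x : Fin 2, x + 1 = if x = 0 then 1 else 0 := by decide
        have h6 : (∀ i : Fin (K + 1), i.castSucc < Fin.last (K + 1) → z (b i) = 0) ↔
            z (b (Fin.last K)) = 0 ∧
              ∀ i : Fin K, i.castSucc < Fin.last K → z (b i.castSucc) = 0 := by
          constructor
          · exact fun h => ⟨h _ (Fin.castSucc_lt_last _), fun i _ => h _ (Fin.castSucc_lt_last _)⟩
          · intro h i _
            refine Fin.lastCases h.1 (fun i => h.2 i (Fin.castSucc_lt_last i)) i
        rw [h5]
        by_cases h7 : z (b (Fin.last K)) = 0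
        · rw [if_pos h7, one_mul]
          refine ite_congr_decidable ?_
          rw [h6, and_iff_right h7]
        · rw [if_neg h7, zero_mul, if_neg fun h => h7 (h6.mp h).1]
      · rw [andStep, Function.update_of_ne, Function.update_of_ne (hbf _ _).symm]
        · refine (h2 j).trans (ite_congr_decidable ⟨fun h i => ?_, fun h i hi => ?_⟩)
          · refine Fin.lastCases (fun hi => ?_) (fun i hi => h i ?_) i
            · exact absurd (Fin.castSucc_lt_castSucc_iff.mp hi) (Fin.le_last j).not_gt
            · exact Fin.castSucc_lt_castSucc_iff.mp hi
          · exact h i.castSucc (Fin.castSucc_lt_castSucc_iff.mpr hi)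
        · rw [Fin.succ_last]
          exact hf.ne (Fin.castSucc_lt_last j).ne
    · rw [andStep, Function.update_of_ne fun h => hwf ⟨_, h.symm⟩,
        Function.update_of_ne fun h => hwb ⟨_, h.symm⟩]
      exact h3 w (fun ⟨i, hi⟩ => hwb ⟨_, hi⟩) fun ⟨i, hi⟩ => hwf ⟨_, hi⟩

/-- Started with flags `0`, the circuit negates all bits, and the flag `f j` records whether the
first `j` bits were zero. -/
theorem andFun_apply (hb : Function.Injective b) (hf : Function.Injective f)
    (hbf : ∀ i j, b i ≠ f j) (z : W → Fin 2) (hz : ∀ j, z (f j) = 0) :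
    (∀ i, andFun b f z (b i) = z (b i) + 1) ∧
    (∀ j : Fin (K + 1), andFun b f z (f j) =
      if ∀ i : Fin K, i.castSucc < j → z (b i) = 0 then 1 else 0) ∧
    ∀ w, w ∉ Set.range b → w ∉ Set.range f → andFun b f z w = z w := by
  have h := foldl_andStep b f hb hf hbf (Function.update z (f 0) (z (f 0) + 1))
    (by rw [Function.update_self, hz, zero_add])
    (fun j => by rw [Function.update_of_ne (hf.ne (Fin.succ_ne_zero j)), hz])
  have hbz (i : Fin K) : Function.update z (f 0) (z (f 0) + 1) (b i) = z (b i) :=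
    Function.update_of_ne (hbf i 0) _ _
  simp only [hbz] at h
  refine ⟨h.1, h.2.1, fun w hwb hwf => (h.2.2 w hwb hwf).trans ?_⟩
  exact Function.update_of_ne (fun h => hwf ⟨0, h.symm⟩) _ _

end And

section Swap
variable {n : ℕ} (c : W) (a b : Fin n → W) (hab : ∀ i j, a i ≠ b j) (hca : ∀ i, c ≠ a i)
  (hcb : ∀ i, c ≠ b i)

/-- The swap of the wires `a j` and `b j`, controlled by `c`: of the three CNOT gates that make up a
swap, only the middle one needs the control. -/
def swapStepGates (j : Fin n) : List (WGate W) :=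
  [cnotGate (b j) (a j) (hab j j).symm, toffoliGate c (a j) (b j) (hca j) (hcb j) (hab j j),
    cnotGate (b j) (a j) (hab j j).symm]

/-- The swap of the registers `a` and `b`, controlled by `c`. -/
def swapGates : List (WGate W) := (List.finRange n).flatMap (swapStepGates c a b hab hca hcb)

/-- The map that `swapStepGates` performs on basis states. -/
def swapStep (j : Fin n) (z : W → Fin 2) : W → Fin 2 :=
  let y := Function.update z (a j) (z (a j) + z (b j))
  let x := Function.update y (b j) (y (b j) + y c * y (a j))
  Function.update x (a j) (x (a j) + x (b j))

/-- The map that `swapGates` performs on basis states. -/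
def swapFun (z : W → Fin 2) : W → Fin 2 :=
  (List.finRange n).foldl (fun z j => swapStep c a b j z) z

theorem gatesMatrix_swapGates :
    gatesMatrix (swapGates c a b hab hca hcb) = funMat (swapFun c a b) := by
  refine gatesMatrix_flatMap_funMat (fun j => ?_) _
  rw [swapStepGates, gatesMatrix_cons, gatesMatrix_cons, gatesMatrix_singleton, matrix_cnotGate,
    matrix_toffoliGate, funMat_mul, funMat_mul]
  rfl

include hab hca hcb

theorem swapFun_bijective : Function.Bijective (swapFun c a b) := by
  refine foldl_bijective (fun j => ?_) _
  have h := (involutive_cnot (hab j j).symm).bijective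
  exact h.comp ((involutive_toffoli (hcb j) (hab j j)).bijective.comp h)

theorem swapStep_apply (j : Fin n) (z : W → Fin 2) :
    swapStep c a b j z (a j) = (if z c = 1 then z (b j) else z (a j)) ∧
    swapStep c a b j z (b j) = (if z c = 1 then z (a j) else z (b j)) ∧
    ∀ w, w ≠ a j → w ≠ b j → swapStep c a b j z w = z w := by
  have h1 : ∀ x y t : Fin 2, x + y + (y + t * (x + y)) = if t = 1 then y else x := by decide
  have h2 : ∀ x y t : Fin 2, y + t * (x + y) = if t = 1 then x else y := by decide
  have hab' := hab j j
  have hba' := (hab j j).symm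
  have hca' := hca j
  refine ⟨?_, ?_, fun w hwa hwb => ?_⟩
  · simp only [swapStep, Function.update_self, Function.update_of_ne hab',
      Function.update_of_ne hba', Function.update_of_ne hca', h1]
  · simp only [swapStep, Function.update_self, Function.update_of_ne hab',
      Function.update_of_ne hba', Function.update_of_ne hca', h2]
  · simp only [swapStep, Function.update_of_ne hwa, Function.update_of_ne hwb]

theorem foldl_swapStep (ha : Function.Injective a) (hb : Function.Injective b) {S : List (Fin n)}
    (hS : S.Nodup) (z : W → Fin 2) :
    (∀ j ∈ S, S.foldl (fun z j => swapStep c a b j z) z (a j) =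
      if z c = 1 then z (b j) else z (a j)) ∧
    (∀ j ∈ S, S.foldl (fun z j => swapStep c a b j z) z (b j) =
      if z c = 1 then z (a j) else z (b j)) ∧
    ∀ w, (∀ j ∈ S, w ≠ a j) → (∀ j ∈ S, w ≠ b j) →
      S.foldl (fun z j => swapStep c a b j z) z w = z w := by
  induction S generalizing z with
  | nil => simp
  | cons k S ih =>
    rw [List.nodup_cons] at hS
    obtain ⟨h1, h2, h3⟩ := ih hS.2 (swapStep c a b k z)
    obtain ⟨g1, g2, g3⟩ := swapStep_apply c a b hab hca hcb k z
    have hc : swapStep c a b k z c = z c := g3 c (hca k) (hcb k)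
    have hkS : ∀ j ∈ S, k ≠ j := fun j hj h => hS.1 (h ▸ hj)
    simp only [List.foldl_cons]
    refine ⟨fun j hj => ?_, fun j hj => ?_, fun w hwa hwb => ?_⟩
    · rcases List.mem_cons.mp hj with rfl | hj
      · rw [h3 _ (fun i hi => ha.ne (hkS i hi)) fun i _ => hab _ _, g1]
      · rw [h1 j hj, hc, g3 _ (hab _ _).symm (hb.ne (hkS j hj).symm),
          g3 _ (ha.ne (hkS j hj).symm) (hab _ _)]
    · rcases List.mem_cons.mp hj with rfl | hj
      · rw [h3 _ (fun i _ => (hab _ _).symm) fun i hi => hb.ne (hkS i hi), g2]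
      · rw [h2 j hj, hc, g3 _ (ha.ne (hkS j hj).symm) (hab _ _), g3 _ (hab _ _).symm
          (hb.ne (hkS j hj).symm)]
    · rw [h3 w (fun j hj => hwa j (List.mem_cons_of_mem k hj))
        fun j hj => hwb j (List.mem_cons_of_mem k hj)]
      exact g3 w (hwa k List.mem_cons_self) (hwb k List.mem_cons_self)

theorem swapFun_apply (ha : Function.Injective a) (hb : Function.Injective b) (z : W → Fin 2) :
    (∀ j, swapFun c a b z (a j) = if z c = 1 then z (b j) else z (a j)) ∧
    (∀ j, swapFun c a b z (b j) = if z c = 1 then z (a j) else z (b j)) ∧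
    ∀ w, w ∉ Set.range a → w ∉ Set.range b → swapFun c a b z w = z w := by
  obtain ⟨h1, h2, h3⟩ := foldl_swapStep c a b hab hca hcb ha hb (List.nodup_finRange n) z
  exact ⟨fun j => h1 j (List.mem_finRange j), fun j => h2 j (List.mem_finRange j),
    fun w hwa hwb => h3 w (fun j _ h => hwa ⟨j, h.symm⟩) fun j _ h => hwb ⟨j, h.symm⟩⟩

end Swap

end Classical

/-! ### The circuit of the ideal world -/

section IdealCircuit
set_option linter.unusedSectionVars false

/-- The wires of the ideal circuit that neither the attack nor the preparation of `Ω` touches: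
the register `C₂`, the message, and a chain of flags. -/
abbrev Side (m n : ℕ) : Type := Fin m ⊕ (Fin n ⊕ Fin (m + m + 1))

variable (m n r : ℕ)

/-- The wires of `C₁` (the first ones of the attack) and of `C₂`. -/
def pairWires : Fin m ⊕ Fin m ↪ Fin (m + r) ⊕ Side m n :=
  ⟨Sum.elim (fun j => .inl (Fin.castAdd r j)) fun j => .inr (.inl j), by
    rintro (i | i) (j | j) h <;> simp_all⟩

/-- The input consists of the message and the reference register of the attack. -/
def idealIn : Fin (n + r) ↪ Fin (m + r) ⊕ Side m n :=
  finSumFinEquiv.symm.toEmbedding.trans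
    ⟨Sum.elim (fun i => .inr (.inr (.inl i))) fun j => .inl (Fin.natAdd m j), by
      rintro (i | i) (j | j) h <;> simp_all⟩

/-- The wires on which the fixed state is prepared. -/
def stateWire (i : Fin n) : Fin n ⊕ (Fin (m + r) ⊕ Side m n) := .inl i

/-- The wires of the message. -/
def messageWire (i : Fin n) : Fin n ⊕ (Fin (m + r) ⊕ Side m n) := .inr (.inr (.inr (.inl i)))

/-- The chain of flags, of which the last one tells whether all pairs were found intact. -/
def flagWire (j : Fin (m + m + 1)) : Fin n ⊕ (Fin (m + r) ⊕ Side m n) :=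
  .inr (.inr (.inr (.inr j)))

/-- The wires of `C₁` and `C₂`, which carry the outcome of the Bell measurement. -/
def bitWire (i : Fin (m + m)) : Fin n ⊕ (Fin (m + r) ⊕ Side m n) :=
  .inr ((pairWires m n r) (finSumFinEquiv.symm i))

/-- The output consists of the wires of the fixed state, which carry the message in case of
acceptance, the reference register and the last flag. -/
def idealOut : Fin (n + r + 1) ↪ Fin n ⊕ (Fin (m + r) ⊕ Side m n) :=
  ((finSumFinEquiv.symm.trans (finSumFinEquiv.symm.sumCongr (Equiv.refl _))).toEmbedding).trans
    ⟨Sum.elim (Sum.elim (stateWire m n r) fun j => .inr (.inl (Fin.natAdd m j)))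
      fun _ => flagWire m n r (Fin.last _), by
      rintro ((i | i) | i) ((j | j) | j) h <;> simp_all [stateWire, flagWire]
      exact Subsingleton.elim _ _⟩

theorem flagWire_injective : Function.Injective (flagWire m n r) := fun i j h => by
  simpa [flagWire] using h

theorem bitWire_injective : Function.Injective (bitWire m n r) := fun i j h => by
  simpa [bitWire] using h

theorem messageWire_injective : Function.Injective (messageWire m n r) := fun i j h => by
  simpa [messageWire] using h

theorem stateWire_injective : Function.Injective (stateWire m n r) := fun i j h => by
  simpa [stateWire] using h

theorem bitWire_ne_flagWire (i : Fin (m + m)) (j : Fin (m + m + 1)) :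
    bitWire m n r i ≠ flagWire m n r j := by
  rw [bitWire, flagWire]
  rcases finSumFinEquiv.symm i with a | a <;> exact fun h => by cases h

theorem messageWire_ne_stateWire (i j : Fin n) : messageWire m n r i ≠ stateWire m n r j := by
  simp [messageWire, stateWire]

theorem flagWire_ne_messageWire (i) (j : Fin n) : flagWire m n r i ≠ messageWire m n r j := by
  simp [messageWire, flagWire]

theorem flagWire_ne_stateWire (i) (j : Fin n) : flagWire m n r i ≠ stateWire m n r j := by
  simp [flagWire, stateWire]

/-- The flag is computed from all bits of `C₁` and `C₂`; then it controls the choice between the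
message and the fixed state. -/
def choiceGates : List (WGate (Fin n ⊕ (Fin (m + r) ⊕ Side m n))) :=
  andGates (bitWire m n r) (flagWire m n r) (flagWire_injective m n r)
    (bitWire_ne_flagWire m n r) ++
  swapGates (flagWire m n r (Fin.last _)) (messageWire m n r) (stateWire m n r)
    (messageWire_ne_stateWire m n r) (flagWire_ne_messageWire m n r _)
    (flagWire_ne_stateWire m n r _)

/-- What happens after the attack: the Bell measurement and the choice of the output. -/
def finalGates : List (WGate (Fin n ⊕ (Fin (m + r) ⊕ Side m n))) :=
  (bellGates m).map (WGate.map ((pairWires m n r).trans .inr)) ++ choiceGates m n r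

variable {m n r}
variable {WΩ WU : Type} [Fintype WΩ] [Fintype WU] [DecidableEq WΩ] [DecidableEq WU]

/-- The final gates act on the outputs of the two subcircuits. -/
def finalWires (oΩ : Fin n ↪ WΩ) (oU : Fin (m + r) ↪ WU) :
    Fin n ⊕ (Fin (m + r) ⊕ Side m n) ↪ WΩ ⊕ (WU ⊕ Side m n) :=
  (keepLeft (Fin n) (keepRight (Side m n) oU)).trans (keepRight (WU ⊕ Side m n) oΩ)

/-- The preparation of the EPR pairs acts on the inputs of the attack. -/
def initialWires (WΩ : Type) (ιU : Fin (m + r) ↪ WU) :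
    Fin (m + r) ⊕ Side m n ↪ WΩ ⊕ (WU ⊕ Side m n) :=
  (keepRight (Side m n) ιU).trans .inr

/-- The gates of the ideal circuit, for given circuits of the attack and of the fixed state. -/
def idealGates (oΩ : Fin n ↪ WΩ) (gΩ : List (WGate WΩ)) (ιU oU : Fin (m + r) ↪ WU)
    (gU : List (WGate WU)) : List (WGate (WΩ ⊕ (WU ⊕ Side m n))) :=
  (eprGates m).map (WGate.map ((pairWires m n r).trans (initialWires WΩ ιU))) ++
    gU.map (WGate.map (Function.Embedding.inl.trans .inr)) ++ gΩ.map (WGate.map .inl) ++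
    (finalGates m n r).map (WGate.map (finalWires oΩ oU))

/-- The state before the Bell measurement, as a function of the input. -/
def attackedInput (m n r : ℕ) (U : Op (Fin (m + r) → Fin 2)) :
    Matrix (Fin (m + r) ⊕ Side m n → Fin 2) (Fin (n + r) → Fin 2) ℂ :=
  padRight (Side m n) U *
    (onWires (pairWires m n r) (gatesMatrix (eprGates m)) * prepWires (idealIn m n r))

theorem conj_conj {A B C : Type} [Fintype A] [Fintype B] (M : Matrix C B ℂ) (N : Matrix B A ℂ)
    (X : Op A) : M * N * X * (M * N)ᴴ = M * (N * X * Nᴴ) * Mᴴ := by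
  simp only [Matrix.conjTranspose_mul, Matrix.mul_assoc]

/-- The two given circuits enter the ideal circuit only through the maps that they perform. -/
theorem traceWires_idealGates (oΩ : Fin n ↪ WΩ) (gΩ : List (WGate WΩ)) (ιΩ : Fin 0 ↪ WΩ)
    (ιU oU : Fin (m + r) ↪ WU) (gU : List (WGate WU)) (Ω : Op (Fin n → Fin 2))
    (U : Op (Fin (m + r) → Fin 2))
    (hΩ : ∀ Y : Op (Fin 0 → Fin 2), traceWires oΩ (gatesMatrix gΩ * (prepWires ιΩ * Y * (prepWires ιΩ)ᴴ) *
      (gatesMatrix gΩ)ᴴ) = Y.trace • Ω)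
    (hU : ∀ Y : Op (Fin (m + r) → Fin 2), traceWires oU (gatesMatrix gU * (prepWires ιU * Y * (prepWires ιU)ᴴ) *
      (gatesMatrix gU)ᴴ) = U * Y * Uᴴ) (X : Op (Fin (n + r) → Fin 2)) :
    traceWires ((idealOut m n r).trans (finalWires oΩ oU))
      (gatesMatrix (idealGates oΩ gΩ ιU oU gU) *
        (prepWires ((idealIn m n r).trans (initialWires WΩ ιU)) * X *
          (prepWires ((idealIn m n r).trans (initialWires WΩ ιU)))ᴴ) *
        (gatesMatrix (idealGates oΩ gΩ ιU oU gU))ᴴ) =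
    traceWires (idealOut m n r) (gatesMatrix (finalGates m n r) *
      attach Ω (attackedInput m n r U * X * (attackedInput m n r U)ᴴ) *
      (gatesMatrix (finalGates m n r))ᴴ) := by
  -- the fresh wires are moved past all gates that do not touch them, so that each subcircuit stands
  -- right after the preparation of its own wires
  have h1 : gatesMatrix (idealGates oΩ gΩ ιU oU gU) *
      prepWires ((idealIn m n r).trans (initialWires WΩ ιU)) =
      onWires (finalWires oΩ oU) (gatesMatrix (finalGates m n r)) *
        (onWires (Function.Embedding.inl : WΩ ↪ WΩ ⊕ (WU ⊕ Side m n)) (gatesMatrix gΩ) * (prepWires (Function.Embedding.inr :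
            WU ⊕ Side m n ↪ WΩ ⊕ (WU ⊕ Side m n)) * (onWires (Function.Embedding.inl : WU ↪ WU ⊕ Side m n) (gatesMatrix gU) *
          (prepWires (keepRight (Side m n) ιU) * (onWires (pairWires m n r)
            (gatesMatrix (eprGates m)) * prepWires (idealIn m n r)))))) := by
    rw [idealGates, gatesMatrix_append, gatesMatrix_append, gatesMatrix_append, gatesMatrix_map,
      gatesMatrix_map, gatesMatrix_map, gatesMatrix_map, prepWires_trans, initialWires,
      prepWires_trans]
    simp only [Matrix.mul_assoc]
    congr 2
    rw [← Matrix.mul_assoc (prepWires _) (prepWires _), ← prepWires_trans, ← Matrix.mul_assoc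
      (onWires ((pairWires m n r).trans _) _), onWires_trans_mul_prepWires, prepWires_trans]
    simp only [Matrix.mul_assoc]
    rw [← Matrix.mul_assoc (onWires _ _) (prepWires _), onWires_trans_mul_prepWires]
    simp only [Matrix.mul_assoc]
  have h2 : prepWires (Function.Embedding.inr : WU ⊕ Side m n ↪ WΩ ⊕ (WU ⊕ Side m n)) =
      prepWires (keepRight (WU ⊕ Side m n) ιΩ) *
        prepWires (Function.Embedding.inr : WU ⊕ Side m n ↪ Fin 0 ⊕ (WU ⊕ Side m n)) := by
    rw [← prepWires_trans]
    rfl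
  rw [← conj_conj, h1, traceWires_trans, conj_conj, traceWires_conj]
  congr 2
  -- first the subcircuit for the fixed state is replaced by its map, then that for the attack
  rw [finalWires, traceWires_trans, h2, conj_conj, Matrix.mul_assoc (prepWires _) (prepWires _),
    conj_conj, conj_conj, traceWires_subcircuit]
  simp only [hΩ]
  rw [onLeftWires_prepare, traceWires_attach, conj_conj, conj_conj, traceWires_subcircuit]
  simp only [hU]
  simp only [onLeftWires_conj, attackedInput, conj_conj]

end IdealCircuit

/-! ### The state after the attack -/

section Attacked
variable {m : ℕ} {R : Type} [Fintype R] [DecidableEq R]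

/-- The attacked EPR pairs as a map from the input to the output of the reference register, for
every basis state of the pairs; `s` is the final basis state of the reference register. -/
def pairAmp (U : Op (Qubits m × R)) (s : R) : Matrix (Fin m ⊕ Fin m → Fin 2) R ℂ :=
  Matrix.of fun u t => ((U ⊗ₖ (1 : Op (Qubits m))) * eprIso m R)
    (((fun j => u (.inl j)), s), fun j => u (.inr j)) t

/-- The operator on the reference register if the outcome of the Bell measurement is `p`. -/
def branch (U : Op (Qubits m × R)) (p : Fin m ⊕ Fin m → Fin 2) : Op R :=
  Matrix.of fun s t => (gatesMatrix (bellGates m) * pairAmp U s) p t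

/-- The outcome `0` means that all pairs are found intact, because the gates that undo the EPR pairs
map these to `|0⟩`. -/
theorem branch_zero (U : Op (Qubits m × R)) : branch U 0 = pauliCoeff U 0 := by
  rw [← eprIso_conj_attack]
  ext s t
  rw [branch, Matrix.of_apply, Matrix.mul_apply, Matrix.mul_apply]
  simp only [gatesMatrix_bellGates_zero_apply, Matrix.conjTranspose_apply, eprIso,
    Matrix.of_apply, apply_ite star, star_eprAmp, star_zero, Fintype.sum_prod_type, ite_mul,
    zero_mul]
  rw [← (Equiv.sumArrowEquivProdArrow (Fin m) (Fin m) (Fin 2)).symm.sum_comp,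
    Fintype.sum_prod_type]
  refine Finset.sum_congr rfl fun a _ => ?_
  rw [Finset.sum_comm]
  refine Finset.sum_congr rfl fun c _ => ?_
  rw [Finset.sum_ite_eq' Finset.univ s, if_pos (Finset.mem_univ s)]
  rfl

/-- If the outcome is ignored, the change of basis has no effect. -/
theorem sum_branch_conj (U : Matrix.unitaryGroup (Qubits m × R) ℂ) (ρ : Op R) :
    ∑ p, branch U.1 p * ρ * (branch U.1 p)ᴴ = traceFst (traceSnd (attackedEpr U ρ)) := by
  have h1 : attackedEpr U ρ = ((U.1 ⊗ₖ (1 : Op (Qubits m))) * eprIso m R) * ρ *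
      ((U.1 ⊗ₖ (1 : Op (Qubits m))) * eprIso m R)ᴴ := by
    rw [attackedEpr, eprState_eq]
    simp only [Matrix.conjTranspose_mul, Matrix.mul_assoc]
  have h2 (s s' : R) : ∑ p, (branch U.1 p * ρ * (branch U.1 p)ᴴ) s s' =
      (pairAmp U.1 s * ρ * (pairAmp U.1 s')ᴴ).trace := by
    -- the isometry `bellGates` does not change the trace over the pairs
    have h3 : (pairAmp U.1 s * ρ * (pairAmp U.1 s')ᴴ).trace =
        ((gatesMatrix (bellGates m) * pairAmp U.1 s) * ρ *
          (gatesMatrix (bellGates m) * pairAmp U.1 s')ᴴ).trace := by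
      rw [Matrix.conjTranspose_mul, ← Matrix.mul_assoc,
        Matrix.trace_mul_comm _ (gatesMatrix (bellGates m))ᴴ]
      simp only [← Matrix.mul_assoc, bellGates_isometry, Matrix.one_mul]
    rw [h3, Matrix.trace]
    refine Finset.sum_congr rfl fun p _ => ?_
    simp only [Matrix.diag, Matrix.mul_apply (M := _ * ρ), Matrix.mul_apply (N := ρ)]
    rfl
  ext s s'
  rw [Matrix.sum_apply, h2, h1, Matrix.trace,
    ← (Equiv.sumArrowEquivProdArrow (Fin m) (Fin m) (Fin 2)).symm.sum_comp, Fintype.sum_prod_type]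
  simp only [traceFst, traceSnd, Matrix.of_apply]
  refine Finset.sum_congr rfl fun a _ => Finset.sum_congr rfl fun c _ => ?_
  rfl

end Attacked

section Input
variable (m n r : ℕ)

@[simp] theorem idealIn_castAdd (i : Fin n) :
    idealIn m n r (Fin.castAdd r i) = .inr (.inr (.inl i)) := by
  simp only [idealIn, Function.Embedding.trans_apply, Equiv.coe_toEmbedding,
    finSumFinEquiv_symm_apply_castAdd]
  rfl

@[simp] theorem idealIn_natAdd (j : Fin r) :
    idealIn m n r (Fin.natAdd n j) = .inl (Fin.natAdd m j) := by
  simp only [idealIn, Function.Embedding.trans_apply, Equiv.coe_toEmbedding,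
    finSumFinEquiv_symm_apply_natAdd]
  rfl

variable {m n r}

theorem notMem_range_idealIn {w : Fin (m + r) ⊕ Side m n} (h : ∀ i, w ≠ .inr (.inr (.inl i)))
    (h' : ∀ j, w ≠ .inl (Fin.natAdd m j)) : w ∉ Set.range (idealIn m n r) := by
  rintro ⟨i, hi⟩
  revert hi
  refine Fin.addCases (fun i hi => ?_) (fun j hj => ?_) i
  · exact h i (by rw [← hi, idealIn_castAdd])
  · exact h' j (by rw [← hj, idealIn_natAdd])

/-- The message and the flags of a basis state agree with the input `x`. -/
def SideAgrees (z : Fin (m + r) ⊕ Side m n → Fin 2) (x : Fin (n + r) → Fin 2) : Prop :=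
  (∀ i, z (.inr (.inr (.inl i))) = x (Fin.castAdd r i)) ∧ ∀ j, z (.inr (.inr (.inr j))) = 0

open Classical in
/-- The amplitudes after the preparation of the EPR pairs. -/
theorem eprInput_apply (z : Fin (m + r) ⊕ Side m n → Fin 2) (x : Fin (n + r) → Fin 2) :
    (onWires (pairWires m n r) (gatesMatrix (eprGates m)) * prepWires (idealIn m n r)) z x =
      if SideAgrees z x ∧ ∀ j, z (.inl (Fin.natAdd m j)) = x (Fin.natAdd n j) then
        eprAmp (fun j => z (.inl (Fin.castAdd r j))) fun j => z (.inr (.inl j)) else 0 := by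
  rw [mul_prepWires_apply]
  set y := Function.extend (idealIn m n r) x 0 with hy
  have hyM (i : Fin n) : y (.inr (.inr (.inl i))) = x (Fin.castAdd r i) := by
    rw [hy, ← idealIn_castAdd, extend_wire]
  have hyR (j : Fin r) : y (.inl (Fin.natAdd m j)) = x (Fin.natAdd n j) := by
    rw [hy, ← idealIn_natAdd, extend_wire]
  have hyF (j) : y (.inr (.inr (.inr j))) = 0 :=
    extend_of_notMem _ _ _ (notMem_range_idealIn (by simp) (by simp))
  have hyC : (fun i => y (pairWires m n r i)) = 0 := by
    funext i
    refine extend_of_notMem _ _ _ (notMem_range_idealIn (fun k => ?_) fun k => ?_)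
    · rcases i with i | i <;> exact fun h => by cases h
    · rcases i with i | i
      · intro h
        have h' := congrArg Fin.val (Sum.inl_injective h)
        simp only [Fin.val_castAdd, Fin.val_natAdd] at h'
        omega
      · exact fun h => by cases h
  have hiff : (∀ j ∉ Set.range (pairWires m n r), z j = y j) ↔
      SideAgrees z x ∧ ∀ j, z (.inl (Fin.natAdd m j)) = x (Fin.natAdd n j) := by
    constructor
    · refine fun h => ⟨⟨fun i => ?_, fun j => ?_⟩, fun j => ?_⟩
      · rw [← hyM]
        exact h _ (by rintro ⟨a | a, ha⟩ <;> cases ha)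
      · rw [← hyF]
        exact h _ (by rintro ⟨a | a, ha⟩ <;> cases ha)
      · rw [← hyR]
        refine h _ ?_
        rintro ⟨a | a, ha⟩
        · have h' := congrArg Fin.val (Sum.inl_injective ha)
          simp only [Fin.val_castAdd, Fin.val_natAdd] at h'
          omega
        · cases ha
    · rintro ⟨⟨h1, h2⟩, h3⟩ (w | w | w | w) hw
      · revert hw
        refine Fin.addCases (fun i hw => ?_) (fun i _ => ?_) w
        · exact absurd ⟨.inl i, rfl⟩ hw
        · rw [h3, hyR]
      · exact absurd ⟨.inr w, rfl⟩ hw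
      · rw [h1, hyM]
      · rw [h2, hyF]
  rw [onWires, Matrix.of_apply, hyC]
  by_cases h : ∀ j ∉ Set.range (pairWires m n r), z j = y j
  · rw [if_pos h, if_pos (hiff.mp h), gatesMatrix_eprGates_apply_zero]
    rfl
  · rw [if_neg h, if_neg (mt hiff.mpr h)]

open Classical in
/-- The amplitudes after the attack. -/
theorem attackedInput_apply (U : Op (Qubits m × Qubits r))
    (z : Fin (m + r) ⊕ Side m n → Fin 2) (x : Fin (n + r) → Fin 2) :
    attackedInput m n r (Matrix.reindex (join m r) (join m r) U) z x =
      if SideAgrees z x then pairAmp U (fun j => z (.inl (Fin.natAdd m j)))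
        (fun i => z (pairWires m n r i)) (fun j => x (Fin.natAdd n j)) else 0 := by
  rw [attackedInput, padRight_mul_apply]
  have hs (u : Fin (m + r) → Fin 2) :
      SideAgrees (Sum.elim u fun b => z (.inr b)) x ↔ SideAgrees z x := Iff.rfl
  simp only [eprInput_apply, hs, ite_and, Sum.elim_inl, Sum.elim_inr]
  split_ifs with h
  · have hU (a : Qubits m) (t : Qubits r) : Matrix.reindex (join m r) (join m r) U
        (fun i => z (.inl i)) (join m r (a, t)) =
          U ((fun j => z (.inl (Fin.castAdd r j))), fun j => z (.inl (Fin.natAdd m j))) (a, t) := by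
      change U _ ((join m r).symm (join m r (a, t))) = _
      rw [Equiv.symm_apply_apply]
      rfl
    have hl (a : Qubits m) (t : Qubits r) (j) : join m r (a, t) (Fin.castAdd r j) = a j :=
      Fin.append_left _ _ _
    have hr (a : Qubits m) (t : Qubits r) (j) : join m r (a, t) (Fin.natAdd m j) = t j :=
      Fin.append_right _ _ _
    rw [← (join m r).sum_comp, Fintype.sum_prod_type, pairAmp, Matrix.of_apply,
      kronecker_mul_eprIso, Finset.sum_eq_single fun j => z (.inr (.inl j))]
    · rw [Finset.sum_eq_single fun j => x (Fin.natAdd n j)]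
      · rw [hU, if_pos fun j => hr _ _ j, eprAmp_eq, if_pos, mul_comm]
        · rfl
        · exact funext fun j => hl _ _ j
      · intro t _ ht
        rw [if_neg, mul_zero]
        exact fun h' => ht (funext fun j => (hr _ _ j).symm.trans (h' j))
      · simp
    · intro a _ ha
      refine Finset.sum_eq_zero fun t _ => ?_
      rw [eprAmp_eq, if_neg (c := _ = _), ite_self, mul_zero]
      exact fun h' => ha (funext fun j => (hl _ _ j).symm.trans (congrFun h' j))
    · simp
  · simp

open Classical in
/-- The amplitudes after the Bell measurement has been reduced to one in the computational
basis. -/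
theorem bellGates_mul_attackedInput_apply (U : Op (Qubits m × Qubits r))
    (z : Fin (m + r) ⊕ Side m n → Fin 2) (x : Fin (n + r) → Fin 2) :
    (onWires (pairWires m n r) (gatesMatrix (bellGates m)) *
      attackedInput m n r (Matrix.reindex (join m r) (join m r) U)) z x =
      if SideAgrees z x then branch U (fun i => z (pairWires m n r i))
        (fun j => z (.inl (Fin.natAdd m j))) (fun j => x (Fin.natAdd n j)) else 0 := by
  rw [onWires_mul_apply]
  have hn (w : Fin (m + r) ⊕ Side m n) (hw : ∀ j, w ≠ .inl (Fin.castAdd r j))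
      (hw' : ∀ j, w ≠ .inr (.inl j)) : w ∉ Set.range (pairWires m n r) := by
    rintro ⟨a | a, rfl⟩
    · exact hw a rfl
    · exact hw' a rfl
  have hs (u : Fin m ⊕ Fin m → Fin 2) :
      SideAgrees (Function.extend (pairWires m n r) u z) x ↔ SideAgrees z x := by
    have h1 (i) : Function.extend (pairWires m n r) u z (.inr (.inr i)) = z (.inr (.inr i)) :=
      extend_of_notMem _ _ _ (hn _ (by simp) (by simp))
    simp only [SideAgrees, h1]
  have hR (u : Fin m ⊕ Fin m → Fin 2) (j) : Function.extend (pairWires m n r) u z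
      (.inl (Fin.natAdd m j)) = z (.inl (Fin.natAdd m j)) := by
    refine extend_of_notMem _ _ _ (hn _ (fun i h => ?_) (by simp))
    have h' := congrArg Fin.val (Sum.inl_injective h)
    simp only [Fin.val_castAdd, Fin.val_natAdd] at h'
    omega
  simp only [attackedInput_apply, hs, hR, extend_wire]
  split_ifs with h
  · rw [branch, Matrix.of_apply, Matrix.mul_apply]
  · simp

end Input

/-! ### The choice of the output -/

section Choice
variable (m n r : ℕ)

/-- The map that the classical gates `choiceGates` perform on basis states. -/
def choiceFun (z : Fin n ⊕ (Fin (m + r) ⊕ Side m n) → Fin 2) :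
    Fin n ⊕ (Fin (m + r) ⊕ Side m n) → Fin 2 :=
  swapFun (flagWire m n r (Fin.last _)) (messageWire m n r) (stateWire m n r)
    (andFun (bitWire m n r) (flagWire m n r) z)

theorem gatesMatrix_choiceGates : gatesMatrix (choiceGates m n r) = funMat (choiceFun m n r) := by
  rw [choiceGates, gatesMatrix_append, gatesMatrix_andGates, gatesMatrix_swapGates, funMat_mul]
  rfl

theorem choiceFun_bijective : Function.Bijective (choiceFun m n r) :=
  (swapFun_bijective _ _ _ (messageWire_ne_stateWire m n r) (flagWire_ne_messageWire m n r _)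
    (flagWire_ne_stateWire m n r _)).comp
    (andFun_bijective _ _ (flagWire_injective m n r) (bitWire_ne_flagWire m n r))

variable {m n r}

/-- The basis state with the given values on the wires of `C₁` and `C₂`, of the reference register
and of the message, and with `0` on the flags. -/
def sideLabel (p : Fin m ⊕ Fin m → Fin 2) (s : Fin r → Fin 2) (μ : Fin n → Fin 2) :
    Fin (m + r) ⊕ Side m n → Fin 2 :=
  Sum.elim (Fin.append (fun j => p (.inl j)) s)
    (Sum.elim (fun j => p (.inr j)) (Sum.elim μ fun _ => 0))

theorem sideLabel_pairWires (p : Fin m ⊕ Fin m → Fin 2) (s : Fin r → Fin 2) (μ : Fin n → Fin 2)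
    (i : Fin m ⊕ Fin m) : sideLabel p s μ (pairWires m n r i) = p i := by
  rcases i with i | i
  · exact Fin.append_left (fun j => p (.inl j)) s i
  · rfl

theorem sideLabel_natAdd (p : Fin m ⊕ Fin m → Fin 2) (s : Fin r → Fin 2) (μ : Fin n → Fin 2)
    (j : Fin r) : sideLabel p s μ (.inl (Fin.natAdd m j)) = s j :=
  Fin.append_right (fun j => p (.inl j)) s j

theorem eq_sideLabel {z : Fin (m + r) ⊕ Side m n → Fin 2} (h : ∀ j, z (.inr (.inr (.inr j))) = 0) :
    z = sideLabel (fun i => z (pairWires m n r i)) (fun j => z (.inl (Fin.natAdd m j)))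
      fun i => z (.inr (.inr (.inl i))) := by
  funext w
  rcases w with w | w | w | w
  · refine Fin.addCases (fun i => ?_) (fun i => ?_) w
    · exact (sideLabel_pairWires (fun i => z (pairWires m n r i))
        (fun j => z (.inl (Fin.natAdd m j))) _ (.inl i)).symm
    · exact (sideLabel_natAdd _ (fun j => z (.inl (Fin.natAdd m j))) _ i).symm
  · rfl
  · rfl
  · exact h w

theorem bitWire_ne_reference (i : Fin (m + m)) (j : Fin r) :
    bitWire m n r i ≠ .inr (.inl (Fin.natAdd m j)) := by
  intro h
  rw [bitWire] at h
  generalize finSumFinEquiv.symm i = a at h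
  rcases a with a | a
  · have h1 : (Sum.inl (Fin.castAdd r a) : Fin (m + r) ⊕ Side m n) = .inl (Fin.natAdd m j) :=
      Sum.inr_injective h
    have h2 := congrArg Fin.val (Sum.inl_injective h1)
    simp only [Fin.val_castAdd, Fin.val_natAdd] at h2
    omega
  · cases h

/-- The effect of the classical gates: `p = 0` signals that all pairs were found intact. -/
theorem choiceFun_apply (ω : Fin n → Fin 2) (p : Fin m ⊕ Fin m → Fin 2) (s : Fin r → Fin 2)
    (μ : Fin n → Fin 2) :
    (∀ i, choiceFun m n r (Sum.elim ω (sideLabel p s μ)) (stateWire m n r i) =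
      if p = 0 then μ i else ω i) ∧
    (∀ i, choiceFun m n r (Sum.elim ω (sideLabel p s μ)) (messageWire m n r i) =
      if p = 0 then ω i else μ i) ∧
    (∀ j, choiceFun m n r (Sum.elim ω (sideLabel p s μ)) (.inr (.inl (Fin.natAdd m j))) = s j) ∧
    (∀ i, choiceFun m n r (Sum.elim ω (sideLabel p s μ)) (bitWire m n r i) =
      p (finSumFinEquiv.symm i) + 1) ∧
    (∀ j, choiceFun m n r (Sum.elim ω (sideLabel p s μ)) (flagWire m n r j) =
      if ∀ i : Fin (m + m), i.castSucc < j → p (finSumFinEquiv.symm i) = 0 then 1 else 0) ∧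
    choiceFun m n r (Sum.elim ω (sideLabel p s μ)) (flagWire m n r (Fin.last _)) =
      if p = 0 then 1 else 0 := by
  obtain ⟨h1, h2, h3⟩ := andFun_apply (bitWire m n r) (flagWire m n r) (bitWire_injective m n r)
    (flagWire_injective m n r) (bitWire_ne_flagWire m n r) (Sum.elim ω (sideLabel p s μ))
    (fun j => rfl)
  obtain ⟨g1, g2, g3⟩ := swapFun_apply (flagWire m n r (Fin.last _)) (messageWire m n r)
    (stateWire m n r) (messageWire_ne_stateWire m n r) (flagWire_ne_messageWire m n r _)
    (flagWire_ne_stateWire m n r _) (messageWire_injective m n r) (stateWire_injective m n r)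
    (andFun (bitWire m n r) (flagWire m n r) (Sum.elim ω (sideLabel p s μ)))
  have hbit (i) : (Sum.elim ω (sideLabel p s μ)) (bitWire m n r i) = p (finSumFinEquiv.symm i) :=
    sideLabel_pairWires p s μ _
  simp only [hbit] at h1 h2
  have hbm (i j) : bitWire m n r i ≠ messageWire m n r j := by
    rw [bitWire, messageWire]
    rcases finSumFinEquiv.symm i with a | a <;> exact fun h => by cases h
  have hbs (i j) : bitWire m n r i ≠ stateWire m n r j := Sum.inr_ne_inl
  have hm (i) : andFun (bitWire m n r) (flagWire m n r) (Sum.elim ω (sideLabel p s μ))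
      (messageWire m n r i) = μ i := by
    rw [h3]
    · rfl
    · rintro ⟨j, hj⟩
      exact hbm _ _ hj
    · rintro ⟨j, hj⟩
      exact flagWire_ne_messageWire m n r _ _ hj
  have hst (i) : andFun (bitWire m n r) (flagWire m n r) (Sum.elim ω (sideLabel p s μ))
      (stateWire m n r i) = ω i := by
    rw [h3]
    · rfl
    · rintro ⟨j, hj⟩
      exact hbs _ _ hj
    · rintro ⟨j, hj⟩
      exact flagWire_ne_stateWire m n r _ _ hj
  have hlast : (∀ i : Fin (m + m), i.castSucc < Fin.last (m + m) →
      p (finSumFinEquiv.symm i) = 0) ↔ p = 0 := by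
    constructor
    · intro h
      funext i
      simpa using h (finSumFinEquiv i) (Fin.castSucc_lt_last _)
    · rintro rfl i _
      rfl
  have hacc : andFun (bitWire m n r) (flagWire m n r) (Sum.elim ω (sideLabel p s μ))
      (flagWire m n r (Fin.last _)) = 1 ↔ p = 0 := by
    rw [h2, ← hlast]
    split_ifs with h
    · exact iff_of_true rfl h
    · exact iff_of_false (by decide) h
  simp only [hacc, hm, hst] at g1 g2
  have hflag (j) : choiceFun m n r (Sum.elim ω (sideLabel p s μ)) (flagWire m n r j) =
      if ∀ i : Fin (m + m), i.castSucc < j → p (finSumFinEquiv.symm i) = 0 then 1 else 0 := by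
    refine (g3 _ ?_ ?_).trans (h2 j)
    · rintro ⟨i, hi⟩
      exact flagWire_ne_messageWire m n r _ _ hi.symm
    · rintro ⟨i, hi⟩
      exact flagWire_ne_stateWire m n r _ _ hi.symm
  refine ⟨g2, g1, fun j => ?_, fun i => (g3 _ ?_ ?_).trans (h1 i), hflag,
    (hflag _).trans (ite_congr_decidable hlast)⟩
  · refine (g3 _ ?_ ?_).trans ((h3 _ ?_ ?_).trans (sideLabel_natAdd p s μ j))
    · rintro ⟨i, hi⟩
      cases hi
    · rintro ⟨i, hi⟩
      cases hi
    · rintro ⟨i, hi⟩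
      exact bitWire_ne_reference i j hi
    · rintro ⟨i, hi⟩
      cases hi
  · rintro ⟨j, hj⟩
    exact hbm _ _ hj.symm
  · rintro ⟨j, hj⟩
    exact hbs _ _ hj.symm

theorem idealOut_state (i : Fin n) :
    idealOut m n r (Fin.castAdd 1 (Fin.castAdd r i)) = stateWire m n r i := by
  simp only [idealOut, Function.Embedding.trans_apply, Equiv.coe_toEmbedding, Equiv.trans_apply,
    finSumFinEquiv_symm_apply_castAdd, Equiv.sumCongr_apply, Sum.map_inl]
  rfl

theorem idealOut_reference (j : Fin r) : idealOut m n r (Fin.castAdd 1 (Fin.natAdd n j)) =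
    .inr (.inl (Fin.natAdd m j)) := by
  simp only [idealOut, Function.Embedding.trans_apply, Equiv.coe_toEmbedding, Equiv.trans_apply,
    finSumFinEquiv_symm_apply_castAdd, Equiv.sumCongr_apply, Sum.map_inl,
    finSumFinEquiv_symm_apply_natAdd]
  rfl

theorem idealOut_flag (i : Fin 1) :
    idealOut m n r (Fin.natAdd (n + r) i) = flagWire m n r (Fin.last _) := by
  simp only [idealOut, Function.Embedding.trans_apply, Equiv.coe_toEmbedding, Equiv.trans_apply,
    finSumFinEquiv_symm_apply_natAdd]
  rfl

theorem forall_idealOut {q : Fin (n + r + 1) → Prop} : (∀ i, q i) ↔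
    (∀ i, q (Fin.castAdd 1 (Fin.castAdd r i))) ∧ (∀ j, q (Fin.castAdd 1 (Fin.natAdd n j))) ∧
      q (Fin.natAdd (n + r) 0) := by
  refine ⟨fun h => ⟨fun i => h _, fun j => h _, h _⟩, fun ⟨h1, h2, h3⟩ i => ?_⟩
  refine Fin.addCases (fun i => Fin.addCases h1 h2 i) (fun i => ?_) i
  rwa [Fin.eq_zero i]

/-- The discarded wires are the measured bits, the message register and all flags but the last. -/
theorem notMem_range_idealOut_iff {w : Fin n ⊕ (Fin (m + r) ⊕ Side m n)} :
    w ∉ Set.range (idealOut m n r) ↔ (∃ i, w = bitWire m n r i) ∨ (∃ i, w = messageWire m n r i) ∨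
      ∃ j : Fin (m + m), w = flagWire m n r j.castSucc := by
  constructor
  · intro h
    rcases w with w | w | w | w | w
    · exact absurd ⟨_, idealOut_state w⟩ h
    · revert h
      refine Fin.addCases (fun i _ => ?_) (fun i h => ?_) w
      · refine .inl ⟨finSumFinEquiv (.inl i), ?_⟩
        rw [bitWire, Equiv.symm_apply_apply]
        rfl
      · exact absurd ⟨_, idealOut_reference i⟩ h
    · refine .inl ⟨finSumFinEquiv (.inr w), ?_⟩
      rw [bitWire, Equiv.symm_apply_apply]
      rfl
    · exact .inr (.inl ⟨w, rfl⟩)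
    · revert h
      refine Fin.lastCases (fun h => ?_) (fun j _ => .inr (.inr ⟨j, rfl⟩)) w
      exact absurd ⟨_, idealOut_flag 0⟩ h
  · intro h
    suffices hw : ∀ i, idealOut m n r i ≠ w from fun ⟨i, hi⟩ => hw i hi
    have h1 (i) : stateWire m n r i ≠ w := by
      rcases h with ⟨k, rfl⟩ | ⟨k, rfl⟩ | ⟨k, rfl⟩ <;> exact fun h => by cases h
    have h2 (j) : (.inr (.inl (Fin.natAdd m j)) : Fin n ⊕ (Fin (m + r) ⊕ Side m n)) ≠ w := by
      rcases h with ⟨k, rfl⟩ | ⟨k, rfl⟩ | ⟨k, rfl⟩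
      · exact (bitWire_ne_reference k j).symm
      · exact fun h => by cases h
      · exact fun h => by cases h
    have h3 : flagWire m n r (Fin.last _) ≠ w := by
      rcases h with ⟨k, rfl⟩ | ⟨k, rfl⟩ | ⟨k, rfl⟩
      · exact (bitWire_ne_flagWire m n r _ _).symm
      · exact fun h => by cases h
      · exact (flagWire_injective m n r).ne (Fin.castSucc_lt_last k).ne'
    refine forall_idealOut.mpr ⟨fun i => ?_, fun j => ?_, ?_⟩
    · rw [idealOut_state]
      exact h1 i
    · rw [idealOut_reference]
      exact h2 j
    · rw [idealOut_flag]
      exact h3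

/-- The condition under which the basis states `z`, `w` contribute to the entry `x`, `y` of the
output, if `z` and `w` have flags `0`. -/
theorem choiceFun_agree_iff (x y : Fin (n + r + 1) → Fin 2) (ω ω' : Fin n → Fin 2)
    (p p' : Fin m ⊕ Fin m → Fin 2) (s s' : Fin r → Fin 2) (μ μ' : Fin n → Fin 2) :
    ((∀ i, choiceFun m n r (Sum.elim ω (sideLabel p s μ)) (idealOut m n r i) = x i) ∧
      (∀ i, choiceFun m n r (Sum.elim ω' (sideLabel p' s' μ')) (idealOut m n r i) = y i) ∧
      ∀ j ∉ Set.range (idealOut m n r), choiceFun m n r (Sum.elim ω (sideLabel p s μ)) j =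
        choiceFun m n r (Sum.elim ω' (sideLabel p' s' μ')) j) ↔
    (p = p' ∧ (∀ j, s j = x (Fin.castAdd 1 (Fin.natAdd n j))) ∧
      (∀ j, s' j = y (Fin.castAdd 1 (Fin.natAdd n j)))) ∧
      if p = 0 then (∀ i, μ i = x (Fin.castAdd 1 (Fin.castAdd r i))) ∧
        (∀ i, μ' i = y (Fin.castAdd 1 (Fin.castAdd r i))) ∧ ω = ω' ∧
        x (Fin.natAdd (n + r) 0) = 1 ∧ y (Fin.natAdd (n + r) 0) = 1
      else (∀ i, ω i = x (Fin.castAdd 1 (Fin.castAdd r i))) ∧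
        (∀ i, ω' i = y (Fin.castAdd 1 (Fin.castAdd r i))) ∧ μ = μ' ∧
        x (Fin.natAdd (n + r) 0) = 0 ∧ y (Fin.natAdd (n + r) 0) = 0 := by
  obtain ⟨a1, a2, a3, a4, a5, a6⟩ := choiceFun_apply ω p s μ
  obtain ⟨b1, b2, b3, b4, b5, b6⟩ := choiceFun_apply ω' p' s' μ'
  have hoff : (∀ j ∉ Set.range (idealOut m n r), choiceFun m n r (Sum.elim ω (sideLabel p s μ)) j =
      choiceFun m n r (Sum.elim ω' (sideLabel p' s' μ')) j) ↔
      p = p' ∧ ∀ i, (if p = 0 then ω i else μ i) = if p' = 0 then ω' i else μ' i := by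
    simp only [notMem_range_idealOut_iff]
    constructor
    · intro h
      refine ⟨funext fun i => ?_, fun i => ?_⟩
      · have := h _ (.inl ⟨finSumFinEquiv i, rfl⟩)
        rw [a4, b4, Equiv.symm_apply_apply] at this
        exact add_right_cancel this
      · have := h _ (.inr (.inl ⟨i, rfl⟩))
        rwa [a2, b2] at this
    · rintro ⟨rfl, h⟩ j (⟨i, rfl⟩ | ⟨i, rfl⟩ | ⟨i, rfl⟩)
      · rw [a4, b4]
      · rw [a2, b2, h]
      · rw [a5, b5]
  rw [hoff, forall_idealOut, forall_idealOut]
  simp only [idealOut_state, idealOut_reference, idealOut_flag, a1, a3, a6, b1, b3, b6]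
  by_cases hpp : p = p'
  · subst hpp
    by_cases hp : p = 0
    · simp only [hp, if_true, true_and, ← funext_iff]
      constructor
      · rintro ⟨⟨h1, h2, h3⟩, ⟨h4, h5, h6⟩, h7⟩
        exact ⟨⟨h2, h5⟩, h1, h4, h7, h3.symm, h6.symm⟩
      · rintro ⟨⟨h2, h5⟩, h1, h4, h7, h3, h6⟩
        exact ⟨⟨h1, h2, h3.symm⟩, ⟨h4, h5, h6.symm⟩, h7⟩
    · simp only [hp, if_false, true_and, ← funext_iff]
      constructor
      · rintro ⟨⟨h1, h2, h3⟩, ⟨h4, h5, h6⟩, h7⟩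
        exact ⟨⟨h2, h5⟩, h1, h4, h7, h3.symm, h6.symm⟩
      · rintro ⟨⟨h2, h5⟩, h1, h4, h7, h3, h6⟩
        exact ⟨⟨h1, h2, h3.symm⟩, ⟨h4, h5, h6.symm⟩, h7⟩
  · simp only [hpp, false_and, and_false]

end Choice

section Attach
set_option linter.unusedSectionVars false

variable {A B C : Type} [Fintype A] [Fintype B] [Fintype C] [DecidableEq A] [DecidableEq B]
  [DecidableEq C]

theorem attach_conjTranspose (Ω : Op (A → Fin 2)) (Z : Op (B → Fin 2)) :
    (attach Ω Z)ᴴ = attach Ωᴴ Zᴴ := by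
  ext u v
  simp [attach_apply, Matrix.conjTranspose_apply]

theorem onWires_inr_mul_attach (Ω : Op (A → Fin 2)) (M Z : Op (B → Fin 2)) :
    onWires (Function.Embedding.inr : B ↪ A ⊕ B) M * attach Ω Z = attach Ω (M * Z) := by
  ext z t
  rw [onWires_mul_apply, attach_apply, Matrix.mul_apply, Finset.mul_sum]
  refine Finset.sum_congr rfl fun u _ => ?_
  have h : Function.extend (Function.Embedding.inr : B ↪ A ⊕ B) u z =
      Sum.elim (fun a => z (.inl a)) u := by
    symm
    rw [eq_extend_iff]
    refine ⟨fun _ => rfl, ?_⟩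
    rintro (a | b) hj
    · rfl
    · exact absurd ⟨b, rfl⟩ hj
  rw [h, attach_apply]
  simp only [Sum.elim_inl, Sum.elim_inr, Function.Embedding.inr_apply]
  ring

/-- Operators on the second factor of a tensor product. -/
theorem attach_conj (Ω : Op (A → Fin 2)) (g : C ↪ B) (M : Op (C → Fin 2)) (Z : Op (B → Fin 2)) :
    onWires (g.trans (Function.Embedding.inr : B ↪ A ⊕ B)) M * attach Ω Z *
      (onWires (g.trans (Function.Embedding.inr : B ↪ A ⊕ B)) M)ᴴ =
      attach Ω (onWires g M * Z * (onWires g M)ᴴ) := by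
  rw [← onWires_onWires, onWires_inr_mul_attach]
  have h := congrArg Matrix.conjTranspose
    (onWires_inr_mul_attach Ωᴴ (onWires g M) (onWires g M * Z)ᴴ)
  rw [Matrix.conjTranspose_mul, ← attach_conjTranspose, Matrix.conjTranspose_conjTranspose,
    attach_conjTranspose, Matrix.conjTranspose_conjTranspose, Matrix.conjTranspose_mul,
    Matrix.conjTranspose_conjTranspose] at h
  exact h

end Attach

section Final
variable {m n r : ℕ}

open Classical in
/-- The output of the circuit, sorted by the outcome `p` of the Bell measurement. The index `a` is
the basis state of the register that is discarded: the one that carried the fixed state in case of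
acceptance, and the message in case of rejection. -/
theorem traceWires_choice (Ω : Op (Fin n → Fin 2)) (Y : Op (Fin (m + r) ⊕ Side m n → Fin 2))
    (hY : ∀ z w, Y z w ≠ 0 →
      (∀ j, z (.inr (.inr (.inr j))) = 0) ∧ ∀ j, w (.inr (.inr (.inr j))) = 0)
    (xM yM : Fin n → Fin 2) (xR yR : Fin r → Fin 2) (xF yF : Fin 1 → Fin 2) :
    traceWires (idealOut m n r) (funMat (choiceFun m n r) * attach Ω Y *
      (funMat (choiceFun m n r))ᴴ) (Fin.append (Fin.append xM xR) xF)
        (Fin.append (Fin.append yM yR) yF) =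
      ∑ p, ∑ a, if p = 0 then
        if xF 0 = 1 ∧ yF 0 = 1 then Ω a a * Y (sideLabel p xR xM) (sideLabel p yR yM) else 0
      else if xF 0 = 0 ∧ yF 0 = 0 then Ω xM yM * Y (sideLabel p xR a) (sideLabel p yR a)
      else 0 := by
  rw [traceWires_funMat (choiceFun_bijective m n r)]
  set G : (Fin m ⊕ Fin m → Fin 2) → (Fin n → Fin 2) → ℂ := fun p a => if p = 0 then
      if xF 0 = 1 ∧ yF 0 = 1 then Ω a a * Y (sideLabel p xR xM) (sideLabel p yR yM) else 0
    else if xF 0 = 0 ∧ yF 0 = 0 then Ω xM yM * Y (sideLabel p xR a) (sideLabel p yR a)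
    else 0 with hG
  set φ := choiceFun m n r with hφ
  set F : (Fin n ⊕ (Fin (m + r) ⊕ Side m n) → Fin 2) →
      (Fin n ⊕ (Fin (m + r) ⊕ Side m n) → Fin 2) → ℂ := fun w z =>
    if (∀ i, φ z (idealOut m n r i) = Fin.append (Fin.append xM xR) xF i) ∧
      (∀ i, φ w (idealOut m n r i) = Fin.append (Fin.append yM yR) yF i) ∧
      ∀ j ∉ Set.range (idealOut m n r), φ z j = φ w j then attach Ω Y z w else 0 with hF
  refine Eq.trans (b := ∑ w, ∑ z, F w z) (Finset.sum_congr rfl fun w _ =>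
    Finset.sum_congr rfl fun z _ => ite_congr_decidable Iff.rfl) ?_
  change _ = ∑ p, ∑ a, G p a
  -- the pairs of basis states that contribute: the outcome `p` and the discarded register determine them
  set e : (Fin m ⊕ Fin m → Fin 2) × (Fin n → Fin 2) →
      (Fin n ⊕ (Fin (m + r) ⊕ Side m n) → Fin 2) × (Fin n ⊕ (Fin (m + r) ⊕ Side m n) → Fin 2) :=
    fun q =>
      (Sum.elim (if q.1 = 0 then q.2 else yM) (sideLabel q.1 yR (if q.1 = 0 then yM else q.2)),
        Sum.elim (if q.1 = 0 then q.2 else xM) (sideLabel q.1 xR (if q.1 = 0 then xM else q.2)))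
    with he
  have hinj : Function.Injective e := by
    rintro ⟨p, a⟩ ⟨p', a'⟩ h
    have h1 := congrArg Prod.fst h
    have hp : p = p' := by
      funext i
      have := congrFun h1 (.inr (pairWires m n r i))
      simpa only [he, Sum.elim_inr, sideLabel_pairWires] using this
    subst hp
    congr 1
    funext i
    by_cases hp : p = 0
    · have := congrFun h1 (.inl i)
      simpa only [he, Sum.elim_inl, hp, if_true] using this
    · have := congrFun h1 (.inr (.inr (.inr (.inl i))))
      simpa [he, hp, sideLabel] using this
  -- all other pairs have a nonzero flag, do not match the entry, or differ on a discarded wire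
  have h0 : ∀ q ∉ Set.range e, F q.1 q.2 = 0 := by
    rintro ⟨w, z⟩ hwz
    by_contra hne
    simp only [hF] at hne
    rw [ite_eq_right_iff, Classical.not_imp] at hne
    obtain ⟨hc, hne⟩ := hne
    rw [attach_apply] at hne
    obtain ⟨hz, hw⟩ := hY _ _ (right_ne_zero_of_mul hne)
    refine hwz ?_
    have hz' := eq_sideLabel (z := fun b => z (.inr b)) hz
    have hw' := eq_sideLabel (z := fun b => w (.inr b)) hw
    have hz2 : z = Sum.elim (fun i => z (.inl i)) fun i => z (.inr i) :=
      (Sum.elim_comp_inl_inr z).symm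
    have hw2 : w = Sum.elim (fun i => w (.inl i)) fun i => w (.inr i) :=
      (Sum.elim_comp_inl_inr w).symm
    rw [hz'] at hz2
    rw [hw'] at hw2
    have hc' := hc
    rw [hz2, hw2] at hc'
    obtain ⟨⟨hp, hxR, hyR⟩, hif⟩ := (choiceFun_agree_iff _ _ _ _ _ _ _ _ _ _).mp hc'
    simp only [Fin.append_left, Fin.append_right] at hxR hyR hif
    by_cases h0 : (fun i => z (.inr (pairWires m n r i))) = 0
    · rw [if_pos h0] at hif
      obtain ⟨h1, h2, h3, -, -⟩ := hif
      refine ⟨(0, fun i => z (.inl i)), ?_⟩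
      rw [hz2, hw2, ← hp, h0, ← h3, funext h1, funext h2, funext hxR, funext hyR]
      simp [he]
    · rw [if_neg h0] at hif
      obtain ⟨h1, h2, h3, -, -⟩ := hif
      refine ⟨(fun i => z (.inr (pairWires m n r i)), fun i => z (.inr (.inr (.inr (.inl i))))), ?_⟩
      simp only [he, if_neg h0]
      refine Prod.ext ?_ ?_
      · rw [hw2, ← hp, ← h3, funext h2, funext hyR]
      · rw [← funext h1, ← funext hxR]
        exact hz2.symm
  have h1 : ∀ q, G q.1 q.2 = F (e q).1 (e q).2 := by
    rintro ⟨p, a⟩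
    have hiff := choiceFun_agree_iff (Fin.append (Fin.append xM xR) xF)
      (Fin.append (Fin.append yM yR) yF) (if p = 0 then a else xM) (if p = 0 then a else yM) p p
      xR yR (if p = 0 then xM else a) (if p = 0 then yM else a)
    simp only [Fin.append_left, Fin.append_right, implies_true, and_true, true_and] at hiff
    simp only [hF, hG]
    refine Eq.trans ?_ (ite_congr_decidable (hq := Classical.propDecidable _) hiff).symm
    by_cases hp : p = 0
    · simp only [he, hp, if_true, implies_true, true_and]
      rfl
    · simp only [he, hp, if_false, implies_true, true_and]
      rfl
  have h2 := Fintype.sum_of_injective e hinj (fun q => G q.1 q.2) (fun q => F q.1 q.2) h0 h1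
  rw [← Fintype.sum_prod_type' F, ← Fintype.sum_prod_type' G]
  convert h2.symm using 2
  exact Finset.ext fun q => by simp

/-- The state after the Bell measurement has been reduced to one in the computational basis: the
blocks of the message pass unchanged, and the reference register undergoes the branches of the
attack. -/
theorem measured_apply (U : Op (Qubits m × Qubits r)) (X : Op (Qubits (n + r)))
    (p p' : Fin m ⊕ Fin m → Fin 2) (s s' : Qubits r) (μ μ' : Qubits n) :
    ((onWires (pairWires m n r) (gatesMatrix (bellGates m)) *
      attackedInput m n r (Matrix.reindex (join m r) (join m r) U)) * X *
      (onWires (pairWires m n r) (gatesMatrix (bellGates m)) *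
        attackedInput m n r (Matrix.reindex (join m r) (join m r) U))ᴴ)
      (sideLabel p s μ) (sideLabel p' s' μ') =
    (branch U p * (Matrix.of fun t t' => X (join n r (μ, t)) (join n r (μ', t'))) *
      (branch U p')ᴴ) s s' := by
  classical
  set Θ := onWires (pairWires m n r) (gatesMatrix (bellGates m)) *
    attackedInput m n r (Matrix.reindex (join m r) (join m r) U) with hΘ
  -- the row of `Θ` that belongs to the message `μ` is nonzero only at inputs with the message `μ`
  have hrow {T : Type} (Z : Matrix (Qubits (n + r)) T ℂ) (p : Fin m ⊕ Fin m → Fin 2)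
      (s : Qubits r) (μ : Qubits n) (c : T) : (Θ * Z) (sideLabel p s μ) c =
        ∑ t, branch U p s t * Z (join n r (μ, t)) c := by
    have hl (a : Qubits n) (t : Qubits r) (j) : join n r (a, t) (Fin.castAdd r j) = a j :=
      Fin.append_left _ _ _
    have hr (a : Qubits n) (t : Qubits r) (j) : join n r (a, t) (Fin.natAdd n j) = t j :=
      Fin.append_right _ _ _
    have hent (a : Qubits n) (t : Qubits r) : Θ (sideLabel p s μ) (join n r (a, t)) =
        if a = μ then branch U p s t else 0 := by
      rw [hΘ, bellGates_mul_attackedInput_apply]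
      have h1 : SideAgrees (sideLabel p s μ) (join n r (a, t)) ↔ a = μ := by
        simp only [SideAgrees, hl]
        exact ⟨fun h => funext fun i => (h.1 i).symm,
          fun h => ⟨fun i => (congrFun h i).symm, fun j => rfl⟩⟩
      simp only [h1, sideLabel_pairWires, sideLabel_natAdd, hr]
    rw [Matrix.mul_apply, ← (join n r).sum_comp, Fintype.sum_prod_type,
      Finset.sum_eq_single μ]
    · simp only [hent, if_true]
    · intro a _ ha
      refine Finset.sum_eq_zero fun t _ => ?_
      rw [hent, if_neg ha, zero_mul]
    · simp
  rw [Matrix.mul_assoc, hrow, Matrix.mul_assoc, Matrix.mul_apply]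
  refine Finset.sum_congr rfl fun t _ => ?_
  congr 1
  have h := congrArg star (hrow Xᴴ p' s' μ' (join n r (μ, t)))
  rw [← Matrix.conjTranspose_apply, Matrix.conjTranspose_mul,
    Matrix.conjTranspose_conjTranspose] at h
  rw [h, star_sum, Matrix.mul_apply]
  refine Finset.sum_congr rfl fun t' _ => ?_
  simp [Matrix.conjTranspose_apply, mul_comm]

open Classical in
/-- The entries of the ideal channel, sorted by the flag. -/
theorem idealMap_apply (Ω : Op (Qubits n)) (acc rej : Op (Qubits r) → Op (Qubits r))
    (hrej : IsLinearMap ℂ rej) (X : Op (Qubits (n + r)))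
    (xM yM : Qubits n) (xR yR : Qubits r) (xF yF : Flag) :
    idealMap Ω acc rej X (Fin.append (Fin.append xM xR) xF) (Fin.append (Fin.append yM yR) yF) =
      (if xF 0 = 1 ∧ yF 0 = 1 then
        acc (Matrix.of fun t t' => X (join n r (xM, t)) (join n r (yM, t'))) xR yR else 0) +
      if xF 0 = 0 ∧ yF 0 = 0 then Ω xM yM *
        rej (∑ a, Matrix.of fun t t' => X (join n r (a, t)) (join n r (a, t'))) xR yR else 0 := by
  have hx (xM : Qubits n) (xR : Qubits r) (xF : Flag) :
      (((join n r).prodCongr (Equiv.refl Flag)).trans (join (n + r) 1)).symm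
        (Fin.append (Fin.append xM xR) xF) = ((xM, xR), xF) := by
    rw [Equiv.symm_apply_eq]
    rfl
  set X' : Op (Qubits n × Qubits r) := Matrix.reindex (join n r).symm (join n r).symm X with hX'
  have hentry : idealMap Ω acc rej X (Fin.append (Fin.append xM xR) xF)
      (Fin.append (Fin.append yM yR) yF) =
      ideal Ω acc rej X' ((xM, xR), xF) ((yM, yR), yF) := by
    rw [← hx xM xR xF, ← hx yM yR yF]
    rfl
  have hflag (c : Fin 2) (f g : Flag) : proj (fun _ => c) f g =
      if f 0 = c ∧ g 0 = c then (1 : ℂ) else 0 := by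
    rw [proj, Matrix.single_apply]
    have h (f : Flag) : (fun _ => c) = f ↔ f 0 = c := by
      refine ⟨fun h => by rw [← h], fun h => funext fun i => ?_⟩
      rw [Fin.eq_zero i, h]
    rw [if_congr (and_congr (h f) (h g)) rfl rfl]
  have hrej' : traceFst (onRight (Qubits n) rej X') =
      rej (∑ a, Matrix.of fun t t' => X (join n r (a, t)) (join n r (a, t'))) := by
    rw [traceFst_onRight hrej]
    congr 1
    ext t t'
    simp only [traceFst, Matrix.of_apply, Matrix.sum_apply]
    rfl
  rw [hentry, ideal, hrej', Matrix.add_apply, Matrix.kroneckerMap_apply, Matrix.kroneckerMap_apply,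
    Matrix.kroneckerMap_apply]
  simp only [accept, reject, hflag, mul_ite, mul_one, mul_zero]
  rfl

/-- The final gates, applied to the attacked pairs and the fixed state, perform the ideal channel:
they accept for the outcome `0` of the measurement, and reject for all others. -/
theorem traceWires_finalGates (Ω : Op (Qubits n)) (hΩ : Ω.trace = 1)
    (U : Matrix.unitaryGroup (Qubits m × Qubits r) ℂ) (X : Op (Qubits (n + r))) :
    traceWires (idealOut m n r) (gatesMatrix (finalGates m n r) *
      attach Ω (attackedInput m n r (Matrix.reindex (join m r) (join m r) U.1) * X *
        (attackedInput m n r (Matrix.reindex (join m r) (join m r) U.1))ᴴ) *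
      (gatesMatrix (finalGates m n r))ᴴ) = idealMap Ω (simAcc U) (simRej U) X := by
  classical
  rw [finalGates, gatesMatrix_append, gatesMatrix_map, gatesMatrix_choiceGates, conj_conj,
    attach_conj, ← conj_conj]
  set Θ := onWires (pairWires m n r) (gatesMatrix (bellGates m)) *
    attackedInput m n r (Matrix.reindex (join m r) (join m r) U.1) with hΘ
  -- the flags have not been touched so far
  have hY (z w : Fin (m + r) ⊕ Side m n → Fin 2) (h : (Θ * X * Θᴴ) z w ≠ 0) :
      (∀ j, z (.inr (.inr (.inr j))) = 0) ∧ ∀ j, w (.inr (.inr (.inr j))) = 0 := by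
    have h0 (z : Fin (m + r) ⊕ Side m n → Fin 2) (hz : ¬∀ j, z (.inr (.inr (.inr j))) = 0) (x) :
        Θ z x = 0 := by
      rw [hΘ, bellGates_mul_attackedInput_apply, if_neg fun h' => hz h'.2]
    constructor
    · by_contra hz
      refine h ?_
      rw [Matrix.mul_assoc, Matrix.mul_apply]
      exact Finset.sum_eq_zero fun x _ => by rw [h0 z hz, zero_mul]
    · by_contra hw
      refine h ?_
      rw [Matrix.mul_apply]
      exact Finset.sum_eq_zero fun x _ => by
        rw [Matrix.conjTranspose_apply, h0 w hw, star_zero, mul_zero]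
  ext x y
  obtain ⟨⟨⟨xM, xR⟩, xF⟩, rfl⟩ :=
    (((join n r).prodCongr (Equiv.refl Flag)).trans (join (n + r) 1)).surjective x
  obtain ⟨⟨⟨yM, yR⟩, yF⟩, rfl⟩ :=
    (((join n r).prodCongr (Equiv.refl Flag)).trans (join (n + r) 1)).surjective y
  have hrej : IsLinearMap ℂ (simRej U) := (isSimulator U).2.1.1
  refine (traceWires_choice Ω _ hY xM yM xR yR xF yF).trans
    (Eq.trans ?_ (idealMap_apply Ω (simAcc U) (simRej U) hrej X xM yM xR yR xF yF).symm)
  simp only [hΘ, measured_apply]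
  rw [← Finset.add_sum_erase _ _ (Finset.mem_univ (0 : Fin m ⊕ Fin m → Fin 2))]
  congr 1
  · simp only [if_true, branch_zero, ← simAcc_eq]
    split_ifs
    · rw [← Finset.sum_mul]
      change Ω.trace * _ = _
      rw [hΩ, one_mul]
    · simp
  · have h1 (p : Fin m ⊕ Fin m → Fin 2) (hp : p ∈ Finset.univ.erase 0) : p ≠ 0 :=
      Finset.ne_of_mem_erase hp
    rw [Finset.sum_congr rfl fun p hp => Finset.sum_congr rfl fun a _ => if_neg (h1 p hp)]
    split_ifs
    · simp only [← Finset.mul_sum]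
      congr 1
      have h2 (p : Fin m ⊕ Fin m → Fin 2) : ∑ a, (branch U.1 p *
          (Matrix.of fun t t' => X (join n r (a, t)) (join n r (a, t'))) * (branch U.1 p)ᴴ) xR yR =
          (branch U.1 p * (∑ a, Matrix.of fun t t' => X (join n r (a, t)) (join n r (a, t'))) *
            (branch U.1 p)ᴴ) xR yR := by
        rw [Matrix.mul_sum, Matrix.sum_mul, Matrix.sum_apply]
      simp only [h2]
      rw [simRej_eq_sub, simAcc_eq, ← sum_branch_conj, ← branch_zero, Matrix.sub_apply,
        Matrix.sum_apply,
        ← Finset.add_sum_erase _ _ (Finset.mem_univ (0 : Fin m ⊕ Fin m → Fin 2)),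
        add_sub_cancel_left]
    · simp

end Final

/-! ### Descriptions of gates on numbered wires -/

section Codes
variable {A W : Type}

/-- The description of a list of gates, where `ν` numbers the wires. -/
def gatesCode (ν : W → ℕ) (l : List (WGate W)) : List Sym :=
  l.flatMap fun g => .gate g.kind :: encodeList (List.ofFn fun i => ν (g.wires i))

theorem gatesCode_append (ν : W → ℕ) (l l' : List (WGate W)) :
    gatesCode ν (l ++ l') = gatesCode ν l ++ gatesCode ν l' := List.flatMap_append

theorem gatesCode_cons (ν : W → ℕ) (g : WGate W) (l : List (WGate W)) :
    gatesCode ν (g :: l) = gatesCode ν [g] ++ gatesCode ν l := gatesCode_append ν [g] l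

theorem gatesCode_map (ν : W → ℕ) (f : A ↪ W) (l : List (WGate A)) :
    gatesCode ν (l.map (WGate.map f)) = gatesCode (fun a => ν (f a)) l := List.flatMap_map _ _ _

theorem gatesCode_flatMap {ι : Type} (ν : W → ℕ) (L : ι → List (WGate W)) (S : List ι) :
    gatesCode ν (S.flatMap L) = S.flatMap fun j => gatesCode ν (L j) := List.flatMap_assoc

theorem gatesCode_hadamardGate (ν : W → ℕ) (t : W) :
    gatesCode ν [hadamardGate t] = .gate .hadamard :: encodeNat (ν t) := by
  change Sym.gate .hadamard :: encodeList (List.ofFn (n := 1) fun i => ν (wire1 t i)) ++ [] = _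
  rw [show (fun i => ν (wire1 t i)) = fun i => ν (![t] i) from rfl]
  simp [encodeList]

theorem gatesCode_notGate (ν : W → ℕ) (t : W) :
    gatesCode ν [notGate t] = .gate .not :: encodeNat (ν t) := by
  change Sym.gate .not :: encodeList (List.ofFn (n := 1) fun i => ν (wire1 t i)) ++ [] = _
  rw [show (fun i => ν (wire1 t i)) = fun i => ν (![t] i) from rfl]
  simp [encodeList]

theorem gatesCode_cnotGate (ν : W → ℕ) (c t : W) (h : c ≠ t) :
    gatesCode ν [cnotGate c t h] = .gate .cnot :: (encodeNat (ν c) ++ encodeNat (ν t)) := by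
  change Sym.gate .cnot :: encodeList (List.ofFn (n := 2) fun i => ν (wire2 c t h i)) ++ [] = _
  rw [show (fun i => ν (wire2 c t h i)) = fun i => ν (![c, t] i) from rfl]
  simp [encodeList]

theorem gatesCode_toffoliGate (ν : W → ℕ) (c c' t : W) (h : c ≠ c') (h1 : c ≠ t) (h2 : c' ≠ t) :
    gatesCode ν [toffoliGate c c' t h h1 h2] =
      .gate .toffoli :: (encodeNat (ν c) ++ encodeNat (ν c') ++ encodeNat (ν t)) := by
  change Sym.gate .toffoli ::
    encodeList (List.ofFn (n := 3) fun i => ν (wire3 c c' t h h1 h2 i)) ++ [] = _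
  rw [show (fun i => ν (wire3 c c' t h h1 h2 i)) = fun i => ν (![c, c', t] i) from rfl]
  simp [encodeList]

theorem encodeList_append (l l' : List ℕ) : encodeList (l ++ l') = encodeList l ++ encodeList l' :=
  List.flatMap_append

theorem encodeList_ofFn_add {a b : ℕ} (f : Fin (a + b) → ℕ) :
    encodeList (List.ofFn f) = encodeList (List.ofFn fun i => f (Fin.castAdd b i)) ++
      encodeList (List.ofFn fun j => f (Fin.natAdd a j)) := by
  rw [List.ofFn_add, encodeList_append]
  rfl

theorem encodeWires_eq {a N : ℕ} (w : Fin a ↪ Fin N) :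
    encodeWires w = encodeList (List.ofFn fun i => (w i : ℕ)) := by
  rw [encodeWires, encodeList, List.flatMap_def, List.map_ofFn]
  rfl

theorem Circuit.encode_eq {a b : ℕ} (Q : Circuit a b) :
    Q.encode = unary Q.N ++ .sep :: (encodeList (List.ofFn fun i => (Q.input i : ℕ)) ++
      .mark :: (gatesCode (fun w : Fin Q.N => (w : ℕ)) (Q.gates.map Gate.toWGate) ++
        .mark :: (encodeList (List.ofFn fun i => (Q.output i : ℕ)) ++ [.mark]))) := by
  have h : gatesCode (fun w : Fin Q.N => (w : ℕ)) (Q.gates.map Gate.toWGate) =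
      (Q.gates.map fun g => Sym.gate g.kind :: encodeWires g.wires).flatten := by
    rw [gatesCode, List.flatMap_map, List.flatMap_def]
    simp only [encodeWires_eq]
    rfl
  rw [h, Circuit.encode, encodeWires_eq, encodeWires_eq, encodeNat]
  simp only [List.append_assoc, List.cons_append, List.nil_append]

theorem circuitOf_encode {a b N : ℕ} (e : W ≃ Fin N) (input : Fin a ↪ W) (gates : List (WGate W))
    (output : Fin b ↪ W) : (circuitOf e input gates output).encode =
      unary N ++ .sep :: (encodeList (List.ofFn fun i => (e (input i) : ℕ)) ++
        .mark :: (gatesCode (fun w => (e w : ℕ)) gates ++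
          .mark :: (encodeList (List.ofFn fun i => (e (output i) : ℕ)) ++ [.mark]))) := by
  rw [Circuit.encode_eq]
  have h : (circuitOf e input gates output).gates.map Gate.toWGate =
      gates.map (WGate.map e.toEmbedding) := by
    exact List.map_map
  rw [h]
  change unary N ++ .sep :: (encodeList (List.ofFn fun i => (e (input i) : ℕ)) ++
    .mark :: (gatesCode (fun w : Fin N => (w : ℕ)) (gates.map (WGate.map e.toEmbedding)) ++
      .mark :: (encodeList (List.ofFn fun i => (e (output i) : ℕ)) ++ [.mark]))) = _
  rw [gatesCode_map]
  rfl

theorem mem_encodeList {a : Sym} {l : List ℕ} (h : a ∈ encodeList l) : a = .one ∨ a = .sep := by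
  obtain ⟨i, -, hi⟩ := List.mem_flatMap.mp h
  rw [encodeNat, List.mem_append, List.mem_singleton] at hi
  exact hi.imp List.eq_of_mem_replicate id

theorem mark_notMem_encodeList (l : List ℕ) : Sym.mark ∉ encodeList l := fun h => by
  rcases mem_encodeList h with h | h <;> cases h

theorem mark_notMem_gatesCode (ν : W → ℕ) (l : List (WGate W)) : Sym.mark ∉ gatesCode ν l := by
  intro h
  obtain ⟨g, -, hg⟩ := List.mem_flatMap.mp h
  rcases List.mem_cons.mp hg with h | h
  · cases h
  · exact mark_notMem_encodeList _ h

theorem substWord_append (a : Sym) (g w w' : List Sym) :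
    substWord a g (w ++ w') = substWord a g w ++ substWord a g w' := List.flatMap_append

theorem substWord_eq_self {a : Sym} {g w : List Sym} (h : a ∉ w) : substWord a g w = w := by
  induction w with
  | nil => rfl
  | cons b w ih =>
    rw [List.mem_cons, not_or] at h
    rw [substWord, List.flatMap_cons, if_neg (Ne.symm h.1), ← substWord, ih h.2]
    rfl

theorem unary_add (i j : ℕ) : unary (i + j) = unary i ++ unary j := List.replicate_add _ _ _

/-- Adding `o` to all wires amounts to a replacement of the end markers. -/
theorem substWord_encodeList (o : ℕ) (l : List ℕ) :
    substWord .sep (unary o ++ [.sep]) (encodeList l) = encodeList (l.map (· + o)) := by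
  induction l with
  | nil => rfl
  | cons i l ih =>
    have h : Sym.sep ∉ unary i := fun h => by cases List.eq_of_mem_replicate h
    rw [encodeList_cons, List.map_cons, encodeList_cons, substWord_append, substWord_eq_self h,
      ← ih, unary_add]
    simp [substWord]

/-- The renumbering of the wires of a circuit, as in `substWord_encodeList`: the end marker occurs
only after a wire. -/
theorem substWord_gatesCode (o : ℕ) (ν : W → ℕ) (l : List (WGate W)) :
    substWord .sep (unary o ++ [.sep]) (gatesCode ν l) = gatesCode (fun w => ν w + o) l := by
  induction l with
  | nil => rfl
  | cons g l ih =>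
    rw [gatesCode_cons, gatesCode_cons (fun w => ν w + o), substWord_append, ih]
    congr 1
    change substWord _ _ ([Sym.gate g.kind] ++ encodeList _ ++ []) =
      [Sym.gate g.kind] ++ encodeList _ ++ []
    rw [List.append_nil, List.append_nil, substWord_append, substWord_encodeList, List.map_ofFn,
      substWord_eq_self (by simp)]
    rfl

/-- Repeating a wire amounts to a replacement of the symbols of `1 ^ n`. -/
theorem substWord_unary (c n : ℕ) :
    substWord .one (encodeNat c) (unary n) = encodeList (List.ofFn fun _ : Fin n => c) := by
  rw [List.ofFn_const]
  induction n with
  | zero => rfl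
  | succ n ih =>
    rw [Nat.add_comm, unary_add, substWord_append, ih, Nat.add_comm, List.replicate_succ,
      encodeList_cons]
    simp [substWord, unary, encodeNat]

theorem ofFn_add_eq_range' (o k : ℕ) : (List.ofFn fun i : Fin k => o + (i : ℕ)) = List.range' o k := by
  refine List.ext_getElem (by simp) fun i h1 h2 => ?_
  simp

end Codes

/-! ### Words that are computable in polynomial time -/

theorem PolyTimeComputable.congr {f g : ℕ → List Sym} (hf : PolyTimeComputable f)
    (h : ∀ n, f n = g n) : PolyTimeComputable g := funext h ▸ hf

/-- The parts of the descriptions of a uniform family of circuits. -/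
theorem PolyTimeComputable.circuit {a b : ℕ → ℕ} {Q : ∀ n, Circuit (a n) (b n)}
    (h : PolyTimeComputable fun n => (Q n).encode) :
    (PolyTimeComputable fun n => unary (Q n).N) ∧
    (PolyTimeComputable fun n => encodeList (List.ofFn fun i => ((Q n).input i : ℕ))) ∧
    (PolyTimeComputable fun n =>
      gatesCode (fun w : Fin (Q n).N => (w : ℕ)) ((Q n).gates.map Gate.toWGate)) ∧
    PolyTimeComputable fun n => encodeList (List.ofFn fun i => ((Q n).output i : ℕ)) := by
  have hsep (i : ℕ) : Sym.sep ∉ unary i := fun h => by cases List.eq_of_mem_replicate h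
  have h0 := h.congr fun n => (Q n).encode_eq
  have h1 := h0.dropThrough .sep (fun _ => hsep _) fun n => rfl
  have h2 := h1.dropThrough .mark (fun _ => mark_notMem_encodeList _) fun n => rfl
  have h3 := h2.dropThrough .mark (fun _ => mark_notMem_gatesCode _ _) fun n => rfl
  exact ⟨h0.takeUntil .sep (fun _ => hsep _) fun n => rfl,
    h1.takeUntil .mark (fun _ => mark_notMem_encodeList _) fun n => rfl,
    h2.takeUntil .mark (fun _ => mark_notMem_gatesCode _ _) fun n => rfl,
    h3.takeUntil .mark (fun _ => mark_notMem_encodeList _) fun n => rfl⟩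

theorem PolyTimeComputable.unary_add {a b : ℕ → ℕ} (ha : PolyTimeComputable fun n => unary (a n))
    (hb : PolyTimeComputable fun n => unary (b n)) :
    PolyTimeComputable fun n => unary (a n + b n) :=
  (ha.append hb).congr fun _ => (QAuth.unary_add _ _).symm

theorem PolyTimeComputable.encodeNat {a : ℕ → ℕ} (ha : PolyTimeComputable fun n => unary (a n)) :
    PolyTimeComputable fun n => encodeNat (a n) :=
  ha.append (polyTimeComputable_const [.sep])

/-- The wires of a register that is moved by an offset. -/
theorem PolyTimeComputable.shift {k o : ℕ → ℕ} {x : ∀ n, Fin (k n) → ℕ}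
    (hx : PolyTimeComputable fun n => encodeList (List.ofFn (x n)))
    (ho : PolyTimeComputable fun n => unary (o n)) :
    PolyTimeComputable fun n => encodeList (List.ofFn fun i => o n + x n i) := by
  refine (hx.subst .sep ho.encodeNat).congr fun n => ?_
  refine (substWord_encodeList (o n) _).trans ?_
  rw [List.map_ofFn]
  simp only [Function.comp_def, Nat.add_comm]

theorem PolyTimeComputable.shiftGates {W : ℕ → Type} {o : ℕ → ℕ} {ν : ∀ n, W n → ℕ}
    {l : ∀ n, List (WGate (W n))} (hl : PolyTimeComputable fun n => gatesCode (ν n) (l n))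
    (ho : PolyTimeComputable fun n => unary (o n)) :
    PolyTimeComputable fun n => gatesCode (fun w => o n + ν n w) (l n) := by
  refine (hl.subst .sep ho.encodeNat).congr fun n => ?_
  refine (substWord_gatesCode (o n) (ν n) _).trans ?_
  simp only [Nat.add_comm]

/-- A register of `k` consecutive wires from `o` on. -/
theorem PolyTimeComputable.interval {o k : ℕ → ℕ} (ho : PolyTimeComputable fun n => unary (o n))
    (hk : PolyTimeComputable fun n => unary (k n)) :
    PolyTimeComputable fun n => encodeList (List.ofFn fun i : Fin (k n) => o n + (i : ℕ)) :=
  (ho.range hk).congr fun n => by rw [ofFn_add_eq_range']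

/-- The list that repeats a wire `k` times, for a control that is shared by many gates. -/
theorem PolyTimeComputable.repeated {c k : ℕ → ℕ} (hc : PolyTimeComputable fun n => unary (c n))
    (hk : PolyTimeComputable fun n => unary (k n)) :
    PolyTimeComputable fun n => encodeList (List.ofFn fun _ : Fin (k n) => c n) :=
  (hk.subst .one hc.encodeNat).congr fun n => substWord_unary (c n) (k n)

/-- The two parts of a register. -/
theorem PolyTimeComputable.split_ofFn {a b : ℕ → ℕ} {x : ∀ n, Fin (a n + b n) → ℕ}
    (hx : PolyTimeComputable fun n => encodeList (List.ofFn (x n)))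
    (ha : PolyTimeComputable fun n => unary (a n)) :
    (PolyTimeComputable fun n => encodeList (List.ofFn fun i => x n (Fin.castAdd (b n) i))) ∧
      PolyTimeComputable fun n => encodeList (List.ofFn fun j => x n (Fin.natAdd (a n) j)) := by
  refine PolyTimeComputable.split (k := a) (hx.congr fun n => ?_) (fun n => by simp) ha
  rw [encodeList_ofFn_add, encodeList_append]

theorem PolyTimeComputable.append_ofFn {a b : ℕ → ℕ} {x : ∀ n, Fin (a n + b n) → ℕ}
    (h : PolyTimeComputable fun n => encodeList (List.ofFn fun i => x n (Fin.castAdd (b n) i)))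
    (h' : PolyTimeComputable fun n => encodeList (List.ofFn fun j => x n (Fin.natAdd (a n) j))) :
    PolyTimeComputable fun n => encodeList (List.ofFn (x n)) :=
  (h.append h').congr fun _ => (encodeList_ofFn_add _).symm

/-- Three registers are turned into gates by a template. -/
theorem PolyTimeComputable.template_ofFn (T : Template) {k : ℕ → ℕ} {x y z : ∀ n, Fin (k n) → ℕ}
    (hx : PolyTimeComputable fun n => encodeList (List.ofFn (x n)))
    (hy : PolyTimeComputable fun n => encodeList (List.ofFn (y n)))
    (hz : PolyTimeComputable fun n => encodeList (List.ofFn (z n))) :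
    PolyTimeComputable fun n =>
      (List.finRange (k n)).flatMap fun j => T.expand ![x n j, y n j, z n j] := by
  refine (PolyTimeComputable.template T
    (l := fun n => (List.finRange (k n)).map fun j => ![x n j, y n j, z n j])
    (hx.congr fun n => ?_) (hy.congr fun n => ?_) (hz.congr fun n => ?_)).congr fun n =>
      List.flatMap_map _ _ _
  all_goals
    rw [List.map_map, List.ofFn_eq_map]
    rfl

/-! ### The ideal world is efficient -/

/-- A numbering of the wires of the ideal circuit: first the wires of the circuit for the fixed
state, then those of the attack, then `C₂`, the message, and the flags. -/
def numbering (a b m n k : ℕ) :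
    Fin a ⊕ (Fin b ⊕ (Fin m ⊕ (Fin n ⊕ Fin k))) ≃ Fin (a + (b + (m + (n + k)))) :=
  ((Equiv.refl _).sumCongr (((Equiv.refl _).sumCongr (((Equiv.refl _).sumCongr
    finSumFinEquiv).trans finSumFinEquiv)).trans finSumFinEquiv)).trans finSumFinEquiv

section Circuit
variable {m n r : ℕ}

/-- The circuit of the ideal world, for circuits `Q` that prepares the fixed state and `P` that
performs the attack. -/
def idealCircuit (Q : Circuit 0 n) (P : Circuit (m + r) (m + r)) : Circuit (n + r) (n + r + 1) :=
  circuitOf (numbering Q.N P.N m n (m + m + 1))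
    ((idealIn m n r).trans (initialWires (Fin Q.N) P.input))
    (idealGates Q.output (Q.gates.map Gate.toWGate) P.input P.output (P.gates.map Gate.toWGate))
    ((idealOut m n r).trans (finalWires Q.output P.output))

theorem attackMap_eq (U : Matrix.unitaryGroup (Qubits m × Qubits r) ℂ) (X : Op (Qubits (m + r))) :
    attackMap U X = Matrix.reindex (join m r) (join m r) U.1 * X *
      (Matrix.reindex (join m r) (join m r) U.1)ᴴ := by
  have h := (Matrix.reindex (join m r) (join m r)).apply_symm_apply X
  change Matrix.reindexAlgEquiv ℂ ℂ (join m r) (U.1 * _ * U.1ᴴ) = _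
  rw [map_mul, map_mul]
  refine congrArg₂ _ (congrArg₂ _ rfl ?_) rfl
  exact h

/-- The circuit of the ideal world performs the ideal channel. -/
theorem idealCircuit_channel {Ω : Op (Qubits n)} (hΩ : Ω.trace = 1)
    (U : Matrix.unitaryGroup (Qubits m × Qubits r) ℂ) {Q : Circuit 0 n}
    {P : Circuit (m + r) (m + r)} (hQ : ∀ Y, Q.channel Y = Y.trace • Ω)
    (hP : ∀ Y, P.channel Y = attackMap U Y) (X : Op (Qubits (n + r))) :
    (idealCircuit Q P).channel X = idealMap Ω (simAcc U) (simRej U) X := by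
  rw [idealCircuit, circuitOf_channel,
    traceWires_idealGates (ιΩ := Q.input) (Ω := Ω)
      (U := Matrix.reindex (join m r) (join m r) U.1), traceWires_finalGates Ω hΩ]
  · intro Y
    rw [← hQ, Circuit.channel_eq]
  · intro Y
    rw [← attackMap_eq, ← hP, Circuit.channel_eq]

end Circuit

section Codes
variable {m n r : ℕ} {WΩ WU : Type} [Fintype WΩ] [Fintype WU] [DecidableEq WΩ] [DecidableEq WU]

/-- The gates `pairGates`; the wires are those of `C₂` and of `C₁`, and the third is not used. -/
def eprTemplate : Template :=
  [.inl (.gate .hadamard), .inr 0, .inl (.gate .cnot), .inr 0, .inr 1]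

/-- The gates `unpairGates`, with wires as in `eprTemplate`. -/
def bellTemplate : Template :=
  [.inl (.gate .cnot), .inr 0, .inr 1, .inl (.gate .hadamard), .inr 0]

/-- The gates `andStepGates`; the wires are the bit, the old flag and the new flag. -/
def andTemplate : Template :=
  [.inl (.gate .not), .inr 0, .inl (.gate .toffoli), .inr 0, .inr 1, .inr 2]

/-- The gates `swapStepGates`; the wires are the control and the two wires to be swapped. -/
def swapTemplate : Template :=
  [.inl (.gate .cnot), .inr 2, .inr 1, .inl (.gate .toffoli), .inr 0, .inr 1, .inr 2,
    .inl (.gate .cnot), .inr 2, .inr 1]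

theorem gatesCode_eprGates (ν : Fin m ⊕ Fin m → ℕ) : gatesCode ν (eprGates m) =
    (List.finRange m).flatMap fun j =>
      eprTemplate.expand ![ν (.inr j), ν (.inl j), ν (.inl j)] := by
  rw [eprGates, gatesCode_flatMap]
  congr 1
  funext j
  rw [pairGates, gatesCode_cons, gatesCode_hadamardGate, gatesCode_cnotGate]
  simp [eprTemplate, Template.expand]

theorem gatesCode_bellGates (ν : Fin m ⊕ Fin m → ℕ) : gatesCode ν (bellGates m) =
    (List.finRange m).flatMap fun j =>
      bellTemplate.expand ![ν (.inr j), ν (.inl j), ν (.inl j)] := by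
  rw [bellGates, gatesCode_flatMap]
  congr 1
  funext j
  rw [unpairGates, gatesCode_cons, gatesCode_hadamardGate, gatesCode_cnotGate]
  simp [bellTemplate, Template.expand]

theorem gatesCode_andGates {W : Type} [Fintype W] [DecidableEq W] {K : ℕ} (ν : W → ℕ)
    (b : Fin K → W) (f : Fin (K + 1) → W) (hf : Function.Injective f) (hbf : ∀ i j, b i ≠ f j) :
    gatesCode ν (andGates b f hf hbf) = .gate .not :: (encodeNat (ν (f 0)) ++
      (List.finRange K).flatMap fun j =>
        andTemplate.expand ![ν (b j), ν (f j.castSucc), ν (f j.succ)]) := by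
  rw [andGates, gatesCode_cons, gatesCode_notGate, gatesCode_flatMap]
  refine congrArg (fun l => Sym.gate .not :: encodeNat (ν (f 0)) ++ l) ?_
  congr 1
  funext j
  rw [andStepGates, gatesCode_cons, gatesCode_notGate, gatesCode_toffoliGate]
  simp [andTemplate, Template.expand]

theorem gatesCode_swapGates {W : Type} [Fintype W] [DecidableEq W] (ν : W → ℕ) (c : W)
    (a b : Fin n → W) (hab : ∀ i j, a i ≠ b j) (hca : ∀ j, c ≠ a j) (hcb : ∀ j, c ≠ b j) :
    gatesCode ν (swapGates c a b hab hca hcb) =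
      (List.finRange n).flatMap fun j => swapTemplate.expand ![ν c, ν (a j), ν (b j)] := by
  rw [swapGates, gatesCode_flatMap]
  congr 1
  funext j
  rw [swapStepGates, gatesCode_cons, gatesCode_cons _ (toffoliGate _ _ _ _ _ _),
    gatesCode_cnotGate, gatesCode_toffoliGate]
  simp [swapTemplate, Template.expand]

theorem bitWire_castAdd (i : Fin m) :
    bitWire m n r (Fin.castAdd m i) = .inr (.inl (Fin.castAdd r i)) := by
  rw [bitWire, finSumFinEquiv_symm_apply_castAdd]
  rfl

theorem bitWire_natAdd (i : Fin m) : bitWire m n r (Fin.natAdd m i) = .inr (.inr (.inl i)) := by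
  rw [bitWire, finSumFinEquiv_symm_apply_natAdd]
  rfl

end Codes

/-- The circuits of the ideal world are as uniform as those they are made of. -/
theorem polyTimeComputable_idealCircuit {m r : ℕ → ℕ}
    (hm : PolyTimeComputable fun n => unary (m n)) {Q : ∀ n, Circuit 0 n}
    {P : ∀ n, Circuit (m n + r n) (m n + r n)} (hQ : PolyTimeComputable fun n => (Q n).encode)
    (hP : PolyTimeComputable fun n => (P n).encode) :
    PolyTimeComputable fun n => (idealCircuit (Q n) (P n)).encode := by
  obtain ⟨hQN, -, hQg, hQo⟩ := PolyTimeComputable.circuit hQ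
  obtain ⟨hPN, hPi, hPg, hPo⟩ := PolyTimeComputable.circuit hP
  have hn := polyTimeComputable_unary
  have hone := polyTimeComputable_const (unary 1)
  have hmm := hm.unary_add hm
  -- the registers on which the subcircuits act
  obtain ⟨hC1in, hRin⟩ := (hPi.shift hQN).split_ofFn hm
  obtain ⟨hC1out, hRout⟩ := (hPo.shift hQN).split_ofFn hm
  -- the other registers, each after the one before it
  have hC2 := ((PolyTimeComputable.interval (polyTimeComputable_const (unary 0)) hm).shift
    hPN).shift hQN
  have hM := (((PolyTimeComputable.interval (polyTimeComputable_const (unary 0)) hn).shift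
    hm).shift hPN).shift hQN
  have hflags (c : ℕ) := ((((PolyTimeComputable.interval (polyTimeComputable_const (unary c))
    hmm).shift hn).shift hm).shift hPN).shift hQN
  have hlast := hQN.unary_add (hPN.unary_add (hm.unary_add (hn.unary_add hmm)))
  have hfirst := hQN.unary_add (hPN.unary_add (hm.unary_add hn))
  have hbits : PolyTimeComputable fun n => encodeList (List.ofFn fun i : Fin (m n + m n) =>
      (numbering (Q n).N (P n).N (m n) n (m n + m n + 1)
        (finalWires (Q n).output (P n).output (bitWire (m n) n (r n) i)) : ℕ)) := by
    refine .append_ofFn (hC1out.congr fun n => ?_) (hC2.congr fun n => ?_)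
    · simp only [bitWire_castAdd]
      rfl
    · simp only [bitWire_natAdd, Nat.zero_add]
      rfl
  have hgates : PolyTimeComputable fun n =>
      gatesCode (fun w => (numbering (Q n).N (P n).N (m n) n (m n + m n + 1) w : ℕ))
        (idealGates (r := r n) (Q n).output ((Q n).gates.map Gate.toWGate) (P n).input
          (P n).output ((P n).gates.map Gate.toWGate)) := by
    have hepr := PolyTimeComputable.template_ofFn eprTemplate hC2 hC1in hC1in
    have hbell := PolyTimeComputable.template_ofFn bellTemplate hC2 hC1out hC1out
    have hand := PolyTimeComputable.template_ofFn andTemplate hbits (hflags 0) (hflags 1)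
    have hswap := PolyTimeComputable.template_ofFn swapTemplate (hlast.repeated hn) hM hQo
    refine (((hepr.append (hPg.shiftGates hQN)).append hQg).append (hbell.append
      (((polyTimeComputable_const [.gate .not]).append (hfirst.encodeNat.append hand)).append
        hswap))).congr fun n => ?_
    rw [idealGates, gatesCode_append, gatesCode_append, gatesCode_append, gatesCode_map,
      gatesCode_map, gatesCode_map, gatesCode_map, gatesCode_eprGates, finalGates,
      gatesCode_append, gatesCode_map, gatesCode_bellGates, choiceGates, gatesCode_append,
      gatesCode_andGates, gatesCode_swapGates]
    simp only [Nat.zero_add, Nat.add_comm 1]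
    rfl
  have hin : PolyTimeComputable fun n => encodeList (List.ofFn fun i : Fin (n + r n) =>
      (numbering (Q n).N (P n).N (m n) n (m n + m n + 1)
        ((idealIn (m n) n (r n)).trans (initialWires (Fin (Q n).N) (P n).input) i) : ℕ)) := by
    refine .append_ofFn (hM.congr fun n => ?_) (hRin.congr fun n => ?_)
    · simp only [Function.Embedding.trans_apply, idealIn_castAdd, Nat.zero_add]
      rfl
    · simp only [Function.Embedding.trans_apply, idealIn_natAdd]
      rfl
  have hout : PolyTimeComputable fun n => encodeList (List.ofFn fun i : Fin (n + r n + 1) =>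
      (numbering (Q n).N (P n).N (m n) n (m n + m n + 1)
        ((idealOut (m n) n (r n)).trans (finalWires (Q n).output (P n).output) i) : ℕ)) := by
    refine .append_ofFn (.append_ofFn (hQo.congr fun n => ?_) (hRout.congr fun n => ?_))
      (hlast.encodeNat.congr fun n => ?_)
    · simp only [Function.Embedding.trans_apply, idealOut_state]
      rfl
    · simp only [Function.Embedding.trans_apply, idealOut_reference]
      rfl
    · simp only [Function.Embedding.trans_apply, idealOut_flag]
      exact (List.append_nil _).symm
  have hN := hQN.unary_add (hPN.unary_add (hm.unary_add (hn.unary_add (hmm.unary_add hone))))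
  have hmark := polyTimeComputable_const [.mark]
  exact (hN.append ((polyTimeComputable_const [.sep]).append (hin.append (hmark.append
    (hgates.append (hmark.append (hout.append hmark))))))).congr fun n =>
      (circuitOf_encode _ _ _ _).symm

end QAuth

end

theorem mainTheorem1 (d : ℕ → ℕ) (Ω : ∀ n, QAuth.Op (QAuth.Qubits n))
    (hΩ : ∀ n, QAuth.IsDensity (Ω n)) :
    -- the Clifford code is an authentication scheme
    (∀ n, (QAuth.cliffordCode n (d n) (Ω n)).IsAuthenticationScheme) ∧
    -- for every attack, the real world is close to the ideal world of the EPR simulator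
    (∀ (n : ℕ) (R : Type) [Fintype R] [DecidableEq R]
      (U : Matrix.unitaryGroup (QAuth.Qubits (n + d n) × R) ℂ),
      QAuth.IsSimulator (QAuth.simAcc U) (QAuth.simRej U) ∧
      ∀ ρ : QAuth.Op (QAuth.Qubits n × R), QAuth.IsDensity ρ →
        QAuth.traceDist ((QAuth.cliffordCode n (d n) (Ω n)).realAverage U ρ)
          (QAuth.ideal (Ω n) (QAuth.simAcc U) (QAuth.simRej U) ρ) ≤ 3 / 2 ^ d n) ∧
    -- the ideal world of this simulator is efficient whenever the attack is
    (QAuth.PolyTimeComputable (fun n => QAuth.unary (d n)) → QAuth.PolyTimeGenerated Ω →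
      ∀ (r : ℕ → ℕ)
        (U : ∀ n, Matrix.unitaryGroup (QAuth.Qubits (n + d n) × QAuth.Qubits (r n)) ℂ),
        QAuth.PolyTime (fun n => QAuth.attackMap (U n)) →
        QAuth.PolyTime
          (fun n => QAuth.idealMap (Ω n) (QAuth.simAcc (U n)) (QAuth.simRej (U n)))) := by
  refine ⟨fun n => QAuth.cliffordCode_isAuthenticationScheme n (d n) (hΩ n), ?_, ?_⟩
  · intro n R _ _ U
    exact ⟨QAuth.isSimulator U, fun ρ hρ => QAuth.cliffordCode_secure (hΩ n) U hρ⟩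
  · rintro hd ⟨Q, hQ, hQΩ⟩ r U ⟨P, hP, hPU⟩
    exact ⟨fun n => QAuth.idealCircuit (Q n) (P n),
      QAuth.polyTimeComputable_idealCircuit (QAuth.polyTimeComputable_unary.unary_add hd) hQ hP,
      fun n X => QAuth.idealCircuit_channel (hΩ n).2 (U n) (hQΩ n) (hPU n) X⟩
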